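/- **Theorem (Hirota bilinear form of the periodic non-chiral ILW equation).** Let $L>0$, $\delta>0$. For $\delta'>0$ put $$\zeta_1(z|L/2,\mathrm i\delta')=\frac{\pi}{L}\lim_{M\to\infty}\sum_{n=-M}^{M}\cot\Big(\frac{\pi}{L}(z-2\mathrm i n\delta')\Big),$$ and for $L$-periodic $f:\mathbb R\to\mathbb C$ put $$(Tf)(x)=\frac1\pi\,\mathrm{p.v.}\!\!\int_{-L/2}^{L/2}\zeta_1(x'-x|L/2,\mathrm i\delta)f(x')\,\mathrm dx',\qquad (\tilde Tf)(x)=\frac1\pi\int_{-L/2}^{L/2}\zeta_1(x'-x+\mathrm i\delta|L/2,\mathrm i\delta)f(x')\,\mathrm dx'.$$ The periodic non-chiral ILW (ncILW) equation for $u,v:\mathbb R^2\to\mathbb C$ is $$u_t+2uu_x+Tu_{xx}+\tilde Tv_{xx}=0,\qquad v_t-2vv_x-Tv_{xx}-\tilde Tu_{xx}=0 .$$ For a function $F(z,t)$ write $F^\pm(x,t)=F(x\pm\mathrm i\delta/2,t)$, and let $D_xf\cdot g=f_xg-fg_x$, $D_x^2f\cdot g=f_{xx}g-2f_xg_x+fg_{xx}$,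 $D_tf\cdot g=f_tg-fg_t$. For $\bar u,\bar v\in\mathbb C$ and $\lambda_1,\lambda_2:\mathbb R\to\mathbb C$ the Hirota system is $$\big(\mathrm iD_t-D_x^2+2\mathrm i\bar uD_x-\lambda_1(t)+\bar u^2\big)F^-\cdot G^+=0,\qquad \big(\mathrm iD_t-D_x^2-2\mathrm i\bar vD_x-\lambda_2(t)+\bar v^2\big)F^+\cdot G^-=0. \tag{H}$$ **(A)** Let $F(z,t)$, $G(z,t)$ be $L$-periodic in $z$ such that, for every $t\in\mathbb R$, $\log F(\cdot,t)$ and $\log G(\cdot,t)$ are analytic for $|\mathrm{Im}\,z|<\delta/2$ and continuous for $|\mathrm{Im}\,z|\le\delta/2$, and such that $F^\pm,G^\pm$ are $C^4$ functions of $(x,t)\in\mathbb R^2$. Let $\bar u,\bar v\in\mathbb C$. Then there are functions $\lambda_1,\lambda_2:\mathbb R\to\mathbb C$ such that $F,G$ satisfy (H) if and only if $$u=\bar u+\mathrm i\,\partial_x\log\frac{F^-}{G^+},\qquad v=\bar v+\mathrm i\,\partial_x\log\frac{G^-}{F^+}\tag{1}$$ satisfy the ncILW equation. **(B)** Let $u,v$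 be solutions of the ncILW equation of class $C^3$ on $\mathbb R^2$ and $L$-periodic in $x$, and let $\bar u,\bar v$ be their spatial means over a period at $t=0$. Then $\bar u,\bar v$ are their means at every time $t$. Put $$u_\pm=\tfrac12(u-\bar u)\mp\tfrac{\mathrm i}{2}\big(T(u-\bar u)+\tilde T(v-\bar v)\big),\qquad v_\pm=\tfrac12(v-\bar v)\pm\tfrac{\mathrm i}{2}\big(T(v-\bar v)+\tilde T(u-\bar u)\big).$$ There are $F(z,t)$, $G(z,t)$ such that, for every $t$, $\log F(\cdot,t)$ and $\log G(\cdot,t)$ are analytic for $|\mathrm{Im}\,z|<\delta/2$, continuous for $|\mathrm{Im}\,z|\le\delta/2$, and, for $|\mathrm{Im}\,z|<\delta/2$, $$\mathrm i\,\partial_z\log F(z,t)=\frac1{2\pi\mathrm i}\int_{-L/2}^{L/2}\zeta_1\big(x'-z-\tfrac{\mathrm i\delta}2\big|L/2,\tfrac{\mathrm i\delta}2\big)\,(u_++v_+)(x',t)\,\mathrm dx',$$ $$\mathrm i\,\partial_z\log G(z,t)=\frac1{2\pi\mathrm i}\int_{-L/2}^{L/2}\zeta_1\big(x'-z-\tfrac{\mathrm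 i\delta}2\big|L/2,\tfrac{\mathrm i\delta}2\big)\,(u_-+v_-)(x',t)\,\mathrm dx'.$$ They can be chosen with arbitrary non-vanishing values $F(0,t)$, $G(0,t)$, and each is unique for $|\mathrm{Im}\,z|\le\delta/2$ up to multiplication by a non-vanishing function of $t$. For every such pair with $F(0,t)$, $G(0,t)$ differentiable in $t$: $F$ and $G$ are $L$-periodic for $|\mathrm{Im}\,z|\le\delta/2$; $F^\pm,G^\pm$ are $C^2$ in $x$ and differentiable in $t$; $u_+-u_-$ and $v_+-v_-$ are differentiable in $x$; (1) holds; the expressions $$\lambda_1=\mathrm i\Big(\log\frac{F^-}{G^+}\Big)_t+u^2+\mathrm i(u_+-u_-)_x,\qquad \lambda_2=\mathrm i\Big(\log\frac{F^+}{G^-}\Big)_t+v^2-\mathrm i(v_+-v_-)_x$$ depend on $t$ only; and (H) holds with these $\lambda_1,\lambda_2$. -/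

import Mathlib

open Complex Filter Topology
open scoped Real

namespace NcILW

noncomputable section

/-- The modified Weierstrass zeta function `ζ₁(z | L/2, iδ)`, with periods `L` and `2iδ`:
`(π/L) lim_{M → ∞} ∑_{n=-M}^{M} cot ((π/L) (z - 2 i n δ))`. -/
def zeta1 (L δ : ℝ) (z : ℂ) : ℂ :=
  (π / L : ℂ) * limUnder atTop (fun M : ℕ =>
    ∑ n ∈ Finset.Icc (-(M : ℤ)) (M : ℤ), Complex.cot ((π / L : ℂ) * (z - 2 * I * n * δ)))

/-- Truncated integral for the principal value in `T`. The arguments `f` of `T` are `L`-periodic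
and `ζ₁` has period `L`, so the integral over `[-L/2, L/2]` (a full period of the circle) is
written over the period `[x - L/2, x + L/2]` centred at the pole. -/
def truncT (L δ : ℝ) (f : ℝ → ℂ) (x ε : ℝ) : ℂ :=
  (1 / π : ℂ) * ((∫ y in (x - L / 2)..(x - ε), zeta1 L δ ((y - x : ℝ) : ℂ) * f y) +
    ∫ y in (x + ε)..(x + L / 2), zeta1 L δ ((y - x : ℝ) : ℂ) * f y)

/-- The principal value integral that defines `(T f)(x)` converges. -/
def TConverges (L δ : ℝ) (f : ℝ → ℂ) (x : ℝ) : Prop :=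
  ∃ l : ℂ, Tendsto (truncT L δ f x) (𝓝[>] 0) (𝓝 l)

/-- `(T f)(x) = (1/π) p.v.∫ ζ₁(x' - x | L/2, iδ) f(x') dx'`. -/
def opT (L δ : ℝ) (f : ℝ → ℂ) (x : ℝ) : ℂ :=
  limUnder (𝓝[>] (0 : ℝ)) (truncT L δ f x)

/-- `(T̃ f)(x) = (1/π) ∫ ζ₁(x' - x + iδ | L/2, iδ) f(x') dx'`. -/
def opTt (L δ : ℝ) (f : ℝ → ℂ) (x : ℝ) : ℂ :=
  (1 / π : ℂ) * ∫ y in (-(L / 2))..(L / 2), zeta1 L δ (((y - x : ℝ) : ℂ) + I * δ) * f y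

/-- The spatial mean over one period. -/
def mean (L : ℝ) (f : ℝ → ℂ) : ℂ := (1 / L : ℂ) * ∫ x in (-(L / 2))..(L / 2), f x

/-- First and second spatial derivatives and the time derivative of `u = u(x, t)`. -/
def dx (u : ℝ → ℝ → ℂ) (x t : ℝ) : ℂ := deriv (fun y => u y t) x

/-- Second spatial derivative. -/
def dxx (u : ℝ → ℝ → ℂ) (x t : ℝ) : ℂ := deriv (fun y => dx u y t) x

/-- Time derivative. -/
def dt (u : ℝ → ℝ → ℂ) (x t : ℝ) : ℂ := deriv (fun s => u x s) t

/-- `(u, v)` satisfies the ncILW equation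
`u_t + 2 u u_x + T u_xx + T̃ v_xx = 0`, `v_t - 2 v v_x - T v_xx - T̃ u_xx = 0`,
all principal value integrals being convergent. -/
def SolvesNcILW (L δ : ℝ) (u v : ℝ → ℝ → ℂ) : Prop :=
  ∀ x t : ℝ,
    TConverges L δ (fun y => dxx u y t) x ∧ TConverges L δ (fun y => dxx v y t) x ∧
    dt u x t + 2 * u x t * dx u x t + opT L δ (fun y => dxx u y t) x
      + opTt L δ (fun y => dxx v y t) x = 0 ∧
    dt v x t - 2 * v x t * dx v x t - opT L δ (fun y => dxx v y t) x
      - opTt L δ (fun y => dxx u y t) x = 0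

/-- `-δ/2 < Im z < δ/2`. -/
def openStrip (δ : ℝ) : Set ℂ := {z | -(δ / 2) < z.im ∧ z.im < δ / 2}

/-- `-δ/2 ≤ Im z ≤ δ/2`. -/
def closedStrip (δ : ℝ) : Set ℂ := {z | -(δ / 2) ≤ z.im ∧ z.im ≤ δ / 2}

/-- `log F` is analytic in the open strip and continuous on the closed strip. -/
def HasAnalyticLog (δ : ℝ) (F : ℂ → ℂ) : Prop :=
  ∃ f : ℂ → ℂ, (∀ z ∈ closedStrip δ, F z = exp (f z)) ∧
    DifferentiableOn ℂ f (openStrip δ) ∧ ContinuousOn f (closedStrip δ)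

/-- `F⁺(x, t) = F(x + iδ/2, t)`. -/
def bdryPlus (δ : ℝ) (F : ℂ → ℝ → ℂ) (x t : ℝ) : ℂ := F ((x : ℂ) + I * (δ / 2)) t

/-- `F⁻(x, t) = F(x - iδ/2, t)`. -/
def bdryMinus (δ : ℝ) (F : ℂ → ℝ → ℂ) (x t : ℝ) : ℂ := F ((x : ℂ) - I * (δ / 2)) t

/-- Hirota derivative `D_x f · g = f_x g - f g_x`. -/
def hirotaDx (f g : ℝ → ℝ → ℂ) (x t : ℝ) : ℂ := dx f x t * g x t - f x t * dx g x t

/-- Hirota derivative `D_x² f · g = f_xx g - 2 f_x g_x + f g_xx`. -/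
def hirotaDxx (f g : ℝ → ℝ → ℂ) (x t : ℝ) : ℂ :=
  dxx f x t * g x t - 2 * dx f x t * dx g x t + f x t * dxx g x t

/-- Hirota derivative `D_t f · g = f_t g - f g_t`. -/
def hirotaDt (f g : ℝ → ℝ → ℂ) (x t : ℝ) : ℂ := dt f x t * g x t - f x t * dt g x t

/-- The bilinear system
`(i D_t - D_x² + 2 i ū D_x - λ₁(t) + ū²) F⁻ · G⁺ = 0`,
`(i D_t - D_x² - 2 i v̄ D_x - λ₂(t) + v̄²) F⁺ · G⁻ = 0`. -/
def HirotaSystem (δ : ℝ) (ubar vbar : ℂ) (lam1 lam2 : ℝ → ℂ) (F G : ℂ → ℝ → ℂ) : Prop :=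
  ∀ x t : ℝ,
    I * hirotaDt (bdryMinus δ F) (bdryPlus δ G) x t
      - hirotaDxx (bdryMinus δ F) (bdryPlus δ G) x t
      + 2 * I * ubar * hirotaDx (bdryMinus δ F) (bdryPlus δ G) x t
      + (-lam1 t + ubar ^ 2) * (bdryMinus δ F x t * bdryPlus δ G x t) = 0 ∧
    I * hirotaDt (bdryPlus δ F) (bdryMinus δ G) x t
      - hirotaDxx (bdryPlus δ F) (bdryMinus δ G) x t
      - 2 * I * vbar * hirotaDx (bdryPlus δ F) (bdryMinus δ G) x t
      + (-lam2 t + vbar ^ 2) * (bdryPlus δ F x t * bdryMinus δ G x t) = 0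

/-- `u = ū + i ∂ₓ log (F⁻ / G⁺)`. -/
def uOfFG (δ : ℝ) (ubar : ℂ) (F G : ℂ → ℝ → ℂ) (x t : ℝ) : ℂ :=
  ubar + I * logDeriv (fun y : ℝ => bdryMinus δ F y t / bdryPlus δ G y t) x

/-- `v = v̄ + i ∂ₓ log (G⁻ / F⁺)`. -/
def vOfFG (δ : ℝ) (vbar : ℂ) (F G : ℂ → ℝ → ℂ) (x t : ℝ) : ℂ :=
  vbar + I * logDeriv (fun y : ℝ => bdryMinus δ G y t / bdryPlus δ F y t) x

/-- The function `x ↦ T(f - f̄)(x) + T̃(g - ḡ)(x)` at time `t`. -/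
def TTt (L δ : ℝ) (fbar gbar : ℂ) (f g : ℝ → ℝ → ℂ) (x t : ℝ) : ℂ :=
  opT L δ (fun y => f y t - fbar) x + opTt L δ (fun y => g y t - gbar) x

/-- `u₊ = (u - ū)/2 - (i/2) (T(u - ū) + T̃(v - v̄))`. -/
def uPlus (L δ : ℝ) (ubar vbar : ℂ) (u v : ℝ → ℝ → ℂ) (x t : ℝ) : ℂ :=
  (u x t - ubar) / 2 - I / 2 * TTt L δ ubar vbar u v x t

/-- `u₋ = (u - ū)/2 + (i/2) (T(u - ū) + T̃(v - v̄))`. -/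
def uMinus (L δ : ℝ) (ubar vbar : ℂ) (u v : ℝ → ℝ → ℂ) (x t : ℝ) : ℂ :=
  (u x t - ubar) / 2 + I / 2 * TTt L δ ubar vbar u v x t

/-- `v₊ = (v - v̄)/2 + (i/2) (T(v - v̄) + T̃(u - ū))`. -/
def vPlus (L δ : ℝ) (ubar vbar : ℂ) (u v : ℝ → ℝ → ℂ) (x t : ℝ) : ℂ :=
  (v x t - vbar) / 2 + I / 2 * TTt L δ vbar ubar v u x t

/-- `v₋ = (v - v̄)/2 - (i/2) (T(v - v̄) + T̃(u - ū))`. -/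
def vMinus (L δ : ℝ) (ubar vbar : ℂ) (u v : ℝ → ℝ → ℂ) (x t : ℝ) : ℂ :=
  (v x t - vbar) / 2 - I / 2 * TTt L δ vbar ubar v u x t

/-- `log F(·, t)` is analytic for `|Im z| < δ/2`, continuous for `|Im z| ≤ δ/2`, and
`i ∂_z log F(z, t) = (1/(2πi)) ∫ ζ₁(x' - z - iδ/2 | L/2, iδ/2) J(x', t) dx'` for `|Im z| < δ/2`. -/
def IsHirotaPotential (L δ : ℝ) (J : ℝ → ℝ → ℂ) (F : ℂ → ℝ → ℂ) : Prop :=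
  ∀ t : ℝ, HasAnalyticLog δ (fun z => F z t) ∧
    ∀ z ∈ openStrip δ, I * logDeriv (fun w => F w t) z =
      1 / (2 * π * I) * ∫ y in (-(L / 2))..(L / 2),
        zeta1 L (δ / 2) ((y : ℂ) - z - I * (δ / 2)) * J y t

/-- `F(·, t)` is `L`-periodic on the closed strip. -/
def StripPeriodic (L δ : ℝ) (F : ℂ → ℝ → ℂ) : Prop :=
  ∀ t : ℝ, ∀ z ∈ closedStrip δ, F (z + L) t = F z t

/-- The boundary values `F^±` are `C^n` functions of `(x, t) ∈ ℝ²`. -/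
def BdryContDiff (δ : ℝ) (n : ℕ) (F : ℂ → ℝ → ℂ) : Prop :=
  ContDiff ℝ n (fun p : ℝ × ℝ => bdryPlus δ F p.1 p.2) ∧
    ContDiff ℝ n (fun p : ℝ × ℝ => bdryMinus δ F p.1 p.2)

/-- The boundary values `F^±` are `C²` in `x` and differentiable in `t`, so that all derivatives
in the bilinear system exist. -/
def BdryRegular (δ : ℝ) (F : ℂ → ℝ → ℂ) : Prop :=
  (∀ t : ℝ, ContDiff ℝ 2 (fun x => bdryPlus δ F x t) ∧
    ContDiff ℝ 2 (fun x => bdryMinus δ F x t)) ∧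
  ∀ x : ℝ, Differentiable ℝ (fun t => bdryPlus δ F x t) ∧
    Differentiable ℝ (fun t => bdryMinus δ F x t)

end

end NcILW

/-!
On Fourier coefficients, `T` and `T̃` are the multipliers `i coth (2πnδ/L)` and `i / sinh (2πnδ/L)`,
which encode how the boundary values at `x ± iδ/2` of a periodic function analytic in the strip
determine each other: on such boundary values `T` and `T̃` combine to multiplication by constants.
Taking the boundary values of `∂ₓ log F` and `∂ₓ log G` turns the nonlocal terms of the ncILW
equation into `∂ₓ²` of the logarithms of `F^±` and `G^±`. Dividing a bilinear equation by `F^∓ G^±`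
likewise equates a local expression in these logarithms to `λ(t)`; the `x`-derivative of that
expression is, up to sign, the left-hand side of an ncILW equation, so the expression is a function
of `t` alone precisely when that equation holds. Conversely, `u_±` and `v_±` recombine into boundary
values of functions analytic in the strip, and `F` and `G` are the exponentials of the primitives of
these functions.
-/

namespace NcILW

noncomputable section

/-! ### Fourier coefficients and trigonometric series -/

/-- The Fourier mode `exp (2πi n z / L)`, on the whole complex plane. -/
def mode (L : ℝ) (n : ℤ) (z : ℂ) : ℂ := exp (2 * π * I * n * z / L)

/-- The `n`-th Fourier coefficient of an `L`-periodic function. Unlike Mathlib's `fourierCoeff` it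
is taken of a function on `ℝ`. -/
def fcoeff (L : ℝ) (h : ℝ → ℂ) (n : ℤ) : ℂ :=
  (1 / L : ℂ) * ∫ x in (-(L / 2))..(L / 2), h x * mode L (-n) x

/-- The trigonometric series with coefficients `a`. A Fourier multiplier with symbol `m` is
`h ↦ trigSeries L (m * fcoeff L h)`. -/
def trigSeries (L : ℝ) (a : ℤ → ℂ) (z : ℂ) : ℂ := ∑' n : ℤ, a n * mode L n z

/-- The symbol `2πi n / L` of the derivative. -/
def derivSymbol (L : ℝ) (n : ℤ) : ℂ := 2 * π * I * n / L

section Mode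

variable (L : ℝ) (n : ℤ)

theorem mode_zero_left (z : ℂ) : mode L 0 z = 1 := by simp [mode]

theorem mode_zero_right : mode L n 0 = 1 := by simp [mode]

theorem mode_add (z w : ℂ) : mode L n (z + w) = mode L n z * mode L n w := by
  rw [mode, mode, mode, ← Complex.exp_add]; congr 1; ring

theorem mode_mul_mode (m : ℤ) (z : ℂ) : mode L n z * mode L m z = mode L (n + m) z := by
  rw [mode, mode, mode, ← Complex.exp_add]; congr 1; push_cast; ring

theorem mode_neg_right (z : ℂ) : mode L n (-z) = mode L (-n) z := by
  rw [mode, mode]; congr 1; push_cast; ring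

theorem norm_mode (z : ℂ) : ‖mode L n z‖ = Real.exp (-(2 * π * n / L * z.im)) := by
  have h : 2 * π * I * n * z / L = ((2 * π * n / L : ℝ) : ℂ) * (I * z) := by push_cast; ring
  rw [mode, Complex.norm_exp, h, Complex.re_ofReal_mul]
  simp

@[simp]
theorem norm_mode_ofReal (x : ℝ) : ‖mode L n x‖ = 1 := by
  simp [norm_mode]

variable {L} in
theorem mode_add_period (hL : L ≠ 0) (z : ℂ) : mode L n (z + L) = mode L n z := by
  have hL' : (L : ℂ) ≠ 0 := by exact_mod_cast hL
  have hmode : mode L n L = 1 := by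
    rw [mode, Complex.exp_eq_one_iff]
    exact ⟨n, by field_simp⟩
  rw [mode_add, hmode, mul_one]

theorem hasDerivAt_mode (z : ℂ) : HasDerivAt (mode L n) (derivSymbol L n * mode L n z) z := by
  have h : HasDerivAt (fun w : ℂ => 2 * π * I * n * w / L) (derivSymbol L n) z := by
    simpa [derivSymbol] using ((hasDerivAt_id z).const_mul (2 * π * I * n : ℂ)).div_const (L : ℂ)
  rw [mul_comm]
  exact h.cexp

theorem continuous_mode : Continuous (mode L n) := by
  unfold mode; fun_prop

@[fun_prop]
theorem continuous_mode_ofReal : Continuous (fun x : ℝ => mode L n x) :=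
  (continuous_mode L n).comp continuous_ofReal

theorem fourier_coe_eq_mode (x : ℝ) : fourier n (x : AddCircle L) = mode L n x := by
  rw [fourier_coe_apply, mode]

theorem norm_derivSymbol : ‖derivSymbol L n‖ = 2 * π / |L| * |(n : ℝ)| := by
  simp only [derivSymbol, Complex.norm_div, Complex.norm_mul, Complex.norm_ofNat, norm_real,
    Real.norm_eq_abs, abs_of_pos Real.pi_pos, norm_I, Complex.norm_intCast]
  ring

end Mode

section Coefficients

variable {L : ℝ} {f g h : ℝ → ℂ}

theorem fourierCoeff_lift [Fact (0 < L)] (hp : Function.Periodic h L) (n : ℤ) :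
    fourierCoeff (hp.lift : AddCircle L → ℂ) n = fcoeff L h n := by
  have hL : -(L / 2) + L = L / 2 := by ring
  rw [fourierCoeff_eq_intervalIntegral _ _ (-(L / 2)), fcoeff, hL, Complex.real_smul]
  push_cast
  congr 1
  refine intervalIntegral.integral_congr fun x _ => ?_
  simp only [smul_eq_mul, fourier_coe_eq_mode, Function.Periodic.lift_coe, mul_comm]

theorem fcoeff_add (hf : Continuous f) (hg : Continuous g) :
    fcoeff L (fun x => f x + g x) = fcoeff L f + fcoeff L g := by
  ext n
  have hfm : Continuous fun x => f x * mode L (-n) x := by fun_prop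
  have hgm : Continuous fun x => g x * mode L (-n) x := by fun_prop
  simp only [fcoeff, Pi.add_apply, ← mul_add, add_mul]
  rw [intervalIntegral.integral_add (hfm.intervalIntegrable _ _) (hgm.intervalIntegrable _ _)]

theorem fcoeff_const_mul (c : ℂ) (f : ℝ → ℂ) (n : ℤ) :
    fcoeff L (fun x => c * f x) n = c * fcoeff L f n := by
  rw [fcoeff, fcoeff, mul_left_comm, ← intervalIntegral.integral_const_mul c]
  simp only [mul_assoc]

theorem fcoeff_sub (hf : Continuous f) (hg : Continuous g) :
    fcoeff L (fun x => f x - g x) = fcoeff L f - fcoeff L g := by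
  have hneg : fcoeff L (fun x => -1 * g x) = -fcoeff L g :=
    funext fun n => (fcoeff_const_mul _ _ n).trans (neg_one_mul _)
  rw [sub_eq_add_neg, ← hneg, ← fcoeff_add hf (by fun_prop)]
  simp only [neg_one_mul, sub_eq_add_neg]

theorem fcoeff_mode (hL : 0 < L) (m n : ℤ) :
    fcoeff L (fun x => mode L m x) n = if n = m then 1 else 0 := by
  have : Fact (0 < L) := ⟨hL⟩
  have hp : Function.Periodic (fun x : ℝ => mode L m x) L := fun x => by
    push_cast; exact mode_add_period m hL.ne' x
  have hlift : (hp.lift : AddCircle L → ℂ) = fourier m := by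
    funext y
    induction y using QuotientAddGroup.induction_on with
    | H x => exact (fourier_coe_eq_mode L m x).symm
  rw [← fourierCoeff_lift hp, hlift, fourierCoeff_fourier, Pi.single_apply]

theorem fcoeff_zero_eq_mean (L : ℝ) (f : ℝ → ℂ) : fcoeff L f 0 = mean L f := by
  simp [fcoeff, mean, mode_zero_left]

theorem fcoeff_const (hL : 0 < L) (c : ℂ) (n : ℤ) :
    fcoeff L (fun _ => c) n = if n = 0 then c else 0 := by
  have h := fcoeff_const_mul (L := L) c (fun x => mode L 0 x) n
  rw [fcoeff_mode hL] at h
  simpa only [mode_zero_left, mul_one, mul_ite, mul_zero] using h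

theorem norm_fcoeff_le (hL : 0 < L) {K : ℝ}
    (hK : ∀ x ∈ Set.Icc (-(L / 2)) (L / 2), ‖h x‖ ≤ K) (n : ℤ) : ‖fcoeff L h n‖ ≤ K := by
  have hint : ‖∫ x in (-(L / 2))..(L / 2), h x * mode L (-n) x‖ ≤ K * |L / 2 - -(L / 2)| := by
    refine intervalIntegral.norm_integral_le_of_norm_le_const fun x hx => ?_
    rw [norm_mul, norm_mode_ofReal, mul_one]
    rw [Set.uIoc_of_le (by linarith)] at hx
    exact hK x ⟨hx.1.le, hx.2⟩
  rw [show L / 2 - -(L / 2) = L by ring, abs_of_pos hL] at hint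
  rw [fcoeff, norm_mul, norm_div, norm_one, Complex.norm_real, Real.norm_of_nonneg hL.le,
    div_mul_eq_mul_div, one_mul, div_le_iff₀ hL]
  exact hint

theorem hasSum_fcoeff_mul_mode (hL : 0 < L) (hp : Function.Periodic h L) (hc : Continuous h)
    (hs : Summable fun n => ‖fcoeff L h n‖) (x : ℝ) :
    HasSum (fun n : ℤ => fcoeff L h n * mode L n x) (h x) := by
  have : Fact (0 < L) := ⟨hL⟩
  let lift : C(AddCircle L, ℂ) := ⟨hp.lift, continuous_coinduced_dom.mpr hc⟩
  have hcoeff : fourierCoeff lift = fcoeff L h := funext (fourierCoeff_lift hp)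
  have hsum := has_pointwise_sum_fourier_series_of_summable (f := lift) (hcoeff ▸ hs.of_norm) x
  simp only [hcoeff, smul_eq_mul, fourier_coe_eq_mode] at hsum
  exact hsum

theorem summable_sq_norm_fcoeff (hL : 0 < L) (hp : Function.Periodic h L) (hc : Continuous h) :
    Summable fun n => ‖fcoeff L h n‖ ^ 2 := by
  have : Fact (0 < L) := ⟨hL⟩
  let lift : C(AddCircle L, ℂ) := ⟨hp.lift, continuous_coinduced_dom.mpr hc⟩
  refine (hasSum_sq_fourierCoeff
    (ContinuousMap.toLp 2 AddCircle.haarAddCircle ℂ lift)).summable.congr fun n => ?_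
  rw [fourierCoeff_toLp]
  exact congrArg (‖·‖ ^ 2) (fourierCoeff_lift hp n)

theorem periodic_deriv (hp : Function.Periodic h L) : Function.Periodic (deriv h) L := fun x => by
  rw [← deriv_comp_add_const h L x]
  exact congrArg (deriv · x) (funext hp)

theorem fcoeff_deriv (hL : 0 < L) (hp : Function.Periodic h L) (hh : ContDiff ℝ 1 h) :
    fcoeff L (deriv h) = derivSymbol L * fcoeff L h := by
  ext n
  have hparts := intervalIntegral.integral_mul_deriv_eq_deriv_mul (a := -(L / 2)) (b := L / 2)
    (u := fun x : ℝ => mode L (-n) x) (v := h) (v' := deriv h)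
    (fun x _ => (hasDerivAt_mode L (-n) x).comp_ofReal)
    (fun x _ => (hh.differentiable one_ne_zero x).hasDerivAt)
    ((continuous_const.mul (continuous_mode_ofReal L (-n))).intervalIntegrable _ _)
    (hh.continuous_deriv_one.intervalIntegrable _ _)
  have hbdry : h (L / 2) = h (-(L / 2)) := by
    rw [← hp (-(L / 2))]; congr 1; ring
  have hbdry_mode : mode L (-n) ((L / 2 : ℝ) : ℂ) = mode L (-n) ((-(L / 2) : ℝ) : ℂ) := by
    rw [← mode_add_period (-n) hL.ne' ((-(L / 2) : ℝ) : ℂ)]; congr 1; push_cast; ring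
  have hneg : derivSymbol L (-n) = -derivSymbol L n := by
    simp only [derivSymbol, Int.cast_neg]; ring
  rw [hbdry, hbdry_mode, sub_self, zero_sub] at hparts
  simp only [hneg, neg_mul, intervalIntegral.integral_neg, neg_neg, mul_assoc,
    intervalIntegral.integral_const_mul] at hparts
  simp only [Pi.mul_apply, fcoeff]
  simp only [mul_comm _ (mode L (-n) _), hparts]
  ring

theorem fcoeff_deriv_zero (hL : 0 < L) (hp : Function.Periodic h L) (hh : ContDiff ℝ 1 h) :
    fcoeff L (deriv h) 0 = 0 := by
  simp [fcoeff_deriv hL hp hh, derivSymbol]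

end Coefficients

/-! ### Decay of coefficients and smoothness -/

/-- The coefficients `a` decay so fast that the series `∑ |n|^k |a n|` converges; it is what makes
`trigSeries L a` of class `C^k`. The weight `1 + |n|` keeps the zeroth term. -/
def SummableOrder (k : ℕ) (a : ℤ → ℂ) : Prop := Summable fun n : ℤ => (1 + |(n : ℝ)|) ^ k * ‖a n‖

section SummableOrder

variable {L : ℝ} {k : ℕ} {a b m : ℤ → ℂ}

theorem summableOrder_zero : SummableOrder 0 a ↔ Summable fun n => ‖a n‖ := by
  simp [SummableOrder]

namespace SummableOrder

theorem mono {j : ℕ} (ha : SummableOrder k a) (hjk : j ≤ k) : SummableOrder j a := by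
  refine Summable.of_nonneg_of_le (fun n => by positivity) (fun n => ?_) ha
  gcongr
  linarith [abs_nonneg (n : ℝ)]

theorem summable_norm (ha : SummableOrder k a) : Summable fun n => ‖a n‖ :=
  summableOrder_zero.mp (ha.mono k.zero_le)

theorem add (ha : SummableOrder k a) (hb : SummableOrder k b) : SummableOrder k (a + b) := by
  refine Summable.of_nonneg_of_le (fun n => by positivity) (fun n => ?_) (Summable.add ha hb)
  rw [← mul_add]
  gcongr
  exact norm_add_le _ _

theorem bounded_mul (hm : Memℓp m ⊤) (ha : SummableOrder k a) : SummableOrder k (m * a) := by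
  obtain ⟨B, hB⟩ := memℓp_infty_iff.mp hm
  refine Summable.of_nonneg_of_le (fun n => by positivity) (fun n => ?_) (Summable.mul_left B ha)
  have hBn : ‖m n‖ ≤ B := hB (Set.mem_range_self n)
  rw [Pi.mul_apply, norm_mul, mul_left_comm]
  gcongr

theorem derivSymbol_mul (ha : SummableOrder (k + 1) a) :
    SummableOrder k (derivSymbol L * a) := by
  refine Summable.of_nonneg_of_le (fun n => by positivity) (fun n => ?_)
    (Summable.mul_left (2 * π / |L|) ha)
  have hle : ‖derivSymbol L n‖ ≤ 2 * π / |L| * (1 + |(n : ℝ)|) := by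
    rw [norm_derivSymbol]
    exact mul_le_mul_of_nonneg_left (by linarith) (by positivity)
  calc (1 + |(n : ℝ)|) ^ k * ‖(derivSymbol L * a) n‖
      = (1 + |(n : ℝ)|) ^ k * (‖derivSymbol L n‖ * ‖a n‖) := by rw [Pi.mul_apply, norm_mul]
    _ ≤ (1 + |(n : ℝ)|) ^ k * (2 * π / |L| * (1 + |(n : ℝ)|) * ‖a n‖) := by gcongr
    _ = 2 * π / |L| * ((1 + |(n : ℝ)|) ^ (k + 1) * ‖a n‖) := by ring

theorem of_derivSymbol_mul (hL : L ≠ 0) (ha : SummableOrder k (derivSymbol L * a)) :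
    SummableOrder (k + 1) a := by
  refine Summable.of_norm_bounded_eventually (Summable.mul_left (|L| / π) ha) ?_
  filter_upwards [(Set.finite_singleton (0 : ℤ)).compl_mem_cofinite] with n hn
  have hn1 : 1 ≤ |(n : ℝ)| := by exact_mod_cast Int.one_le_abs hn
  have : 0 < |L| := abs_pos.mpr hL
  have hle : 1 + |(n : ℝ)| ≤ |L| / π * ‖derivSymbol L n‖ := by
    rw [norm_derivSymbol]
    field_simp
    linarith
  rw [Real.norm_of_nonneg (by positivity)]
  calc (1 + |(n : ℝ)|) ^ (k + 1) * ‖a n‖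
      = (1 + |(n : ℝ)|) ^ k * (1 + |(n : ℝ)|) * ‖a n‖ := by ring
    _ ≤ (1 + |(n : ℝ)|) ^ k * (|L| / π * ‖derivSymbol L n‖) * ‖a n‖ := by gcongr
    _ = |L| / π * ((1 + |(n : ℝ)|) ^ k * ‖(derivSymbol L * a) n‖) := by
      rw [Pi.mul_apply, norm_mul]; ring

end SummableOrder

theorem summable_norm_fcoeff {h : ℝ → ℂ} (hL : 0 < L) (hp : Function.Periodic h L)
    (hh : ContDiff ℝ 1 h) : Summable fun n => ‖fcoeff L h n‖ := by
  have hsq := summable_sq_norm_fcoeff hL (periodic_deriv hp) hh.continuous_deriv_one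
  refine Summable.of_norm_bounded_eventually
    (((Real.summable_one_div_int_pow.mpr one_lt_two).add hsq).mul_left (L / (2 * π))) ?_
  filter_upwards [(Set.finite_singleton (0 : ℤ)).compl_mem_cofinite] with n hn
  have hn' : 0 < |(n : ℝ)| := abs_pos.mpr (Int.cast_ne_zero.mpr hn)
  have hnorm : ‖fcoeff L h n‖ = L / (2 * π) * (1 / |(n : ℝ)| * ‖fcoeff L (deriv h) n‖) := by
    rw [fcoeff_deriv hL hp hh, Pi.mul_apply, norm_mul, norm_derivSymbol, abs_of_pos hL]
    field_simp
  -- AM-GM for the product of `1 / |n|` and the coefficient of the derivative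
  rw [norm_norm, hnorm, ← sq_abs (n : ℝ), ← one_div_pow]
  gcongr
  nlinarith [sq_nonneg (1 / |(n : ℝ)| - ‖fcoeff L (deriv h) n‖), sq_nonneg (1 / |(n : ℝ)|),
    sq_nonneg ‖fcoeff L (deriv h) n‖]

theorem summableOrder_fcoeff {h : ℝ → ℂ} (hL : 0 < L) (hp : Function.Periodic h L)
    (hh : ContDiff ℝ (k + 1 : ℕ) h) : SummableOrder k (fcoeff L h) := by
  induction k generalizing h with
  | zero => exact summableOrder_zero.mpr (summable_norm_fcoeff hL hp (by simpa using hh))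
  | succ k ih =>
    have hh1 : ContDiff ℝ 1 h := hh.of_le (by norm_cast; omega)
    apply SummableOrder.of_derivSymbol_mul hL.ne'
    rw [← fcoeff_deriv hL hp hh1]
    exact ih (periodic_deriv hp) (ContDiff.deriv' (n := (k + 1 : ℕ)) (by exact_mod_cast hh))

end SummableOrder

section TrigSeries

variable {L : ℝ} {k : ℕ} {a b : ℤ → ℂ}

theorem summable_mul_mode_ofReal (ha : Summable fun n => ‖a n‖) (x : ℝ) :
    Summable fun n => a n * mode L n x :=
  Summable.of_norm_bounded ha fun n => by simp

theorem trigSeries_add_apply (ha : Summable fun n => ‖a n‖) (hb : Summable fun n => ‖b n‖) (x : ℝ) :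
    trigSeries L (a + b) x = trigSeries L a x + trigSeries L b x := by
  simp only [trigSeries, Pi.add_apply, add_mul]
  exact (summable_mul_mode_ofReal ha x).tsum_add (summable_mul_mode_ofReal hb x)

theorem trigSeries_const_mul (c : ℂ) (a : ℤ → ℂ) (z : ℂ) :
    trigSeries L (fun n => c * a n) z = c * trigSeries L a z := by
  simp only [trigSeries, mul_assoc, tsum_mul_left]

theorem trigSeries_add_right (a : ℤ → ℂ) (z w : ℂ) :
    trigSeries L a (z + w) = trigSeries L (fun n => a n * mode L n w) z := by
  simp only [trigSeries, mode_add, mul_assoc, mul_comm (mode L _ w)]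

theorem trigSeries_add_period (hL : L ≠ 0) (a : ℤ → ℂ) (z : ℂ) :
    trigSeries L a (z + L) = trigSeries L a z := by
  simp only [trigSeries, mode_add_period _ hL]

theorem periodic_trigSeries (hL : L ≠ 0) (a : ℤ → ℂ) :
    Function.Periodic (fun x : ℝ => trigSeries L a x) L := fun x => by
  simpa using trigSeries_add_period hL a x

theorem continuous_trigSeries (ha : Summable fun n => ‖a n‖) :
    Continuous fun x : ℝ => trigSeries L a x :=
  continuous_tsum (fun n => by fun_prop) ha fun n x => by simp

theorem hasDerivAt_trigSeries (ha : SummableOrder 1 a) (x : ℝ) :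
    HasDerivAt (fun x : ℝ => trigSeries L a x) (trigSeries L (derivSymbol L * a) x) x := by
  refine hasDerivAt_tsum (𝕜 := ℝ) (y₀ := (0 : ℝ)) (ha.derivSymbol_mul (L := L)).summable_norm
    (g' := fun n y => (derivSymbol L * a) n * mode L n y) (fun n y => ?_)
    (fun n y => by simp) (summable_mul_mode_ofReal ha.summable_norm 0) x
  refine ((hasDerivAt_mode L n y).comp_ofReal.const_mul (a n)).congr_deriv ?_
  rw [Pi.mul_apply]
  ring

theorem contDiff_trigSeries (ha : SummableOrder k a) :
    ContDiff ℝ k fun x : ℝ => trigSeries L a x := by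
  induction k generalizing a with
  | zero => exact contDiff_zero.mpr (continuous_trigSeries ha.summable_norm)
  | succ k ih =>
    have hd := hasDerivAt_trigSeries (L := L) (ha.mono k.succ_pos)
    rw [Nat.cast_succ, contDiff_succ_iff_deriv]
    refine ⟨fun x => (hd x).differentiableAt, by simp, ?_⟩
    rw [funext fun x => (hd x).deriv]
    exact ih ha.derivSymbol_mul

theorem eq_trigSeries_fcoeff {h : ℝ → ℂ} (hL : 0 < L) (hp : Function.Periodic h L)
    (hc : Continuous h) (hs : Summable fun n => ‖fcoeff L h n‖) (x : ℝ) :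
    h x = trigSeries L (fcoeff L h) x :=
  (hasSum_fcoeff_mul_mode hL hp hc hs x).tsum_eq.symm

theorem hasSum_integral_mul {a : ℤ → ℂ} (ha : Summable fun n => ‖a n‖)
    {g : ℝ → ℂ} (hg : Continuous g) {e : ℤ → ℝ → ℂ} (he : ∀ n, Continuous (e n))
    (he1 : ∀ n x, ‖e n x‖ ≤ 1) (c d : ℝ) :
    HasSum (fun n => a n * ∫ x in c..d, e n x * g x)
      (∫ x in c..d, (∑' n, a n * e n x) * g x) := by
  have hle : ∀ n x, ‖a n * e n x‖ ≤ ‖a n‖ := fun n x => by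
    rw [norm_mul]; exact mul_le_of_le_one_right (norm_nonneg _) (he1 n x)
  have hsum := intervalIntegral.hasSum_integral_of_dominated_convergence
    (μ := MeasureTheory.volume) (a := c) (b := d)
    (F := fun n x => a n * e n x * g x) (fun n x => ‖a n‖ * ‖g x‖)
    (fun n => ((continuous_const.mul (he n)).mul hg).aestronglyMeasurable)
    (fun n => .of_forall fun x _ => by rw [norm_mul]; gcongr; exact hle n x)
    (.of_forall fun x _ => ha.mul_right _)
    (by
      simp only [tsum_mul_right]
      exact (continuous_const.mul hg.norm).intervalIntegrable _ _)
    (.of_forall fun x _ => (Summable.of_norm_bounded ha fun n => hle n x).hasSum.mul_right _)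
  simpa only [← intervalIntegral.integral_const_mul, ← mul_assoc] using hsum

theorem fcoeff_trigSeries (hL : 0 < L) (ha : Summable fun n => ‖a n‖) :
    fcoeff L (fun x => trigSeries L a x) = a := by
  ext n
  have hterm : ∀ m, (1 / L : ℂ) * (a m * ∫ x in (-(L / 2))..(L / 2), mode L m x * mode L (-n) x)
      = if m = n then a n else 0 := fun m => by
    have hmode := fcoeff_mode hL m n
    rw [fcoeff] at hmode
    rw [mul_left_comm, hmode]
    rcases eq_or_ne m n with rfl | hmn
    · simp
    · simp [hmn, hmn.symm]
  have hsum := (hasSum_integral_mul ha (continuous_mode_ofReal L (-n)) (continuous_mode_ofReal L)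
    (fun m x => (norm_mode_ofReal L m x).le) (-(L / 2)) (L / 2)).mul_left (1 / L : ℂ)
  simp only [hterm] at hsum
  exact hsum.unique (hasSum_ite_eq n (a n))

end TrigSeries

/-! ### Fourier expansions of `ζ₁` -/

theorem mode_natCast (L : ℝ) (k : ℕ) (z : ℂ) : mode L k z = mode L 1 z ^ k := by
  rw [mode, mode, ← Complex.exp_nat_mul]
  congr 1
  push_cast
  ring

theorem mode_natCast_mul (L : ℝ) (n : ℤ) (k : ℕ) (z : ℂ) : mode L n (k * z) = mode L n z ^ k := by
  rw [mode, mode, ← Complex.exp_nat_mul]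
  congr 1
  ring

theorem norm_mode_one_lt_one {L : ℝ} (hL : 0 < L) {z : ℂ} (hz : 0 < z.im) : ‖mode L 1 z‖ < 1 := by
  rw [norm_mode, Real.exp_lt_one_iff]
  push_cast
  have : 0 < 2 * π * 1 / L * z.im := by positivity
  linarith

theorem cot_eq_mode {L : ℝ} {z : ℂ} (hz : mode L 1 z ≠ 1) :
    Complex.cot (π / L * z) = -I * (1 + 2 * (mode L 1 z / (1 - mode L 1 z))) := by
  have hexp : Complex.exp (2 * I * (π / L * z)) = mode L 1 z := by
    rw [mode]
    congr 1
    push_cast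
    ring
  have hne : 1 - mode L 1 z ≠ 0 := sub_ne_zero.mpr hz.symm
  rw [Complex.cot_eq_exp_ratio, hexp, div_eq_iff (mul_ne_zero I_ne_zero hne)]
  field_simp
  linear_combination (mode L 1 z + 1) * I_sq

theorem complex_cot_neg (z : ℂ) : Complex.cot (-z) = -Complex.cot z := by
  rw [Complex.cot, Complex.cot, Complex.sin_neg, Complex.cos_neg, div_neg]

section Lambert

theorem hasSum_pow_succ {y : ℂ} (hy : ‖y‖ < 1) :
    HasSum (fun n : ℕ => y ^ (n + 1)) (y / (1 - y)) := by
  simpa only [pow_succ', div_eq_mul_inv] using (hasSum_geometric_of_norm_lt_one hy).mul_left y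

theorem norm_pow_succ_mul_lt_one {q x : ℂ} (hq : ‖q‖ < 1) (hx : ‖q * x‖ < 1) (n : ℕ) :
    ‖q ^ (n + 1) * x‖ < 1 := by
  rw [pow_succ, mul_assoc, norm_mul, norm_pow]
  exact (mul_le_of_le_one_left (norm_nonneg _) (pow_le_one₀ (norm_nonneg _) hq.le)).trans_lt hx

theorem summable_lambert {q x : ℂ} (hq : ‖q‖ < 1) (hx : ‖q * x‖ < 1) :
    Summable fun p : ℕ × ℕ => (q ^ (p.1 + 1) * x) ^ (p.2 + 1) := by
  refine Summable.of_norm_bounded ((summable_geometric_of_lt_one (norm_nonneg q) hq).mul_of_nonneg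
    (summable_geometric_of_lt_one (norm_nonneg _) hx) (fun _ => by positivity)
    fun _ => by positivity) fun p => ?_
  calc ‖(q ^ (p.1 + 1) * x) ^ (p.2 + 1)‖
      = ‖q‖ ^ (p.1 * (p.2 + 1)) * ‖q * x‖ ^ (p.2 + 1) := by
        simp only [norm_pow, norm_mul]
        ring
    _ ≤ ‖q‖ ^ p.1 * ‖q * x‖ ^ p.2 := by
        gcongr ?_ * ?_
        · exact pow_le_pow_of_le_one (norm_nonneg _) hq.le (Nat.le_mul_of_pos_right _ p.2.succ_pos)
        · exact pow_le_pow_of_le_one (norm_nonneg _) hx.le p.2.le_succ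

theorem exists_hasSum_lambert {q x : ℂ} (hq : ‖q‖ < 1) (hx : ‖q * x‖ < 1) :
    ∃ S, HasSum (fun n : ℕ => q ^ (n + 1) * x / (1 - q ^ (n + 1) * x)) S ∧
      HasSum (fun m : ℕ => q ^ (m + 1) / (1 - q ^ (m + 1)) * x ^ (m + 1)) S := by
  obtain ⟨S, hS⟩ := summable_lambert hq hx
  have hS' : HasSum (fun p : ℕ × ℕ => (q ^ (p.2 + 1) * x) ^ (p.1 + 1)) S :=
    (Equiv.prodComm ℕ ℕ).hasSum_iff.mpr hS
  have hrow : ∀ n : ℕ, HasSum (fun m : ℕ => (q ^ (n + 1) * x) ^ (m + 1))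
      (q ^ (n + 1) * x / (1 - q ^ (n + 1) * x)) := fun n =>
    hasSum_pow_succ (norm_pow_succ_mul_lt_one hq hx n)
  have hcol : ∀ m : ℕ, HasSum (fun n : ℕ => (q ^ (n + 1) * x) ^ (m + 1))
      (q ^ (m + 1) / (1 - q ^ (m + 1)) * x ^ (m + 1)) := fun m => by
    have hqm : ‖q ^ (m + 1)‖ < 1 := by
      rw [norm_pow]
      exact pow_lt_one₀ (norm_nonneg q) hq m.succ_ne_zero
    refine ((hasSum_pow_succ hqm).mul_right (x ^ (m + 1))).congr_fun fun n => ?_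
    rw [mul_pow, ← pow_mul, ← pow_mul, mul_comm (n + 1)]
  exact ⟨S, hS.prod_fiberwise hrow, hS'.prod_fiberwise hcol⟩

end Lambert

/-- The square `exp (-4πδ/L)` of the nome of the lattice with periods `L` and `2iδ`. -/
def nome (L δ : ℝ) : ℂ := mode L 1 (2 * I * δ)

/-- The frequency `2πnδ/L` entering the hyperbolic Fourier symbols. -/
def freq (L δ : ℝ) (n : ℤ) : ℝ := 2 * π * n * δ / L

/-- The symbol `coth (2πnδ/L)`, with value `0` at `n = 0`. -/
def cothSymbol (L δ : ℝ) (n : ℤ) : ℂ := Complex.cosh (freq L δ n) / Complex.sinh (freq L δ n)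

/-- The symbol `1 / sinh (2πnδ/L)`, with value `0` at `n = 0`. -/
def cschSymbol (L δ : ℝ) (n : ℤ) : ℂ := 1 / Complex.sinh (freq L δ n)

/-- Fourier coefficients of `ζ₁(z) - (π/L) cot (πz/L)`, the part of `ζ₁` regular at `z = 0`. -/
def regCoeff (L δ : ℝ) (n : ℤ) : ℂ := -(π * I / L) * (cothSymbol L δ n - n.sign)

theorem freq_neg (L δ : ℝ) (n : ℤ) : freq L δ (-n) = -freq L δ n := by
  rw [freq, freq]
  push_cast
  ring

theorem cothSymbol_neg (L δ : ℝ) (n : ℤ) : cothSymbol L δ (-n) = -cothSymbol L δ n := by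
  rw [cothSymbol, cothSymbol, freq_neg, Complex.ofReal_neg, Complex.sinh_neg, Complex.cosh_neg,
    div_neg]

@[simp]
theorem cothSymbol_zero (L δ : ℝ) : cothSymbol L δ 0 = 0 := by simp [cothSymbol, freq]

@[simp]
theorem cschSymbol_zero (L δ : ℝ) : cschSymbol L δ 0 = 0 := by simp [cschSymbol, freq]

theorem regCoeff_neg (L δ : ℝ) (n : ℤ) : regCoeff L δ (-n) = -regCoeff L δ n := by
  rw [regCoeff, regCoeff, cothSymbol_neg, Int.sign_neg]
  push_cast
  ring

theorem coth_eq_exp {s : ℂ} (hs : Complex.sinh s ≠ 0) :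
    Complex.cosh s / Complex.sinh s
      = 1 + 2 * (Complex.exp (-(2 * s)) / (1 - Complex.exp (-(2 * s)))) := by
  have hsq : Complex.exp (-(2 * s)) = Complex.exp (-s) ^ 2 := by
    rw [← Complex.exp_nat_mul]
    congr 1
    push_cast
    ring
  have hinv : Complex.exp s * Complex.exp (-s) = 1 := by rw [← Complex.exp_add]; simp
  have hden : 1 - Complex.exp (-(2 * s)) = 2 * Complex.exp (-s) * Complex.sinh s := by
    rw [Complex.sinh, hsq]
    linear_combination -hinv
  have := Complex.exp_ne_zero (-s)
  rw [hden, hsq]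
  field_simp
  rw [Complex.sinh, Complex.cosh]
  ring

section Periods

variable {L δ : ℝ} (hL : 0 < L) (hδ : 0 < δ)

include hL hδ

theorem sinh_freq_ne_zero {n : ℤ} (hn : n ≠ 0) : Complex.sinh (freq L δ n) ≠ 0 := by
  have : (n : ℝ) ≠ 0 := by exact_mod_cast hn
  have hfreq : freq L δ n ≠ 0 := by
    rw [freq]
    positivity
  rw [← Complex.ofReal_sinh]
  exact_mod_cast Real.sinh_ne_zero.mpr hfreq

theorem regCoeff_natCast_add_one (m : ℕ) :
    regCoeff L δ (m + 1) = -(2 * π * I / L) * (nome L δ ^ (m + 1) / (1 - nome L δ ^ (m + 1))) := by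
  have hexp : Complex.exp (-(2 * freq L δ (m + 1))) = nome L δ ^ (m + 1) := by
    rw [nome, ← mode_natCast, mode, freq]
    congr 1
    push_cast
    linear_combination -(4 * π * (m + 1) * δ / L : ℂ) * I_sq
  rw [regCoeff, cothSymbol, coth_eq_exp (sinh_freq_ne_zero hL hδ (by omega)), hexp,
    Int.sign_eq_one_of_pos (by omega)]
  push_cast
  ring

theorem norm_nome_lt_one : ‖nome L δ‖ < 1 :=
  norm_mode_one_lt_one hL (by simpa using hδ)

omit hδ in
theorem norm_nome_mul_mode_lt_one {z : ℂ} (hz : -(2 * δ) < z.im) :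
    ‖nome L δ * mode L 1 z‖ < 1 := by
  rw [nome, ← mode_add]
  refine norm_mode_one_lt_one hL ?_
  simp only [add_im, mul_im, mul_re, re_ofNat, im_ofNat, I_re, I_im, ofReal_re, ofReal_im]
  linarith

theorem cot_add_cot_shift {z : ℂ} (hz : |z.im| < 2 * δ) (n : ℕ) :
    Complex.cot (π / L * (z - 2 * I * (n + 1 : ℤ) * δ)) +
      Complex.cot (π / L * (z - 2 * I * (-(n + 1) : ℤ) * δ)) =
    2 * I * (nome L δ ^ (n + 1) * mode L 1 (-z) / (1 - nome L δ ^ (n + 1) * mode L 1 (-z))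
      - nome L δ ^ (n + 1) * mode L 1 z / (1 - nome L δ ^ (n + 1) * mode L 1 z)) := by
  have hcot : ∀ w : ℂ, -(2 * δ) < w.im →
      Complex.cot (π / L * (w + (n + 1 : ℕ) * (2 * I * δ))) = -I * (1 + 2 *
        (nome L δ ^ (n + 1) * mode L 1 w / (1 - nome L δ ^ (n + 1) * mode L 1 w))) := by
    intro w hw
    have hmode : mode L 1 (w + (n + 1 : ℕ) * (2 * I * δ)) = nome L δ ^ (n + 1) * mode L 1 w := by
      rw [mode_add, mode_natCast_mul, nome, mul_comm]
    have hlt := norm_pow_succ_mul_lt_one (norm_nome_lt_one hL hδ)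
      (norm_nome_mul_mode_lt_one hL hw) n
    have hne : mode L 1 (w + (n + 1 : ℕ) * (2 * I * δ)) ≠ 1 := fun h => by
      rw [← hmode, h, norm_one] at hlt
      exact lt_irrefl _ hlt
    rw [cot_eq_mode hne, hmode]
  have hz' := abs_lt.mp hz
  have hminus : (π / L : ℂ) * (z - 2 * I * (n + 1 : ℤ) * δ)
      = -(π / L * (-z + (n + 1 : ℕ) * (2 * I * δ))) := by push_cast; ring
  have hplus : (π / L : ℂ) * (z - 2 * I * (-(n + 1) : ℤ) * δ)
      = π / L * (z + (n + 1 : ℕ) * (2 * I * δ)) := by push_cast; ring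
  rw [hminus, hplus, complex_cot_neg, hcot z hz'.1, hcot (-z) (by rw [neg_im]; linarith)]
  ring

end Periods

theorem sum_Icc_neg_natCast (f : ℤ → ℂ) (M : ℕ) :
    ∑ n ∈ Finset.Icc (-(M : ℤ)) (M : ℤ), f n
      = f 0 + ∑ n ∈ Finset.range M, (f (n + 1) + f (-(n + 1))) := by
  induction M with
  | zero => simp
  | succ M ih =>
    have hsucc := Finset.sum_Icc_succ_eq_add_endpoints f (N := M)
    push_cast
    rw [hsucc, ih, Finset.sum_range_succ]
    ring

theorem zeta1_eq_of_hasSum {L δ : ℝ} {z s : ℂ} (hs : HasSum (fun n : ℕ =>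
      Complex.cot (π / L * (z - 2 * I * (n + 1 : ℤ) * δ)) +
        Complex.cot (π / L * (z - 2 * I * (-(n + 1) : ℤ) * δ))) s) :
    zeta1 L δ z = π / L * (Complex.cot (π / L * z) + s) := by
  rw [zeta1]
  congr 1
  refine Tendsto.limUnder_eq ?_
  simp only [sum_Icc_neg_natCast]
  simpa using hs.tendsto_sum_nat.const_add (Complex.cot (π / L * z))

section Expansions

variable {L δ : ℝ} (hL : 0 < L) (hδ : 0 < δ)

include hL hδ

theorem hasSum_regCoeff {z : ℂ} (hz : |z.im| < 2 * δ) :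
    HasSum (fun n => regCoeff L δ n * mode L n z)
      (zeta1 L δ z - π / L * Complex.cot (π / L * z)) := by
  have hz' := abs_lt.mp hz
  have hq := norm_nome_lt_one hL hδ
  obtain ⟨S, hScot, hS⟩ := exists_hasSum_lambert hq (norm_nome_mul_mode_lt_one hL hz'.1)
  obtain ⟨S', hScot', hS'⟩ := exists_hasSum_lambert hq
    (norm_nome_mul_mode_lt_one hL (z := -z) (by rw [neg_im]; linarith))
  have hzeta := zeta1_eq_of_hasSum
    (((hScot'.sub hScot).mul_left (2 * I)).congr_fun (cot_add_cot_shift hL hδ hz))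
  have hpos : HasSum (fun n : ℕ => regCoeff L δ (n + 1) * mode L (n + 1) z)
      (-(2 * π * I / L) * S) := by
    refine (hS.mul_left _).congr_fun fun n => ?_
    rw [regCoeff_natCast_add_one hL hδ, mul_assoc, ← mode_natCast]
    push_cast
    rfl
  have hneg : HasSum (fun n : ℕ => regCoeff L δ (-(n + 1)) * mode L (-(n + 1)) z)
      (2 * π * I / L * S') := by
    refine (hS'.mul_left _).congr_fun fun n => ?_
    rw [regCoeff_neg, regCoeff_natCast_add_one hL hδ, ← mode_neg_right, ← mode_natCast]
    push_cast
    ring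
  convert HasSum.of_add_one_of_neg_add_one (f := fun n : ℤ => regCoeff L δ n * mode L n z)
    hpos hneg using 1
  rw [hzeta, regCoeff, cothSymbol_zero, Int.sign_zero]
  push_cast
  ring

theorem zeta1_neg {z : ℂ} (hz : |z.im| < 2 * δ) : zeta1 L δ (-z) = -zeta1 L δ z := by
  have hsum := (Equiv.neg ℤ).hasSum_iff.mpr (hasSum_regCoeff hL hδ (z := -z) (by simpa using hz))
  have hodd := (hasSum_regCoeff hL hδ hz).neg.unique (hsum.congr_fun fun n => by
    simp only [Function.comp_apply, Equiv.neg_apply]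
    rw [mode_neg_right, neg_neg, regCoeff_neg, neg_mul])
  rw [mul_neg, complex_cot_neg] at hodd
  linear_combination -hodd

omit hδ in
theorem hasSum_sign_add_one_mul_mode {z : ℂ} (hz : 0 < z.im) :
    HasSum (fun n : ℤ => ((n.sign : ℂ) + 1) * mode L n z) (I * Complex.cot (π / L * z)) := by
  have hlt := norm_mode_one_lt_one hL hz
  have hpos : HasSum (fun n : ℕ => (((n + 1 : ℤ).sign : ℂ) + 1) * mode L (n + 1) z)
      (2 * (mode L 1 z / (1 - mode L 1 z))) := by
    refine ((hasSum_pow_succ hlt).mul_left 2).congr_fun fun n => ?_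
    rw [Int.sign_eq_one_of_pos (by omega), ← mode_natCast]
    push_cast
    ring
  have hneg : HasSum (fun n : ℕ => (((-(n + 1) : ℤ).sign : ℂ) + 1) * mode L (-(n + 1)) z) 0 := by
    have hsign : ∀ n : ℕ, (-(n + 1) : ℤ).sign = -1 := fun n =>
      Int.sign_eq_neg_one_of_neg (by omega)
    simp only [hsign]
    simp
  convert HasSum.of_add_one_of_neg_add_one
    (f := fun n : ℤ => ((n.sign : ℂ) + 1) * mode L n z) hpos hneg using 1
  have hne : mode L 1 z ≠ 1 := fun h => by simp [h] at hlt
  rw [cot_eq_mode hne, mode_zero_left, Int.sign_zero]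
  push_cast
  linear_combination -(1 + 2 * (mode L 1 z / (1 - mode L 1 z))) * I_sq

theorem hasSum_zeta1_upper {z : ℂ} (hz₀ : 0 < z.im) (hz : z.im < 2 * δ) :
    HasSum (fun n => -(π * I / L) * (cothSymbol L δ n + 1) * mode L n z) (zeta1 L δ z) := by
  have hreg := hasSum_regCoeff hL hδ (abs_lt.mpr ⟨by linarith, hz⟩)
  convert hreg.add ((hasSum_sign_add_one_mul_mode hL hz₀).mul_left (-(π * I / L))) using 1
  · funext n
    rw [regCoeff]
    ring
  · linear_combination (π / L : ℂ) * Complex.cot (π / L * z) * I_sq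

theorem hasSum_zeta1_lower {z : ℂ} (hz : -(2 * δ) < z.im) (hz₀ : z.im < 0) :
    HasSum (fun n => -(π * I / L) * (cothSymbol L δ n - 1) * mode L n z) (zeta1 L δ z) := by
  have hupper := hasSum_zeta1_upper hL hδ (z := -z) (by simpa using hz₀)
    (by rw [neg_im]; linarith)
  rw [zeta1_neg hL hδ (abs_lt.mpr ⟨hz, by linarith⟩)] at hupper
  rw [← neg_neg (zeta1 L δ z)]
  refine ((Equiv.neg ℤ).hasSum_iff.mpr hupper).neg.congr_fun fun n => ?_
  simp only [Function.comp_apply, Equiv.neg_apply]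
  rw [mode_neg_right, neg_neg, cothSymbol_neg]
  ring

end Expansions

/-! ### The kernel `ζ₁` on the real line -/

theorem integral_add_comp_neg {f : ℝ → ℂ} (hf : Continuous f) (b : ℝ) :
    ∫ y in (0 : ℝ)..b, (f y + f (-y)) = ∫ y in (-b)..b, f y := by
  have hf' : Continuous fun y => f (-y) := by fun_prop
  rw [intervalIntegral.integral_add (hf.intervalIntegrable _ _) (hf'.intervalIntegrable _ _),
    intervalIntegral.integral_comp_neg, neg_zero, add_comm,
    intervalIntegral.integral_add_adjacent_intervals (hf.intervalIntegrable _ _)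
      (hf.intervalIntegrable _ _)]

theorem integral_mul_mode_eq {L : ℝ} (hL : 0 < L) (f : ℝ → ℂ) (n : ℤ) :
    ∫ y in (-(L / 2))..(L / 2), f y * mode L n y = L * fcoeff L f (-n) := by
  have : (L : ℂ) ≠ 0 := by exact_mod_cast hL.ne'
  rw [fcoeff, neg_neg]
  field_simp

theorem integral_mode_add_mode_neg {L : ℝ} (hL : 0 < L) (j : ℤ) :
    ∫ y in (0 : ℝ)..(L / 2), (mode L j y + mode L (-j) y) = if j = 0 then (L : ℂ) else 0 := by
  have hfold := integral_add_comp_neg (continuous_mode_ofReal L j) (L / 2)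
  have hint := integral_mul_mode_eq hL (fun x => mode L 0 x) j
  rw [fcoeff_mode hL] at hint
  simp only [mode_zero_left, one_mul, neg_eq_zero, mul_ite, mul_one, mul_zero] at hint
  simpa only [Complex.ofReal_neg, mode_neg_right, hint] using hfold

theorem mode_one_ne_one {L y : ℝ} (hy : 0 < y) (hyL : y < L) : mode L 1 y ≠ 1 := by
  intro h
  obtain ⟨m, hm⟩ := Complex.exp_eq_one_iff.mp h
  have hL : (L : ℂ) ≠ 0 := by exact_mod_cast (hy.trans hyL).ne'
  have hym : (y : ℂ) = m * L := by
    rw [div_eq_iff hL] at hm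
    refine mul_left_cancel₀ Complex.two_pi_I_ne_zero ?_
    push_cast at hm
    linear_combination hm
  have hym' : y = m * L := by exact_mod_cast hym
  have hm0 : (0 : ℝ) < m := pos_of_mul_pos_left (hym' ▸ hy) (hy.trans hyL).le
  have hm1 : (m : ℝ) < 1 := by nlinarith
  norm_cast at hm0 hm1
  omega

theorem cot_mul_mode_sub_mode_neg {L : ℝ} {z : ℂ} (hz : mode L 1 z ≠ 1) (n : ℕ) :
    Complex.cot (π / L * z) * (mode L n z - mode L (-n) z) =
      I * ∑ j ∈ Finset.range n, ((mode L (j + 1 : ℕ) z + mode L (-(j + 1 : ℕ)) z)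
        + (mode L j z + mode L (-j) z)) := by
  induction n with
  | zero => simp
  | succ n ih =>
    have hne : 1 - mode L 1 z ≠ 0 := sub_ne_zero.mpr hz.symm
    have hsucc : mode L (n + 1 : ℕ) z = mode L n z * mode L 1 z := by
      rw [mode_mul_mode]
      push_cast
      rfl
    have hneg : mode L (-n) z = mode L (-(n + 1 : ℕ)) z * mode L 1 z := by
      rw [mode_mul_mode]
      congr 1
      push_cast
      ring
    rw [Finset.sum_range_succ, mul_add, ← ih, cot_eq_mode hz, hsucc, hneg]
    field_simp
    ring

theorem integral_sum_modes {L : ℝ} (hL : 0 < L) (n : ℕ) :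
    ∫ y in (0 : ℝ)..(L / 2), ∑ j ∈ Finset.range n,
      ((mode L (j + 1 : ℕ) y + mode L (-(j + 1 : ℕ)) y) + (mode L j y + mode L (-j) y))
      = if n = 0 then 0 else (L : ℂ) := by
  have hcont : ∀ j : ℤ, Continuous fun y : ℝ => mode L j y + mode L (-j) y := by fun_prop
  rw [intervalIntegral.integral_finsetSum fun j _ =>
    Continuous.intervalIntegrable (by fun_prop) _ _]
  have hterm : ∀ j : ℕ, ∫ y in (0 : ℝ)..(L / 2),
      ((mode L (j + 1 : ℕ) y + mode L (-(j + 1 : ℕ)) y) + (mode L j y + mode L (-j) y))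
      = if j = 0 then (L : ℂ) else 0 := fun j => by
    rw [intervalIntegral.integral_add ((hcont _).intervalIntegrable _ _)
      ((hcont _).intervalIntegrable _ _), integral_mode_add_mode_neg hL,
      integral_mode_add_mode_neg hL, if_neg (by exact_mod_cast j.succ_ne_zero), zero_add]
    simp only [Nat.cast_eq_zero]
  simp only [hterm, Finset.sum_ite_eq', Finset.mem_range]
  rcases n.eq_zero_or_pos with rfl | hn
  · simp
  · simp [hn, hn.ne']

theorem norm_cot_mul_le {θ : ℝ} (hθ : 0 < θ) (hθ' : θ ≤ π / 2) :
    ‖Complex.cot θ‖ * θ ≤ π / 2 := by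
  have hsin : 0 < Real.sin θ := Real.sin_pos_of_pos_of_lt_pi hθ (by linarith [Real.pi_pos])
  have hjordan := Real.mul_le_sin hθ.le hθ'
  rw [Complex.cot, ← Complex.ofReal_cos, ← Complex.ofReal_sin, ← Complex.ofReal_div,
    Complex.norm_real, Real.norm_eq_abs, abs_div, abs_of_pos hsin, div_mul_eq_mul_div,
    div_le_iff₀ hsin]
  calc |Real.cos θ| * θ ≤ 1 * θ := by gcongr; exact Real.abs_cos_le_one θ
    _ = π / 2 * (2 / π * θ) := by field_simp
    _ ≤ π / 2 * Real.sin θ := by gcongr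

section Kernel

variable {L δ : ℝ} (hL : 0 < L) (hδ : 0 < δ)

include hL hδ

theorem summable_norm_regCoeff : Summable fun n => ‖regCoeff L δ n‖ := by
  simpa [mode_zero_right] using (hasSum_regCoeff hL hδ (z := 0) (by simpa using hδ)).summable.norm

theorem memℓp_cothSymbol : Memℓp (cothSymbol L δ) ⊤ := by
  have hreg : Memℓp (regCoeff L δ) ⊤ :=
    Memℓp.of_exponent_ge (memℓp_gen (p := 1) (by simpa using summable_norm_regCoeff hL hδ)) le_top
  have hsign : Memℓp (fun n : ℤ => (n.sign : ℂ)) ⊤ := by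
    refine memℓp_infty ⟨1, Set.forall_mem_range.mpr fun n => ?_⟩
    rcases lt_trichotomy n 0 with hn | rfl | hn
    · simp [Int.sign_eq_neg_one_of_neg hn]
    · simp
    · simp [Int.sign_eq_one_of_pos hn]
  have hcoth : cothSymbol L δ = (fun n => (-(π * I / L))⁻¹ * regCoeff L δ n)
      + fun n : ℤ => (n.sign : ℂ) := by
    funext n
    have : (L : ℂ) ≠ 0 := by exact_mod_cast hL.ne'
    rw [Pi.add_apply, regCoeff, inv_mul_cancel_left₀ (by simp [*, Real.pi_ne_zero])]
    ring
  exact hcoth ▸ (hreg.const_mul _).add hsign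

theorem memℓp_cschSymbol : Memℓp (cschSymbol L δ) ⊤ := by
  obtain ⟨B, hB⟩ := memℓp_infty_iff.mp (memℓp_cothSymbol hL hδ)
  refine memℓp_infty ⟨B, Set.forall_mem_range.mpr fun n => ?_⟩
  refine le_trans ?_ (hB (Set.mem_range_self n))
  rw [cschSymbol, cothSymbol, norm_div, norm_div, norm_one, ← Complex.ofReal_cosh,
    Complex.norm_real, Real.norm_of_nonneg (Real.cosh_pos _).le]
  gcongr
  exact Real.one_le_cosh _

theorem zeta1_ofReal (y : ℝ) :
    zeta1 L δ y = π / L * Complex.cot (π / L * y) + trigSeries L (regCoeff L δ) y := by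
  rw [trigSeries, (hasSum_regCoeff hL hδ (z := (y : ℂ)) (by simpa using hδ)).tsum_eq]
  ring

theorem zeta1_neg_ofReal (y : ℝ) : zeta1 L δ ((-y : ℝ) : ℂ) = -zeta1 L δ y := by
  rw [Complex.ofReal_neg, zeta1_neg hL hδ (by simpa using hδ)]

theorem continuousOn_zeta1 : ContinuousOn (fun y : ℝ => zeta1 L δ y) (Set.Ioo 0 L) := by
  have hcot : ContinuousOn (fun y : ℝ => Complex.cot (π / L * y)) (Set.Ioo 0 L) := by
    refine ContinuousOn.congr (f := fun y : ℝ => -I * (1 + 2 * (mode L 1 y / (1 - mode L 1 y))))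
      ?_ fun y hy => cot_eq_mode (mode_one_ne_one hy.1 hy.2)
    have hmode : ContinuousOn (fun y : ℝ => mode L 1 y) (Set.Ioo 0 L) :=
      (continuous_mode_ofReal L 1).continuousOn
    exact continuousOn_const.mul (continuousOn_const.add (continuousOn_const.mul
      (hmode.div (continuousOn_const.sub hmode) fun y hy =>
        sub_ne_zero.mpr (mode_one_ne_one hy.1 hy.2).symm)))
  simp only [zeta1_ofReal hL hδ]
  exact (continuousOn_const.mul hcot).add
    (continuous_trigSeries (summable_norm_regCoeff hL hδ)).continuousOn

theorem exists_norm_zeta1_mul_le :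
    ∃ K : ℝ, ∀ y ∈ Set.Ioc 0 (L / 2), ‖zeta1 L δ (y : ℂ)‖ * y ≤ K := by
  obtain ⟨K, hK⟩ := (isCompact_Icc (a := (0 : ℝ)) (b := L / 2)).exists_bound_of_continuousOn
    (continuous_trigSeries (summable_norm_regCoeff hL hδ)).continuousOn
  refine ⟨π / 2 + K * (L / 2), fun y ⟨hy₀, hy⟩ => ?_⟩
  have hcot : ‖(π / L : ℂ) * Complex.cot (π / L * y)‖ * y ≤ π / 2 := by
    have hθ : π / L * y ≤ π / 2 := by
      rw [div_mul_eq_mul_div, div_le_div_iff₀ hL two_pos]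
      nlinarith [Real.pi_pos]
    have hle := norm_cot_mul_le (by positivity) hθ
    have hnorm : ‖(π / L : ℂ)‖ = π / L := by
      rw [← Complex.ofReal_div, Complex.norm_real, Real.norm_of_nonneg (by positivity)]
    push_cast at hle
    rw [norm_mul, hnorm]
    linarith
  have hreg := hK y ⟨hy₀.le, hy⟩
  rw [zeta1_ofReal hL hδ]
  calc _ ≤ (‖(π / L : ℂ) * Complex.cot (π / L * y)‖ + ‖trigSeries L (regCoeff L δ) y‖) * y := by
        gcongr
        exact norm_add_le _ _
    _ ≤ _ := by
        rw [add_mul]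
        have hK₀ : 0 ≤ K := (norm_nonneg _).trans hreg
        gcongr

theorem integral_regCoeff_mul_mode_sub_mode_neg (n : ℤ) :
    ∫ y in (0 : ℝ)..(L / 2), trigSeries L (regCoeff L δ) y * (mode L n y - mode L (-n) y)
      = -(L * regCoeff L δ n) := by
  have hsum := summable_norm_regCoeff hL hδ
  have hodd : ∀ y : ℝ, trigSeries L (regCoeff L δ) (-y) = -trigSeries L (regCoeff L δ) y := by
    intro y
    have hneg := zeta1_neg_ofReal hL hδ y
    rw [zeta1_ofReal hL hδ, zeta1_ofReal hL hδ, Complex.ofReal_neg, mul_neg,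
      complex_cot_neg] at hneg
    linear_combination hneg
  have hfold := integral_add_comp_neg (f := fun y => trigSeries L (regCoeff L δ) y * mode L n y)
    ((continuous_trigSeries hsum).mul (continuous_mode_ofReal L n)) (L / 2)
  rw [integral_mul_mode_eq hL, fcoeff_trigSeries hL hsum, regCoeff_neg, mul_neg] at hfold
  rw [← hfold]
  refine intervalIntegral.integral_congr fun y _ => ?_
  simp only [Complex.ofReal_neg, hodd, mode_neg_right]
  ring

theorem integral_zeta1_mul_mode_sub_mode_neg (n : ℤ) :
    ∫ y in (0 : ℝ)..(L / 2), zeta1 L δ y * (mode L n y - mode L (-n) y)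
      = π * I * cothSymbol L δ n := by
  have hnat : ∀ n : ℕ, ∫ y in (0 : ℝ)..(L / 2), zeta1 L δ y * (mode L n y - mode L (-n) y)
      = π * I * cothSymbol L δ n := by
    intro n
    have hreg : Continuous fun y : ℝ => trigSeries L (regCoeff L δ) y :=
      continuous_trigSeries (summable_norm_regCoeff hL hδ)
    have hsplit : ∫ y in (0 : ℝ)..(L / 2), zeta1 L δ y * (mode L n y - mode L (-n) y)
        = ∫ y in (0 : ℝ)..(L / 2), (π / L * I * ∑ j ∈ Finset.range n,
            ((mode L (j + 1 : ℕ) y + mode L (-(j + 1 : ℕ)) y) + (mode L j y + mode L (-j) y))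
          + trigSeries L (regCoeff L δ) y * (mode L n y - mode L (-n) y)) := by
      refine intervalIntegral.integral_congr_ae (Eventually.of_forall fun y hy => ?_)
      rw [Set.uIoc_of_le (by positivity)] at hy
      rw [zeta1_ofReal hL hδ, add_mul, mul_assoc (π / L : ℂ), mul_assoc (π / L : ℂ),
        ← cot_mul_mode_sub_mode_neg (mode_one_ne_one hy.1 (by linarith [hy.2]))]
    rw [hsplit, intervalIntegral.integral_add
      (Continuous.intervalIntegrable (by fun_prop) _ _)
      (Continuous.intervalIntegrable (by fun_prop) _ _), intervalIntegral.integral_const_mul,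
      integral_sum_modes hL, integral_regCoeff_mul_mode_sub_mode_neg hL hδ, regCoeff]
    have : (L : ℂ) ≠ 0 := by exact_mod_cast hL.ne'
    rcases n.eq_zero_or_pos with rfl | hn
    · simp
    · rw [if_neg hn.ne', Int.sign_eq_one_of_pos (by omega)]
      field_simp
      push_cast
      ring
  obtain ⟨k, rfl | rfl⟩ := n.eq_nat_or_neg
  · exact hnat k
  · rw [neg_neg, cothSymbol_neg, mul_neg, ← hnat k, ← intervalIntegral.integral_neg]
    refine intervalIntegral.integral_congr fun y _ => ?_
    ring

end Kernel

/-! ### `T` and `T̃` as Fourier multipliers -/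

theorem exists_norm_le_of_periodic {L : ℝ} (hL : 0 < L) {h : ℝ → ℂ} (hp : Function.Periodic h L)
    (hc : Continuous h) : ∃ K, ∀ x, ‖h x‖ ≤ K := by
  obtain ⟨K, hK⟩ := (isCompact_Icc (a := (0 : ℝ)) (b := L)).exists_bound_of_continuousOn
    hc.continuousOn
  refine ⟨K, fun x => ?_⟩
  obtain ⟨y, hy, hxy⟩ := hp.exists_mem_Ico₀ hL x
  rw [hxy]
  exact hK y ⟨hy.1, hy.2.le⟩

theorem fcoeff_comp_add_right {L : ℝ} {h : ℝ → ℂ} (hL : L ≠ 0) (hp : Function.Periodic h L)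
    (y : ℝ) (n : ℤ) : fcoeff L (fun x => h (x + y)) n = mode L n y * fcoeff L h n := by
  have hper : Function.Periodic (fun s : ℝ => h s * mode L (-n) s) L := fun s => by
    simp only [Complex.ofReal_add, hp s, mode_add_period _ hL]
  have hshift : ∀ x : ℝ, h (x + y) * mode L (-n) x
      = mode L n y * (h (x + y) * mode L (-n) (x + y : ℝ)) := fun x => by
    have hinv : mode L n y * mode L (-n) y = 1 := by
      rw [mode_mul_mode, add_neg_cancel, mode_zero_left]
    rw [Complex.ofReal_add, mode_add]
    linear_combination (-(h (x + y) * mode L (-n) x)) * hinv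
  have hperiod := hper.intervalIntegral_add_eq (-(L / 2) + y) (-(L / 2))
  rw [show -(L / 2) + y + L = L / 2 + y by ring, show -(L / 2) + L = L / 2 by ring] at hperiod
  simp only [fcoeff, hshift]
  rw [intervalIntegral.integral_const_mul, intervalIntegral.integral_comp_add_right
    (fun s : ℝ => h s * mode L (-n) s), hperiod, mul_left_comm]

/-- The integrand of the principal value integral `T h (x)`, folded about the pole: the values at
`x + y` and `x - y` are combined, which is possible because `ζ₁` is odd. -/
def foldT (L δ : ℝ) (h : ℝ → ℂ) (x y : ℝ) : ℂ := zeta1 L δ y * (h (x + y) - h (x - y))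

section PrincipalValue

variable {L δ : ℝ} (hL : 0 < L) (hδ : 0 < δ) {h : ℝ → ℂ}

include hL hδ

theorem continuousOn_foldT (hc : Continuous h) :
    ContinuousOn (Function.uncurry (foldT L δ h)) (Set.univ ×ˢ Set.Ioc 0 (L / 2)) := by
  have hzeta : ContinuousOn (fun p : ℝ × ℝ => zeta1 L δ p.2) (Set.univ ×ˢ Set.Ioc 0 (L / 2)) :=
    (continuousOn_zeta1 hL hδ).comp continuous_snd.continuousOn fun p hp =>
      ⟨hp.2.1, by linarith [hp.2.2]⟩
  have hdiff : Continuous fun p : ℝ × ℝ => h (p.1 + p.2) - h (p.1 - p.2) := by fun_prop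
  exact hzeta.mul hdiff.continuousOn

theorem truncT_eq_integral_foldT (hc : Continuous h) (x : ℝ) {ε : ℝ} (hε : 0 < ε)
    (hεL : ε ≤ L / 2) :
    truncT L δ h x ε = (1 / π : ℂ) * ∫ y in ε..(L / 2), foldT L δ h x y := by
  have hzeta : ContinuousOn (fun y : ℝ => zeta1 L δ y) (Set.uIcc ε (L / 2)) :=
    (continuousOn_zeta1 hL hδ).mono fun y hy => by
      rw [Set.uIcc_of_le hεL] at hy
      exact ⟨hε.trans_le hy.1, by linarith [hy.2]⟩
  have hright : ∫ y in (x + ε)..(x + L / 2), zeta1 L δ ((y - x : ℝ) : ℂ) * h y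
      = ∫ y in ε..(L / 2), zeta1 L δ y * h (x + y) := by
    rw [← intervalIntegral.integral_comp_add_left
      (fun y => zeta1 L δ ((y - x : ℝ) : ℂ) * h y) x]
    simp only [add_sub_cancel_left]
  have hleft : ∫ y in (x - L / 2)..(x - ε), zeta1 L δ ((y - x : ℝ) : ℂ) * h y
      = ∫ y in ε..(L / 2), -(zeta1 L δ y * h (x - y)) := by
    rw [← intervalIntegral.integral_comp_sub_left
      (fun y => zeta1 L δ ((y - x : ℝ) : ℂ) * h y) x]
    simp only [sub_sub_cancel_left, zeta1_neg_ofReal hL hδ, neg_mul]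
  rw [truncT, hright, hleft, intervalIntegral.integral_neg, neg_add_eq_sub,
    ← intervalIntegral.integral_sub (ContinuousOn.intervalIntegrable (by fun_prop))
      (ContinuousOn.intervalIntegrable (by fun_prop))]
  simp only [foldT, mul_sub]

variable (hp : Function.Periodic h L) (hh : ContDiff ℝ 1 h)

include hp hh

theorem exists_norm_foldT_le :
    ∃ K : ℝ, ∀ x, ∀ y ∈ Set.Ioc 0 (L / 2), ‖foldT L δ h x y‖ ≤ K := by
  obtain ⟨A, hA⟩ := exists_norm_zeta1_mul_le hL hδ
  obtain ⟨B, hB⟩ := exists_norm_le_of_periodic hL (periodic_deriv hp) hh.continuous_deriv_one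
  have hB₀ : 0 ≤ B := (norm_nonneg _).trans (hB 0)
  refine ⟨A * (2 * B), fun x y hy => ?_⟩
  have hmean : ‖h (x + y) - h (x - y)‖ ≤ B * ‖(x + y) - (x - y)‖ :=
    Convex.norm_image_sub_le_of_norm_deriv_le (s := Set.univ)
      (fun z _ => hh.differentiable one_ne_zero z) (fun z _ => hB z) convex_univ trivial trivial
  rw [show (x + y) - (x - y) = 2 * y by ring, Real.norm_of_nonneg (by linarith [hy.1])] at hmean
  calc ‖foldT L δ h x y‖ ≤ ‖zeta1 L δ y‖ * (B * (2 * y)) := by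
        rw [foldT, norm_mul]
        gcongr
    _ = (‖zeta1 L δ y‖ * y) * (2 * B) := by ring
    _ ≤ A * (2 * B) := by
        gcongr
        exact hA y hy

theorem intervalIntegrable_foldT (x : ℝ) {a b : ℝ} (ha : 0 ≤ a) (hab : a ≤ b) (hb : b ≤ L / 2) :
    IntervalIntegrable (foldT L δ h x) MeasureTheory.volume a b := by
  obtain ⟨K, hK⟩ := exists_norm_foldT_le hL hδ hp hh
  have hsub : Set.Ioc a b ⊆ Set.Ioc 0 (L / 2) := fun y hy => ⟨ha.trans_lt hy.1, hy.2.trans hb⟩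
  have hcont : ContinuousOn (foldT L δ h x) (Set.Ioc a b) :=
    (continuousOn_foldT hL hδ hh.continuous).comp (f := fun y : ℝ => (x, y))
      (by fun_prop) fun y hy => ⟨trivial, hsub hy⟩
  rw [intervalIntegrable_iff, Set.uIoc_of_le hab]
  exact MeasureTheory.IntegrableOn.of_bound (by simp)
    (hcont.aestronglyMeasurable measurableSet_Ioc) K
    (MeasureTheory.ae_restrict_of_forall_mem measurableSet_Ioc fun y hy => hK x y (hsub hy))

theorem tendsto_truncT (x : ℝ) :
    Tendsto (truncT L δ h x) (𝓝[>] 0)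
      (𝓝 ((1 / π : ℂ) * ∫ y in (0 : ℝ)..(L / 2), foldT L δ h x y)) := by
  have hint := intervalIntegrable_foldT hL hδ hp hh x le_rfl (by positivity) le_rfl
  have hprim : ContinuousWithinAt (fun ε => ∫ y in ε..(L / 2), foldT L δ h x y)
      (Set.Ioi 0) 0 := by
    have hcont := intervalIntegral.continuousOn_primitive_interval_left
      ((intervalIntegrable_iff' (by simp)).mp hint)
    refine (hcont 0 Set.left_mem_uIcc).mono_of_mem_nhdsWithin ?_
    rw [Set.uIcc_of_le (by positivity)]
    exact mem_of_superset (Ioo_mem_nhdsGT (by positivity)) Set.Ioo_subset_Icc_self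
  refine (hprim.tendsto.const_mul _).congr' ?_
  filter_upwards [Ioo_mem_nhdsGT (by positivity : 0 < L / 2)] with ε hε
  exact (truncT_eq_integral_foldT hL hδ hh.continuous x hε.1 hε.2.le).symm

theorem tConverges (x : ℝ) : TConverges L δ h x := ⟨_, tendsto_truncT hL hδ hp hh x⟩

theorem opT_eq_integral_foldT :
    opT L δ h = fun x => (1 / π : ℂ) * ∫ y in (0 : ℝ)..(L / 2), foldT L δ h x y :=
  funext fun x => (tendsto_truncT hL hδ hp hh x).limUnder_eq

theorem periodic_opT : Function.Periodic (opT L δ h) L := fun x => by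
  simp only [opT_eq_integral_foldT hL hδ hp hh, foldT, add_right_comm x L, add_sub_right_comm x L,
    hp _]

theorem continuous_opT : Continuous (opT L δ h) := by
  obtain ⟨K, hK⟩ := exists_norm_foldT_le hL hδ hp hh
  rw [opT_eq_integral_foldT hL hδ hp hh]
  refine continuous_const.mul (intervalIntegral.continuous_of_dominated_interval
    (bound := fun _ => K) (fun x => ?_) (fun x => Eventually.of_forall fun y hy => ?_) (by simp)
    (Eventually.of_forall fun y _ => ?_))
  · exact (intervalIntegrable_foldT hL hδ hp hh x le_rfl (by positivity)
      le_rfl).aestronglyMeasurable_restrict_uIoc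
  · exact hK x y (by rwa [Set.uIoc_of_le (by positivity)] at hy)
  · have := hh.continuous
    unfold foldT
    fun_prop

theorem integral_integral_foldT_swap (n : ℤ) :
    ∫ x in (-(L / 2))..(L / 2), ∫ y in (0 : ℝ)..(L / 2), foldT L δ h x y * mode L (-n) x
      = ∫ y in (0 : ℝ)..(L / 2), ∫ x in (-(L / 2))..(L / 2), foldT L δ h x y * mode L (-n) x := by
  obtain ⟨K, hK⟩ := exists_norm_foldT_le hL hδ hp hh
  refine MeasureTheory.intervalIntegral_intervalIntegral_swap ?_
  rw [Set.uIoc_of_le (by linarith : -(L / 2) ≤ L / 2), Set.uIoc_of_le (by linarith : 0 ≤ L / 2)]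
  have hmeas : MeasurableSet (Set.Ioc (-(L / 2)) (L / 2) ×ˢ Set.Ioc 0 (L / 2)) :=
    measurableSet_Ioc.prod measurableSet_Ioc
  have hmode : Continuous fun p : ℝ × ℝ => mode L (-n) p.1 :=
    (continuous_mode_ofReal L (-n)).comp continuous_fst
  have hcont : ContinuousOn (Function.uncurry fun x y => foldT L δ h x y * mode L (-n) x)
      (Set.Ioc (-(L / 2)) (L / 2) ×ˢ Set.Ioc 0 (L / 2)) :=
    ((continuousOn_foldT hL hδ hh.continuous).mono
      (Set.prod_mono_left (Set.subset_univ _))).mul hmode.continuousOn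
  refine MeasureTheory.IntegrableOn.of_bound (C := K) ?_ (hcont.aestronglyMeasurable hmeas)
    (MeasureTheory.ae_restrict_of_forall_mem hmeas fun p hp => ?_)
  · rw [MeasureTheory.Measure.volume_eq_prod, MeasureTheory.Measure.prod_prod, Real.volume_Ioc,
      Real.volume_Ioc]
    exact ENNReal.mul_lt_top ENNReal.ofReal_lt_top ENNReal.ofReal_lt_top
  · rw [Function.uncurry, norm_mul, norm_mode_ofReal, mul_one]
    exact hK p.1 p.2 hp.2

omit hδ hh in
theorem fcoeff_foldT (hc : Continuous h) (y : ℝ) (n : ℤ) :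
    fcoeff L (fun x => foldT L δ h x y) n
      = fcoeff L h n * (zeta1 L δ y * (mode L n y - mode L (-n) y)) := by
  have hsplit : (fun x => foldT L δ h x y)
      = fun x => zeta1 L δ y * (h (x + y) + -1 * h (x + -y)) := by
    funext x
    rw [foldT, sub_eq_add_neg x y]
    ring
  rw [hsplit, fcoeff_const_mul, fcoeff_add (by fun_prop) (by fun_prop), Pi.add_apply,
    fcoeff_const_mul, fcoeff_comp_add_right hL.ne' hp, fcoeff_comp_add_right hL.ne' hp,
    Complex.ofReal_neg, mode_neg_right]
  ring

theorem fcoeff_opT :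
    fcoeff L (opT L δ h) = (fun n => I * cothSymbol L δ n) * fcoeff L h := by
  ext n
  have hpi : (π : ℂ) ≠ 0 := by exact_mod_cast Real.pi_ne_zero
  have hswap : fcoeff L (fun x => ∫ y in (0 : ℝ)..(L / 2), foldT L δ h x y) n
      = ∫ y in (0 : ℝ)..(L / 2), fcoeff L (fun x => foldT L δ h x y) n := by
    simp only [fcoeff, intervalIntegral.integral_const_mul]
    rw [← integral_integral_foldT_swap hL hδ hp hh]
    simp only [intervalIntegral.integral_mul_const]
  simp only [opT_eq_integral_foldT hL hδ hp hh, fcoeff_const_mul, hswap,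
    fcoeff_foldT hL hp hh.continuous]
  rw [intervalIntegral.integral_const_mul, integral_zeta1_mul_mode_sub_mode_neg hL hδ,
    Pi.mul_apply]
  field_simp

theorem opT_eq_trigSeries (x : ℝ) :
    opT L δ h x = trigSeries L ((fun n => I * cothSymbol L δ n) * fcoeff L h) x := by
  have hcoeff := fcoeff_opT hL hδ hp hh
  have hsum : SummableOrder 0 (fcoeff L (opT L δ h)) := by
    rw [hcoeff]
    exact (summableOrder_zero.mpr (summable_norm_fcoeff hL hp hh)).bounded_mul
      ((memℓp_cothSymbol hL hδ).const_mul I)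
  rw [eq_trigSeries_fcoeff hL (periodic_opT hL hδ hp hh) (continuous_opT hL hδ hp hh)
    hsum.summable_norm, hcoeff]

end PrincipalValue

theorem mode_I_mul (L δ : ℝ) (n : ℤ) : mode L n (I * δ) = exp (-freq L δ n) := by
  rw [mode, freq]
  congr 1
  push_cast
  linear_combination (2 * π * n * δ / L : ℂ) * I_sq

theorem mode_neg_I_mul (L δ : ℝ) (n : ℤ) : mode L n (-(I * δ)) = exp (freq L δ n) := by
  rw [← mul_neg, ← Complex.ofReal_neg, mode_I_mul, freq, freq]
  push_cast
  congr 1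
  ring

theorem cothSymbol_add_one_mul_exp_neg {L δ : ℝ} (hL : 0 < L) (hδ : 0 < δ) {n : ℤ} (hn : n ≠ 0) :
    (cothSymbol L δ n + 1) * exp (-freq L δ n) = cschSymbol L δ n := by
  have hsinh := sinh_freq_ne_zero hL hδ hn
  rw [cothSymbol, cschSymbol, div_add_one hsinh, Complex.cosh_add_sinh, div_mul_eq_mul_div,
    ← Complex.exp_add, add_neg_cancel, Complex.exp_zero]

theorem cothSymbol_sub_one_mul_exp {L δ : ℝ} (hL : 0 < L) (hδ : 0 < δ) {n : ℤ} (hn : n ≠ 0) :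
    (cothSymbol L δ n - 1) * exp (freq L δ n) = cschSymbol L δ n := by
  have hsinh := sinh_freq_ne_zero hL hδ hn
  rw [cothSymbol, cschSymbol, div_sub_one hsinh, Complex.cosh_sub_sinh, div_mul_eq_mul_div,
    ← Complex.exp_add, neg_add_cancel, Complex.exp_zero]

section ConvolutionKernel

variable {L δ : ℝ} (hL : 0 < L) {h : ℝ → ℂ} (hc : Continuous h)

include hL hc

theorem integral_kernel_mul_eq_trigSeries {K : ℝ → ℂ} {a : ℤ → ℂ} {w : ℂ}
    (hK : ∀ y : ℝ, HasSum (fun n => a n * mode L n (y - w)) (K y)) :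
    ∫ y in (-(L / 2))..(L / 2), K y * h y
      = trigSeries L (fun n => L * a (-n) * fcoeff L h n) w := by
  have hfactor : ∀ (y : ℝ) n, a n * mode L n (y - w) = a n * mode L n (-w) * mode L n y :=
    fun y n => by rw [sub_eq_add_neg, mode_add]; ring
  simp only [hfactor] at hK
  have hsum : Summable fun n => ‖a n * mode L n (-w)‖ := by
    simpa [mode_zero_right] using (hK 0).summable.norm
  have hint := hasSum_integral_mul hsum hc (fun n => continuous_mode_ofReal L n)
    (fun n x => (norm_mode_ofReal L n x).le) (-(L / 2)) (L / 2)
  simp only [(hK _).tsum_eq] at hint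
  rw [trigSeries, ← ((Equiv.neg ℤ).hasSum_iff.mpr hint).tsum_eq]
  refine tsum_congr fun n => ?_
  simp only [Function.comp_apply, Equiv.neg_apply, mul_comm (mode L (-n) _) (h _)]
  rw [integral_mul_mode_eq hL, mode_neg_right, neg_neg]
  ring

variable (hδ : 0 < δ)

include hδ

theorem opTt_eq_trigSeries (hmean : fcoeff L h 0 = 0) (x : ℝ) :
    opTt L δ h x = trigSeries L ((fun n => I * cschSymbol L δ n) * fcoeff L h) x := by
  have hkernel : ∀ y : ℝ, HasSum
      (fun n => -(π * I / L) * (cothSymbol L δ n + 1) * mode L n (y - (x + -(I * δ))))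
      (zeta1 L δ (((y - x : ℝ) : ℂ) + I * δ)) := fun y => by
    have hexp := hasSum_zeta1_upper hL hδ (z := ((y - x : ℝ) : ℂ) + I * δ)
      (by simpa using hδ) (by simpa using by linarith)
    rwa [show ((y - x : ℝ) : ℂ) + I * δ = y - (x + -(I * δ)) by push_cast; ring] at hexp ⊢
  rw [opTt, integral_kernel_mul_eq_trigSeries hL hc hkernel, trigSeries_add_right,
    ← trigSeries_const_mul]
  congr 1
  ext n
  simp only [Pi.mul_apply]
  rcases eq_or_ne n 0 with rfl | hn
  · simp [hmean]
  · have hpi : (π : ℂ) ≠ 0 := by exact_mod_cast Real.pi_ne_zero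
    have : (L : ℂ) ≠ 0 := by exact_mod_cast hL.ne'
    rw [mode_neg_I_mul, cothSymbol_neg, ← cothSymbol_sub_one_mul_exp hL hδ hn]
    field_simp
    ring

/-- With half the strip width in the kernel, `(coth + 1) e^{-s} = csch` at `s = freq L (δ / 2) n`
turns the kernel coefficients at `z + iδ/2` into `1 / sinh`. -/
theorem integral_zeta1_potential_eq_trigSeries (hmean : fcoeff L h 0 = 0) {z : ℂ}
    (hz : z ∈ openStrip δ) :
    1 / (2 * π * I) * ∫ y in (-(L / 2))..(L / 2),
        zeta1 L (δ / 2) ((y : ℂ) - z - I * (δ / 2)) * h y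
      = trigSeries L (fun n => cschSymbol L (δ / 2) n / 2 * fcoeff L h n) z := by
  have hkernel : ∀ y : ℝ, HasSum
      (fun n => -(π * I / L) * (cothSymbol L (δ / 2) n - 1)
        * mode L n (y - (z + I * (δ / 2 : ℝ))))
      (zeta1 L (δ / 2) ((y : ℂ) - z - I * (δ / 2))) := fun y => by
    have hexp := hasSum_zeta1_lower hL (half_pos hδ) (z := (y : ℂ) - z - I * (δ / 2))
      (by simp; linarith [hz.2]) (by simp; linarith [hz.1])
    rwa [show (y : ℂ) - z - I * (δ / 2) = y - (z + I * (δ / 2 : ℝ)) by push_cast; ring] at hexp ⊢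
  rw [integral_kernel_mul_eq_trigSeries hL hc hkernel, trigSeries_add_right,
    ← trigSeries_const_mul]
  congr 1
  ext n
  rcases eq_or_ne n 0 with rfl | hn
  · simp [hmean]
  · have hpi : (π : ℂ) ≠ 0 := by exact_mod_cast Real.pi_ne_zero
    have : (L : ℂ) ≠ 0 := by exact_mod_cast hL.ne'
    rw [mode_I_mul, cothSymbol_neg, ← cothSymbol_add_one_mul_exp_neg hL (half_pos hδ) hn]
    field_simp
    ring

end ConvolutionKernel

theorem opT_add_opTt_eq_trigSeries {L δ : ℝ} (hL : 0 < L) (hδ : 0 < δ) {h k : ℝ → ℂ}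
    (hp : Function.Periodic h L) (hh : ContDiff ℝ 1 h) (kp : Function.Periodic k L)
    (hk : ContDiff ℝ 1 k) (hmean : fcoeff L k 0 = 0) (x : ℝ) :
    opT L δ h x + opTt L δ k x = trigSeries L ((fun n => I * cothSymbol L δ n) * fcoeff L h
      + (fun n => I * cschSymbol L δ n) * fcoeff L k) x := by
  rw [opT_eq_trigSeries hL hδ hp hh, opTt_eq_trigSeries hL hk.continuous hδ hmean,
    ← trigSeries_add_apply]
  · exact ((summableOrder_zero.mpr (summable_norm_fcoeff hL hp hh)).bounded_mul
      ((memℓp_cothSymbol hL hδ).const_mul I)).summable_norm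
  · exact ((summableOrder_zero.mpr (summable_norm_fcoeff hL kp hk)).bounded_mul
      ((memℓp_cschSymbol hL hδ).const_mul I)).summable_norm

/-! ### Functions with an analytic logarithm on the strip -/

section Strip

variable (δ : ℝ)

theorem isOpen_openStrip : IsOpen (openStrip δ) :=
  (isOpen_lt continuous_const Complex.continuous_im).inter
    (isOpen_lt Complex.continuous_im continuous_const)

theorem convex_openStrip : Convex ℝ (openStrip δ) :=
  (convex_Ioo (-(δ / 2)) (δ / 2)).linear_preimage Complex.imLm

theorem openStrip_subset_closedStrip : openStrip δ ⊆ closedStrip δ :=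
  fun _ hz => ⟨hz.1.le, hz.2.le⟩

variable {δ}

theorem closure_openStrip (hδ : 0 < δ) : closure (openStrip δ) = closedStrip δ := by
  change closure (Complex.im ⁻¹' Set.Ioo (-(δ / 2)) (δ / 2))
    = Complex.im ⁻¹' Set.Icc (-(δ / 2)) (δ / 2)
  rw [Complex.closure_preimage_im, closure_Ioo (by linarith)]

theorem zero_mem_openStrip (hδ : 0 < δ) : (0 : ℂ) ∈ openStrip δ := by
  constructor <;> simp [hδ]

theorem add_mem_closedStrip (hδ : 0 < δ) (x : ℝ) : (x : ℂ) + I * (δ / 2) ∈ closedStrip δ :=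
  ⟨by simp; linarith, by simp⟩

theorem sub_mem_closedStrip (hδ : 0 < δ) (x : ℝ) : (x : ℂ) - I * (δ / 2) ∈ closedStrip δ :=
  ⟨by simp, by simp; linarith⟩

theorem logDeriv_eq_deriv_of_eq_exp {F f : ℂ → ℂ} (hF : ∀ z ∈ closedStrip δ, F z = exp (f z))
    (hf : DifferentiableOn ℂ f (openStrip δ)) {z : ℂ} (hz : z ∈ openStrip δ) :
    logDeriv F z = deriv f z := by
  have hn := (isOpen_openStrip δ).mem_nhds hz
  have hFexp : F =ᶠ[𝓝 z] fun w => exp (f w) := by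
    filter_upwards [hn] with w hw using hF w (openStrip_subset_closedStrip δ hw)
  rw [logDeriv_apply, hFexp.deriv_eq, hFexp.eq_of_nhds,
    (hf.differentiableAt hn).hasDerivAt.cexp.deriv]
  exact mul_div_cancel_left₀ _ (exp_ne_zero _)

theorem eqOn_add_const_of_deriv_eq (hδ : 0 < δ) {f g : ℂ → ℂ}
    (hf : DifferentiableOn ℂ f (openStrip δ)) (hg : DifferentiableOn ℂ g (openStrip δ))
    (hfc : ContinuousOn f (closedStrip δ)) (hgc : ContinuousOn g (closedStrip δ))
    (h : Set.EqOn (deriv f) (deriv g) (openStrip δ)) :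
    Set.EqOn g (fun z => g 0 - f 0 + f z) (closedStrip δ) := by
  have hopen : Set.EqOn g (fun z => g 0 - f 0 + f z) (openStrip δ) := by
    refine (isOpen_openStrip δ).eqOn_of_deriv_eq (convex_openStrip δ).isPreconnected hg
      (hf.const_add _) (fun z hz => ?_) (zero_mem_openStrip hδ) (by ring)
    rw [deriv_const_add, h hz]
  exact hopen.of_subset_closure hgc (continuousOn_const.add hfc) (openStrip_subset_closedStrip δ)
    (closure_openStrip hδ).ge

theorem HasAnalyticLog.exists_eq_const_mul (hδ : 0 < δ) {F₁ F₂ : ℂ → ℂ}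
    (h₁ : HasAnalyticLog δ F₁) (h₂ : HasAnalyticLog δ F₂)
    (h : Set.EqOn (logDeriv F₁) (logDeriv F₂) (openStrip δ)) :
    ∃ c : ℂ, c ≠ 0 ∧ ∀ z ∈ closedStrip δ, F₂ z = c * F₁ z := by
  obtain ⟨f, hf, hfd, hfc⟩ := h₁
  obtain ⟨g, hg, hgd, hgc⟩ := h₂
  have hlog := eqOn_add_const_of_deriv_eq hδ hfd hgd hfc hgc fun z hz => by
    rw [← logDeriv_eq_deriv_of_eq_exp hf hfd hz, h hz, logDeriv_eq_deriv_of_eq_exp hg hgd hz]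
  refine ⟨exp (g 0 - f 0), exp_ne_zero _, fun z hz => ?_⟩
  rw [hf z hz, hg z hz, hlog hz, Complex.exp_add]

end Strip

section StripSummable

/-- The trigonometric series with coefficients `a` converges absolutely, uniformly on the closed
strip `|Im z| ≤ δ/2`; note that `|freq L (δ / 2) n| = π |n| δ / L`. -/
def StripSummable (L δ : ℝ) (a : ℤ → ℂ) : Prop :=
  Summable fun n => Real.exp |freq L (δ / 2) n| * ‖a n‖

variable {L δ : ℝ} {a : ℤ → ℂ}

theorem norm_mode_le_of_mem_closedStrip {z : ℂ} (hz : z ∈ closedStrip δ) (n : ℤ) :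
    ‖mode L n z‖ ≤ Real.exp |freq L (δ / 2) n| := by
  have hfreq : freq L (δ / 2) n = 2 * π * n / L * (δ / 2) := by rw [freq]; ring
  rw [norm_mode, hfreq, abs_mul]
  refine Real.exp_le_exp.mpr ((neg_le_abs _).trans ?_)
  rw [abs_mul]
  exact mul_le_mul_of_nonneg_left ((abs_le.mpr hz).trans (le_abs_self _)) (abs_nonneg _)

namespace StripSummable

theorem norm_mul_mode_le (a : ℤ → ℂ) {z : ℂ} (hz : z ∈ closedStrip δ) (n : ℤ) :
    ‖a n * mode L n z‖ ≤ Real.exp |freq L (δ / 2) n| * ‖a n‖ := by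
  rw [norm_mul, mul_comm]
  gcongr
  exact norm_mode_le_of_mem_closedStrip hz n

theorem summable_mul_mode (ha : StripSummable L δ a) {z : ℂ} (hz : z ∈ closedStrip δ) :
    Summable fun n => a n * mode L n z :=
  Summable.of_norm_bounded ha (norm_mul_mode_le a hz)

theorem continuousOn_trigSeries (ha : StripSummable L δ a) :
    ContinuousOn (trigSeries L a) (closedStrip δ) :=
  continuousOn_tsum (fun n => (continuous_const.mul (continuous_mode L n)).continuousOn) ha
    fun n _ hz => norm_mul_mode_le a hz n

theorem of_derivSymbol_mul (hL : L ≠ 0) (ha : StripSummable L δ (derivSymbol L * a)) :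
    StripSummable L δ a := by
  let w : ℤ → ℂ := fun n => Real.exp |freq L (δ / 2) n|
  have hw : ∀ b : ℤ → ℂ, StripSummable L δ b ↔ SummableOrder 0 (w * b) := fun b => by
    simp only [StripSummable, summableOrder_zero, Pi.mul_apply, norm_mul, w, Complex.norm_real,
      Real.norm_eq_abs, Real.abs_exp]
  rw [hw, mul_left_comm] at ha
  exact (hw a).mpr ((ha.of_derivSymbol_mul hL).mono zero_le_one)

theorem hasDerivAt_trigSeries (hL : L ≠ 0) (ha : StripSummable L δ (derivSymbol L * a)) {z : ℂ}
    (hz : z ∈ openStrip δ) :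
    HasDerivAt (trigSeries L a) (trigSeries L (derivSymbol L * a) z) z := by
  refine hasDerivAt_tsum_of_isPreconnected ha (isOpen_openStrip δ)
    (convex_openStrip δ).isPreconnected (g' := fun n w => (derivSymbol L * a) n * mode L n w)
    (fun n w _ => ?_)
    (fun n w hw => norm_mul_mode_le _ (openStrip_subset_closedStrip δ hw) n) hz
    ((ha.of_derivSymbol_mul hL).summable_mul_mode (openStrip_subset_closedStrip δ hz)) hz
  exact ((hasDerivAt_mode L n w).const_mul (a n)).congr_deriv (by rw [Pi.mul_apply]; ring)

end StripSummable

theorem norm_cschSymbol_mul_exp_le (hL : 0 < L) (hδ : 0 < δ) (n : ℤ) :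
    Real.exp |freq L δ n| * ‖cschSymbol L δ n‖ ≤ ‖cothSymbol L δ n‖ + 1 := by
  rcases eq_or_ne n 0 with rfl | hn
  · simp
  have hexp : ∀ s : ℝ, ‖exp (s : ℂ)‖ = Real.exp s := fun s => by
    rw [← Complex.ofReal_exp, Complex.norm_real, Real.norm_of_nonneg (Real.exp_pos s).le]
  rcases abs_choice (freq L δ n) with hs | hs
  · rw [hs, ← cothSymbol_add_one_mul_exp_neg hL hδ hn, norm_mul, ← Complex.ofReal_neg, hexp,
      mul_left_comm, ← Real.exp_add, add_neg_cancel, Real.exp_zero, mul_one]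
    exact (norm_add_le _ _).trans_eq (by rw [norm_one])
  · rw [hs, ← cothSymbol_sub_one_mul_exp hL hδ hn, norm_mul, hexp,
      mul_left_comm, ← Real.exp_add, neg_add_cancel, Real.exp_zero, mul_one]
    exact (norm_sub_le _ _).trans_eq (by rw [norm_one])

theorem stripSummable_cschSymbol_mul (hL : 0 < L) (hδ : 0 < δ) (ha : Summable fun n => ‖a n‖) :
    StripSummable L δ (cschSymbol L (δ / 2) * a) := by
  obtain ⟨B, hB⟩ := memℓp_infty_iff.mp (memℓp_cothSymbol hL (half_pos hδ))
  refine Summable.of_nonneg_of_le (fun n => by positivity) (fun n => ?_) (ha.mul_left (B + 1))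
  have hBn : ‖cothSymbol L (δ / 2) n‖ ≤ B := hB (Set.mem_range_self n)
  rw [Pi.mul_apply, norm_mul, ← mul_assoc]
  gcongr
  linarith [norm_cschSymbol_mul_exp_le hL (half_pos hδ) n]

end StripSummable

/-! ### Potentials -/

/-- The right-hand sides `J` for which `i ∂_z log F = (1/(2πi)) ∫ ζ₁ J` is solved by a Fourier
series. -/
structure IsPotentialSource (L : ℝ) (J : ℝ → ℂ) : Prop where
  continuous : Continuous J
  fcoeff_zero : fcoeff L J 0 = 0
  summable : Summable fun n => ‖fcoeff L J n‖

/-- The Fourier coefficients of the solution `log F` of `i ∂_z log F = (1/(2πi)) ∫ ζ₁ J`, obtained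
by dividing those of the right-hand side by the symbol of `i ∂_z`. The coefficient with `n = 0`,
which is arbitrary, is set to `0`. -/
def potentialCoeff (L δ : ℝ) (J : ℝ → ℂ) (n : ℤ) : ℂ :=
  (I * derivSymbol L n)⁻¹ * (cschSymbol L (δ / 2) n / 2 * fcoeff L J n)

/-- The solution `log F` of `i ∂_z log F = (1/(2πi)) ∫ ζ₁ J` of mean zero. -/
def potential (L δ : ℝ) (J : ℝ → ℂ) : ℂ → ℂ := trigSeries L (potentialCoeff L δ J)

section Potential

variable {L δ : ℝ} {J : ℝ → ℂ}

theorem derivSymbol_mul_potentialCoeff (hL : L ≠ 0) :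
    derivSymbol L * potentialCoeff L δ J
      = cschSymbol L (δ / 2) * fun n => (-I / 2) * fcoeff L J n := by
  ext n
  simp only [Pi.mul_apply, potentialCoeff]
  rcases eq_or_ne n 0 with rfl | hn
  · simp
  · have : derivSymbol L n ≠ 0 := by
      simp [derivSymbol, hL, hn, Real.pi_ne_zero]
    have hI : I * I = -1 := I_mul_I
    field_simp
    linear_combination cschSymbol L (δ / 2) n * fcoeff L J n * hI

variable (hL : 0 < L) (hδ : 0 < δ)

include hL

theorem periodic_potential (z : ℂ) : potential L δ J (z + L) = potential L δ J z :=
  trigSeries_add_period hL.ne' _ z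

include hδ

theorem stripSummable_derivSymbol_mul_potentialCoeff (hs : Summable fun n => ‖fcoeff L J n‖) :
    StripSummable L δ (derivSymbol L * potentialCoeff L δ J) := by
  rw [derivSymbol_mul_potentialCoeff hL.ne']
  exact stripSummable_cschSymbol_mul hL hδ (by simpa only [norm_mul] using hs.mul_left _)

theorem continuousOn_potential (hs : Summable fun n => ‖fcoeff L J n‖) :
    ContinuousOn (potential L δ J) (closedStrip δ) :=
  ((stripSummable_derivSymbol_mul_potentialCoeff hL hδ hs).of_derivSymbol_mul
    hL.ne').continuousOn_trigSeries

theorem IsPotentialSource.hasDerivAt_potential (hJ : IsPotentialSource L J) {z : ℂ}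
    (hz : z ∈ openStrip δ) :
    HasDerivAt (potential L δ J) (-I * (1 / (2 * π * I) * ∫ y in (-(L / 2))..(L / 2),
      zeta1 L (δ / 2) ((y : ℂ) - z - I * (δ / 2)) * J y)) z := by
  refine ((stripSummable_derivSymbol_mul_potentialCoeff hL hδ hJ.summable).hasDerivAt_trigSeries
    hL.ne' hz).congr_deriv ?_
  rw [integral_zeta1_potential_eq_trigSeries hL hJ.continuous hδ hJ.fcoeff_zero hz,
    ← trigSeries_const_mul, derivSymbol_mul_potentialCoeff hL.ne']
  congr 1
  ext n
  rw [Pi.mul_apply]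
  ring

theorem isHirotaPotential_exp_potential {K : ℝ → ℝ → ℂ}
    (hK : ∀ t, IsPotentialSource L fun y => K y t) (c : ℝ → ℂ) :
    IsHirotaPotential L δ K fun z t => exp (c t + potential L δ (fun y => K y t) z) := by
  intro t
  have hderiv := fun z hz => ((hK t).hasDerivAt_potential hL hδ (z := z) hz).const_add (c t)
  refine ⟨⟨_, fun _ _ => rfl, fun z hz => (hderiv z hz).differentiableAt.differentiableWithinAt,
    continuousOn_const.add (continuousOn_potential hL hδ (hK t).summable)⟩, fun z hz => ?_⟩
  rw [logDeriv_apply, (hderiv z hz).cexp.deriv, mul_div_cancel_left₀ _ (exp_ne_zero _),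
    ← mul_assoc I, mul_neg, I_mul_I, neg_neg, one_mul]

theorem exists_isHirotaPotential {K : ℝ → ℝ → ℂ}
    (hK : ∀ t, IsPotentialSource L fun y => K y t) {c : ℝ → ℂ} (hc : ∀ t, c t ≠ 0) :
    ∃ F : ℂ → ℝ → ℂ, IsHirotaPotential L δ K F ∧ ∀ t, F 0 t = c t := by
  refine ⟨_, isHirotaPotential_exp_potential hL hδ hK
    fun t => Complex.log (c t) - potential L δ (fun y => K y t) 0, fun t => ?_⟩
  rw [sub_add_cancel, Complex.exp_log (hc t)]

omit hL in
theorem IsHirotaPotential.exists_eq_const_mul {K : ℝ → ℝ → ℂ} {F₁ F₂ : ℂ → ℝ → ℂ}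
    (h₁ : IsHirotaPotential L δ K F₁) (h₂ : IsHirotaPotential L δ K F₂) :
    ∃ c : ℝ → ℂ, ∀ t, c t ≠ 0 ∧ ∀ z ∈ closedStrip δ, F₂ z t = c t * F₁ z t := by
  have hmul : ∀ t, ∃ c : ℂ, c ≠ 0 ∧ ∀ z ∈ closedStrip δ, F₂ z t = c * F₁ z t := fun t =>
    (h₁ t).1.exists_eq_const_mul hδ (h₂ t).1 fun z hz =>
      mul_left_cancel₀ I_ne_zero (((h₁ t).2 z hz).trans ((h₂ t).2 z hz).symm)
  choose c hc using hmul
  exact ⟨c, hc⟩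

theorem IsHirotaPotential.eq_mul_exp_potential {K : ℝ → ℝ → ℂ} {F : ℂ → ℝ → ℂ}
    (hK : ∀ t, IsPotentialSource L fun y => K y t) (hF : IsHirotaPotential L δ K F) (t : ℝ) :
    F 0 t ≠ 0 ∧ ∀ z ∈ closedStrip δ, F z t = F 0 t *
      exp (potential L δ (fun y => K y t) z - potential L δ (fun y => K y t) 0) := by
  obtain ⟨c, hc⟩ := (isHirotaPotential_exp_potential hL hδ hK 0).exists_eq_const_mul hδ hF
  have hzero := (hc t).2 0 (openStrip_subset_closedStrip δ (zero_mem_openStrip hδ))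
  refine ⟨hzero ▸ mul_ne_zero (hc t).1 (exp_ne_zero _), fun z hz => ?_⟩
  rw [hzero, (hc t).2 z hz, mul_assoc, ← Complex.exp_add]
  congr 2
  ring

end Potential

/-! ### Partial derivatives of functions on the plane -/

section Partial

variable {u : ℝ → ℝ → ℂ} {n : ℕ}

theorem contDiff_slice_x {n : WithTop ℕ∞} (hu : ContDiff ℝ n fun p : ℝ × ℝ => u p.1 p.2) (t : ℝ) :
    ContDiff ℝ n fun x => u x t :=
  hu.comp (contDiff_id.prodMk contDiff_const)

theorem contDiff_slice_t {n : WithTop ℕ∞} (hu : ContDiff ℝ n fun p : ℝ × ℝ => u p.1 p.2) (x : ℝ) :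
    ContDiff ℝ n fun t => u x t :=
  hu.comp (contDiff_const.prodMk contDiff_id)

theorem hasDerivAt_dt (hu : ContDiff ℝ 1 fun p : ℝ × ℝ => u p.1 p.2) (x t : ℝ) :
    HasDerivAt (fun s => u x s) (dt u x t) t :=
  ((contDiff_slice_t hu x).differentiable one_ne_zero t).hasDerivAt

theorem dx_eq_fderiv (hu : ContDiff ℝ 1 fun p : ℝ × ℝ => u p.1 p.2) :
    (fun p : ℝ × ℝ => dx u p.1 p.2) = fun p => fderiv ℝ (fun p : ℝ × ℝ => u p.1 p.2) p (1, 0) := by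
  ext ⟨x, t⟩
  have hline : HasDerivAt (fun y : ℝ => (y, t)) (1, 0) x :=
    (hasDerivAt_id x).prodMk (hasDerivAt_const x t)
  exact ((hu.differentiable one_ne_zero (x, t)).hasFDerivAt.comp_hasDerivAt x hline).deriv

theorem dt_eq_fderiv (hu : ContDiff ℝ 1 fun p : ℝ × ℝ => u p.1 p.2) :
    (fun p : ℝ × ℝ => dt u p.1 p.2) = fun p => fderiv ℝ (fun p : ℝ × ℝ => u p.1 p.2) p (0, 1) := by
  ext ⟨x, t⟩
  have hline : HasDerivAt (fun s : ℝ => (x, s)) (0, 1) t :=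
    (hasDerivAt_const t x).prodMk (hasDerivAt_id t)
  exact ((hu.differentiable one_ne_zero (x, t)).hasFDerivAt.comp_hasDerivAt t hline).deriv

theorem contDiff_dx (hu : ContDiff ℝ (n + 1 : ℕ) fun p : ℝ × ℝ => u p.1 p.2) :
    ContDiff ℝ n fun p : ℝ × ℝ => dx u p.1 p.2 := by
  rw [dx_eq_fderiv (hu.of_le (by push_cast; exact le_add_self))]
  exact (hu.fderiv_right (m := n) (by push_cast; rfl)).clm_apply contDiff_const

theorem contDiff_dt (hu : ContDiff ℝ (n + 1 : ℕ) fun p : ℝ × ℝ => u p.1 p.2) :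
    ContDiff ℝ n fun p : ℝ × ℝ => dt u p.1 p.2 := by
  rw [dt_eq_fderiv (hu.of_le (by push_cast; exact le_add_self))]
  exact (hu.fderiv_right (m := n) (by push_cast; rfl)).clm_apply contDiff_const

theorem dt_dx_comm (hu : ContDiff ℝ 2 fun p : ℝ × ℝ => u p.1 p.2) (x t : ℝ) :
    dt (dx u) x t = dx (dt u) x t := by
  have hu1 : ContDiff ℝ 1 fun p : ℝ × ℝ => u p.1 p.2 := hu.of_le (by norm_num)
  have hfderiv := ((hu.fderiv_right (m := 1) (by norm_num)).differentiable one_ne_zero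
    (x, t)).hasFDerivAt
  have happly : ∀ v : ℝ × ℝ, fderiv ℝ (fun p => fderiv ℝ (fun p : ℝ × ℝ => u p.1 p.2) p v) (x, t)
      = (fderiv ℝ (fderiv ℝ fun p : ℝ × ℝ => u p.1 p.2) (x, t)).flip v := fun v => by
    simpa using (hfderiv.clm_apply (hasFDerivAt_const v (x, t))).fderiv
  have htx := congrFun (dt_eq_fderiv (contDiff_dx (n := 1) hu)) (x, t)
  have hxt := congrFun (dx_eq_fderiv (contDiff_dt (n := 1) hu)) (x, t)
  rw [dx_eq_fderiv hu1, happly] at htx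
  rw [dt_eq_fderiv hu1, happly] at hxt
  rw [htx, hxt]
  exact ((hu.contDiffAt (x := (x, t))).isSymmSndFDerivAt (by simp)).eq (0, 1) (1, 0)

theorem periodic_dt {L : ℝ} (hp : ∀ t, Function.Periodic (fun x => u x t) L) (t : ℝ) :
    Function.Periodic (fun x => dt u x t) L := fun x =>
  congrArg (deriv · t) (funext fun s => hp s x)

end Partial

/-! ### Coefficients depending on time -/

/-- A family `a t` of summable coefficient sequences that may be differentiated in `t` term by term
under the sum, with derivative `a' t`: the derivatives have, near every `t`, a summable
majorant. -/
structure HasSummableDeriv (a a' : ℝ → ℤ → ℂ) : Prop where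
  summable : ∀ t, Summable fun n => ‖a t n‖
  hasDerivAt : ∀ n t, HasDerivAt (fun s => a s n) (a' t n) t
  dominated : ∀ t, ∃ K : ℤ → ℝ, Summable K ∧ ∀ s ∈ Set.Ioo (t - 1) (t + 1), ∀ n, ‖a' s n‖ ≤ K n

namespace HasSummableDeriv

variable {L : ℝ} {a a' b b' : ℝ → ℤ → ℂ}

theorem add (ha : HasSummableDeriv a a') (hb : HasSummableDeriv b b') :
    HasSummableDeriv (fun t => a t + b t) (fun t => a' t + b' t) where
  summable t := Summable.of_nonneg_of_le (fun _ => norm_nonneg _) (fun _ => norm_add_le _ _)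
    ((ha.summable t).add (hb.summable t))
  hasDerivAt n t := (ha.hasDerivAt n t).add (hb.hasDerivAt n t)
  dominated t := by
    obtain ⟨K, hKs, hK⟩ := ha.dominated t
    obtain ⟨M, hMs, hM⟩ := hb.dominated t
    exact ⟨fun n => K n + M n, hKs.add hMs, fun s hs n =>
      (norm_add_le _ _).trans (add_le_add (hK s hs n) (hM s hs n))⟩

theorem bounded_mul {m : ℤ → ℂ} (hm : Memℓp m ⊤) (ha : HasSummableDeriv a a') :
    HasSummableDeriv (fun t => m * a t) (fun t => m * a' t) where
  summable t :=
    summableOrder_zero.mp ((summableOrder_zero.mpr (ha.summable t)).bounded_mul hm)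
  hasDerivAt n t := (ha.hasDerivAt n t).const_mul (m n)
  dominated t := by
    obtain ⟨B, hB⟩ := memℓp_infty_iff.mp hm
    obtain ⟨K, hKs, hK⟩ := ha.dominated t
    refine ⟨fun n => B * K n, hKs.mul_left B, fun s hs n => ?_⟩
    have hBn : ‖m n‖ ≤ B := hB (Set.mem_range_self n)
    rw [Pi.mul_apply, norm_mul]
    exact mul_le_mul hBn (hK s hs n) (norm_nonneg _) ((norm_nonneg _).trans hBn)

theorem hasDerivAt_trigSeries (ha : HasSummableDeriv a a') (x t : ℝ) :
    HasDerivAt (fun s => trigSeries L (a s) x) (trigSeries L (a' t) x) t := by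
  obtain ⟨K, hKs, hK⟩ := ha.dominated t
  have ht : t ∈ Set.Ioo (t - 1) (t + 1) := ⟨by linarith, by linarith⟩
  refine hasDerivAt_tsum_of_isPreconnected (g := fun n s => a s n * mode L n x)
    (g' := fun n s => a' s n * mode L n x) hKs isOpen_Ioo isPreconnected_Ioo
    (fun n s _ => (ha.hasDerivAt n s).mul_const _) (fun n s hs => ?_) ht
    (summable_mul_mode_ofReal (ha.summable t) x) ht
  rw [norm_mul, norm_mode_ofReal, mul_one]
  exact hK s hs n

end HasSummableDeriv

section Time

variable {L : ℝ} {u : ℝ → ℝ → ℂ}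

theorem hasDerivAt_fcoeff_time (hu : ContDiff ℝ 2 fun p : ℝ × ℝ => u p.1 p.2) (n : ℤ) (t : ℝ) :
    HasDerivAt (fun s => fcoeff L (fun x => u x s) n) (fcoeff L (fun x => dt u x t) n) t := by
  have hu1 : ContDiff ℝ 1 fun p : ℝ × ℝ => u p.1 p.2 := hu.of_le (by norm_num)
  have hdt : ContDiff ℝ 1 fun p : ℝ × ℝ => dt u p.1 p.2 := contDiff_dt (n := 1) hu
  obtain ⟨K, hK⟩ := ((isCompact_uIcc (a := -(L / 2)) (b := L / 2)).prod
    (isCompact_Icc (a := t - 1) (b := t + 1))).exists_bound_of_continuousOn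
      hdt.continuous.continuousOn
  have hcont : ∀ s, Continuous fun x : ℝ => u x s * mode L (-n) x := fun s =>
    (contDiff_slice_x hu1 s).continuous.mul (continuous_mode_ofReal L (-n))
  refine HasDerivAt.const_mul _ (intervalIntegral.hasDerivAt_integral_of_dominated_loc_of_deriv_le
    (F' := fun s x => dt u x s * mode L (-n) x)
    (s := Set.Ioo (t - 1) (t + 1)) (bound := fun _ => K) (Ioo_mem_nhds (by linarith) (by linarith))
    (Eventually.of_forall fun s => (hcont s).aestronglyMeasurable)
    ((hcont t).intervalIntegrable _ _)
    ((contDiff_slice_x hdt t).continuous.mul (continuous_mode_ofReal L (-n))).aestronglyMeasurable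
    (Eventually.of_forall fun x hx s hs => ?_) (by simp)
    (Eventually.of_forall fun x _ s _ => (hasDerivAt_dt hu1 x s).mul_const _)).2
  rw [norm_mul, norm_mode_ofReal, mul_one]
  exact hK (x, s) ⟨Set.uIoc_subset_uIcc hx, hs.1.le, hs.2.le⟩

theorem summable_inv_one_add_sq_norm_derivSymbol (hL : L ≠ 0) :
    Summable fun n : ℤ => (1 + ‖derivSymbol L n‖ ^ 2)⁻¹ := by
  refine Summable.of_norm_bounded_eventually
    ((Real.summable_one_div_int_pow.mpr one_lt_two).mul_left ((2 * π / |L|) ^ 2)⁻¹) ?_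
  filter_upwards [(Set.finite_singleton (0 : ℤ)).compl_mem_cofinite] with n hn
  have hn : (n : ℝ) ≠ 0 := by exact_mod_cast hn
  have : 0 < |L| := abs_pos.mpr hL
  rw [norm_derivSymbol, norm_inv, Real.norm_of_nonneg (by positivity), one_div, ← mul_inv, mul_pow,
    sq_abs]
  gcongr
  linarith

theorem norm_fcoeff_le_inv_one_add_sq (hL : 0 < L) {h : ℝ → ℂ} (hp : Function.Periodic h L)
    (hh : ContDiff ℝ 2 h) {K : ℝ} (hK : ∀ x ∈ Set.Icc (-(L / 2)) (L / 2), ‖h x‖ ≤ K)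
    (hK2 : ∀ x ∈ Set.Icc (-(L / 2)) (L / 2), ‖deriv (deriv h) x‖ ≤ K) (n : ℤ) :
    ‖fcoeff L h n‖ ≤ 2 * K * (1 + ‖derivSymbol L n‖ ^ 2)⁻¹ := by
  have hdd : ‖fcoeff L (deriv (deriv h)) n‖ = ‖derivSymbol L n‖ ^ 2 * ‖fcoeff L h n‖ := by
    rw [fcoeff_deriv hL (periodic_deriv hp) (hh.deriv' (n := 1)),
      fcoeff_deriv hL hp (hh.of_le (by norm_num)), Pi.mul_apply, Pi.mul_apply, norm_mul, norm_mul]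
    ring
  rw [← div_eq_mul_inv, le_div_iff₀ (by positivity)]
  linarith [norm_fcoeff_le hL hK n, hdd ▸ norm_fcoeff_le hL hK2 n]

theorem hasSummableDeriv_fcoeff (hL : 0 < L) (hu : ContDiff ℝ 3 fun p : ℝ × ℝ => u p.1 p.2)
    (hp : ∀ t, Function.Periodic (fun x => u x t) L) :
    HasSummableDeriv (fun t => fcoeff L fun x => u x t) fun t => fcoeff L fun x => dt u x t where
  summable t := summable_norm_fcoeff hL (hp t) ((contDiff_slice_x hu t).of_le (by norm_num))
  hasDerivAt := hasDerivAt_fcoeff_time (hu.of_le (by norm_num))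
  dominated t := by
    have hdt : ContDiff ℝ 2 fun p : ℝ × ℝ => dt u p.1 p.2 := contDiff_dt (n := 2) hu
    have hdtxx : ContDiff ℝ 0 fun p : ℝ × ℝ => dx (dx (dt u)) p.1 p.2 :=
      contDiff_dx (n := 0) (contDiff_dx (n := 1) hdt)
    have hcompact := (isCompact_Icc (a := -(L / 2)) (b := L / 2)).prod
      (isCompact_Icc (a := t - 1) (b := t + 1))
    obtain ⟨K, hK⟩ := hcompact.exists_bound_of_continuousOn hdt.continuous.continuousOn
    obtain ⟨M, hM⟩ := hcompact.exists_bound_of_continuousOn hdtxx.continuous.continuousOn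
    refine ⟨_, (summable_inv_one_add_sq_norm_derivSymbol hL.ne').mul_left (2 * max K M),
      fun s hs n => norm_fcoeff_le_inv_one_add_sq hL (periodic_dt hp s) (contDiff_slice_x hdt s)
        (fun x hx => ?_) (fun x hx => ?_) n⟩
    · exact (hK (x, s) ⟨hx, hs.1.le, hs.2.le⟩).trans (le_max_left _ _)
    · exact (hM (x, s) ⟨hx, hs.1.le, hs.2.le⟩).trans (le_max_right _ _)

end Time

/-! ### The bilinear equations in logarithmic variables -/

/-- The spatial logarithmic derivative `∂ₓ log P`. -/
def logDx (P : ℝ → ℝ → ℂ) (x t : ℝ) : ℂ := logDeriv (fun y => P y t) x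

/-- The function `a + i ∂ₓ log (P / Q)`: `u` is obtained from `P = F⁻`, `Q = G⁺` and `v` from
`P = G⁻`, `Q = F⁺`. -/
def hirotaField (a : ℂ) (P Q : ℝ → ℝ → ℂ) (x t : ℝ) : ℂ :=
  a + I * logDeriv (fun y => P y t / Q y t) x

/-- The left-hand side of one bilinear equation. -/
def hirotaForm (a l : ℂ) (P Q : ℝ → ℝ → ℂ) (x t : ℝ) : ℂ :=
  I * hirotaDt P Q x t - hirotaDxx P Q x t + 2 * I * a * hirotaDx P Q x t
    + (-l + a ^ 2) * (P x t * Q x t)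

/-- The expression that the bilinear equation with parameter `l` equates to `l t`. -/
def hirotaDensity (a : ℂ) (P Q : ℝ → ℝ → ℂ) (x t : ℝ) : ℂ :=
  I * logDeriv (fun s => P x s / Q x s) t + hirotaField a P Q x t ^ 2
    - (dx (logDx P) x t + dx (logDx Q) x t)

section HirotaForm

variable {P Q : ℝ → ℝ → ℂ} {a : ℂ}

theorem hirotaField_eq {x t : ℝ} (hP : DifferentiableAt ℝ (fun y => P y t) x)
    (hQ : DifferentiableAt ℝ (fun y => Q y t) x) (hP0 : P x t ≠ 0) (hQ0 : Q x t ≠ 0) :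
    hirotaField a P Q x t = a + I * (logDx P x t - logDx Q x t) := by
  rw [hirotaField, logDeriv_div x hP0 hQ0 hP hQ, logDx, logDx]

theorem dx_logDx {x t : ℝ} (hP : ContDiff ℝ 2 fun y => P y t) (hP0 : P x t ≠ 0) :
    dx (logDx P) x t = dxx P x t / P x t - logDx P x t ^ 2 := by
  have hPx : HasDerivAt (fun y => P y t) (dx P x t) x :=
    (hP.differentiable two_ne_zero x).hasDerivAt
  have hPxx : HasDerivAt (fun y => dx P y t) (dxx P x t) x :=
    ((hP.deriv' (n := 1)).differentiable one_ne_zero x).hasDerivAt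
  have hquot : dx (logDx P) x t = _ := (hPxx.div hPx hP0).deriv
  have hlog : logDx P x t = dx P x t / P x t := rfl
  rw [hquot, hlog]
  field_simp

theorem hirotaForm_eq {x t : ℝ} (hP : ContDiff ℝ 2 fun y => P y t)
    (hQ : ContDiff ℝ 2 fun y => Q y t) (hPt : DifferentiableAt ℝ (fun s => P x s) t)
    (hQt : DifferentiableAt ℝ (fun s => Q x s) t) (hP0 : P x t ≠ 0) (hQ0 : Q x t ≠ 0) (l : ℂ) :
    hirotaForm a l P Q x t = P x t * Q x t * (hirotaDensity a P Q x t - l) := by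
  have hlogDx : ∀ R : ℝ → ℝ → ℂ, logDx R x t = dx R x t / R x t := fun _ => rfl
  have hlogDt : ∀ R : ℝ → ℝ → ℂ, logDeriv (fun s => R x s) t = dt R x t / R x t := fun _ => rfl
  rw [hirotaForm, hirotaDensity, dx_logDx hP hP0, dx_logDx hQ hQ0,
    hirotaField_eq (hP.differentiable two_ne_zero x) (hQ.differentiable two_ne_zero x) hP0 hQ0,
    logDeriv_div t hP0 hQ0 hPt hQt, hlogDt, hlogDt, hlogDx, hlogDx, hirotaDt, hirotaDxx, hirotaDx]
  field_simp
  linear_combination (-(dx P x t * Q x t - P x t * dx Q x t) ^ 2) * I_sq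

theorem hirotaForm_eq_zero_iff {x t : ℝ} (hP : ContDiff ℝ 2 fun y => P y t)
    (hQ : ContDiff ℝ 2 fun y => Q y t) (hPt : DifferentiableAt ℝ (fun s => P x s) t)
    (hQt : DifferentiableAt ℝ (fun s => Q x s) t) (hP0 : P x t ≠ 0) (hQ0 : Q x t ≠ 0) (l : ℂ) :
    hirotaForm a l P Q x t = 0 ↔ hirotaDensity a P Q x t = l := by
  rw [hirotaForm_eq hP hQ hPt hQt hP0 hQ0, mul_eq_zero, or_iff_right (mul_ne_zero hP0 hQ0),
    sub_eq_zero]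

theorem contDiff_logDx {n : ℕ} (hP : ContDiff ℝ (n + 1 : ℕ) fun p : ℝ × ℝ => P p.1 p.2)
    (hP0 : ∀ x t, P x t ≠ 0) : ContDiff ℝ n fun p : ℝ × ℝ => logDx P p.1 p.2 := by
  have heq : (fun p : ℝ × ℝ => logDx P p.1 p.2) = fun p => dx P p.1 p.2 * (P p.1 p.2)⁻¹ :=
    funext fun _ => div_eq_mul_inv _ _
  rw [heq]
  exact (contDiff_dx hP).mul
    ((hP.of_le (by push_cast; exact le_self_add)).inv fun p => hP0 p.1 p.2)

theorem periodic_logDx {L : ℝ} {t : ℝ} (hp : Function.Periodic (fun x => P x t) L) :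
    Function.Periodic (fun x => logDx P x t) L :=
  (periodic_deriv hp).div hp

theorem hasDerivAt_logDeriv_time (hP : ContDiff ℝ 2 fun p : ℝ × ℝ => P p.1 p.2)
    (hP0 : ∀ x t, P x t ≠ 0) (x t : ℝ) :
    HasDerivAt (fun y => logDeriv (fun s => P y s) t) (dt (logDx P) x t) x := by
  have hP1 : ContDiff ℝ 1 fun p : ℝ × ℝ => P p.1 p.2 := hP.of_le (by norm_num)
  have hx : ∀ {R : ℝ → ℝ → ℂ}, (ContDiff ℝ 1 fun p : ℝ × ℝ => R p.1 p.2) →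
      HasDerivAt (fun y => R y t) (dx R x t) x := fun hR =>
    ((contDiff_slice_x hR t).differentiable one_ne_zero x).hasDerivAt
  have hquot := (hasDerivAt_dt (contDiff_dx (n := 1) hP) x t).div (hasDerivAt_dt hP1 x t) (hP0 x t)
  have hmixed : dt (logDx P) x t = _ := hquot.deriv
  refine ((hx (contDiff_dt (n := 1) hP)).div (hx hP1) (hP0 x t)).congr_deriv ?_
  rw [hmixed, dt_dx_comm hP]
  ring

section ThreeTimesDifferentiable

variable (hP : ContDiff ℝ 3 fun p : ℝ × ℝ => P p.1 p.2)
  (hQ : ContDiff ℝ 3 fun p : ℝ × ℝ => Q p.1 p.2) (hP0 : ∀ x t, P x t ≠ 0)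
  (hQ0 : ∀ x t, Q x t ≠ 0)

include hP hQ hP0 hQ0

theorem hirotaField_eq_of_contDiff (a : ℂ) :
    hirotaField a P Q = fun x t => a + I * (logDx P x t - logDx Q x t) := by
  ext x t
  exact hirotaField_eq ((contDiff_slice_x hP t).differentiable (by norm_num) x)
    ((contDiff_slice_x hQ t).differentiable (by norm_num) x) (hP0 x t) (hQ0 x t)

theorem hirotaField_neg_swap (a : ℂ) :
    hirotaField (-a) P Q = fun x t => -hirotaField a Q P x t := by
  rw [hirotaField_eq_of_contDiff hP hQ hP0 hQ0, hirotaField_eq_of_contDiff hQ hP hQ0 hP0]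
  ext x t
  ring

theorem hasDerivAt_hirotaDensity (a : ℂ) (x t : ℝ) :
    HasDerivAt (fun y => hirotaDensity a P Q y t)
      (dt (hirotaField a P Q) x t + 2 * hirotaField a P Q x t * dx (hirotaField a P Q) x t
        - (dxx (logDx P) x t + dxx (logDx Q) x t)) x := by
  have hp : ContDiff ℝ 2 fun p : ℝ × ℝ => logDx P p.1 p.2 := contDiff_logDx (n := 2) hP hP0
  have hq : ContDiff ℝ 2 fun p : ℝ × ℝ => logDx Q p.1 p.2 := contDiff_logDx (n := 2) hQ hQ0
  have hx : ∀ {R : ℝ → ℝ → ℂ}, (ContDiff ℝ 1 fun p : ℝ × ℝ => R p.1 p.2) →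
      HasDerivAt (fun y => R y t) (dx R x t) x := fun hR =>
    ((contDiff_slice_x hR t).differentiable one_ne_zero x).hasDerivAt
  have hlog : (fun y => logDeriv (fun s => P y s / Q y s) t)
      = fun y => logDeriv (fun s => P y s) t - logDeriv (fun s => Q y s) t := by
    ext y
    exact logDeriv_div t (hP0 y t) (hQ0 y t)
      ((contDiff_slice_t hP y).differentiable (by norm_num) t)
      ((contDiff_slice_t hQ y).differentiable (by norm_num) t)
  have hfield := hirotaField_eq_of_contDiff hP hQ hP0 hQ0 a
  have hu : ContDiff ℝ 2 fun p : ℝ × ℝ => hirotaField a P Q p.1 p.2 := by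
    rw [hfield]; exact contDiff_const.add (contDiff_const.mul (hp.sub hq))
  have hfield_dt : dt (hirotaField a P Q) x t = I * (dt (logDx P) x t - dt (logDx Q) x t) := by
    rw [hfield]
    exact ((((hasDerivAt_dt (hp.of_le (by norm_num)) x t).sub
      (hasDerivAt_dt (hq.of_le (by norm_num)) x t)).const_mul I).const_add a).deriv
  have htime : HasDerivAt (fun y => logDeriv (fun s => P y s / Q y s) t)
      (dt (logDx P) x t - dt (logDx Q) x t) x := by
    rw [hlog]
    exact (hasDerivAt_logDeriv_time (hP.of_le (by norm_num)) hP0 x t).sub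
      (hasDerivAt_logDeriv_time (hQ.of_le (by norm_num)) hQ0 x t)
  refine (((htime.const_mul I).add ((hx (hu.of_le (by norm_num))).pow 2)).sub
    ((hx (contDiff_dx (n := 1) hp)).add (hx (contDiff_dx (n := 1) hq)))).congr_deriv ?_
  simp only [hfield_dt, dxx, dx]
  push_cast
  ring

theorem exists_hirotaForm_eq_zero_iff (a : ℂ) :
    (∃ l : ℝ → ℂ, ∀ x t, hirotaForm a (l t) P Q x t = 0) ↔
      ∀ x t, dt (hirotaField a P Q) x t + 2 * hirotaField a P Q x t * dx (hirotaField a P Q) x t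
        - (dxx (logDx P) x t + dxx (logDx Q) x t) = 0 := by
  have hform : ∀ (l : ℂ) x t, hirotaForm a l P Q x t = 0 ↔ hirotaDensity a P Q x t = l :=
    fun l x t => hirotaForm_eq_zero_iff ((contDiff_slice_x hP t).of_le (by norm_num))
      ((contDiff_slice_x hQ t).of_le (by norm_num))
      ((contDiff_slice_t hP x).differentiable (by norm_num) t)
      ((contDiff_slice_t hQ x).differentiable (by norm_num) t) (hP0 x t) (hQ0 x t) l
  have hderiv := hasDerivAt_hirotaDensity hP hQ hP0 hQ0 a
  simp only [hform]
  constructor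
  · rintro ⟨l, hl⟩ x t
    rw [← (hderiv x t).deriv, funext fun y => hl y t, deriv_const]
  · intro h
    exact ⟨fun t => hirotaDensity a P Q 0 t, fun x t =>
      is_const_of_deriv_eq_zero (f := fun y => hirotaDensity a P Q y t)
        (fun y => (hderiv y t).differentiableAt) (fun y => by rw [(hderiv y t).deriv, h]) x 0⟩

end ThreeTimesDifferentiable

end HirotaForm

theorem hirotaSystem_iff {δ : ℝ} {ubar vbar : ℂ} {lam1 lam2 : ℝ → ℂ} {F G : ℂ → ℝ → ℂ} :
    HirotaSystem δ ubar vbar lam1 lam2 F G ↔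
      (∀ x t, hirotaForm ubar (lam1 t) (bdryMinus δ F) (bdryPlus δ G) x t = 0) ∧
      ∀ x t, hirotaForm (-vbar) (lam2 t) (bdryPlus δ F) (bdryMinus δ G) x t = 0 := by
  simp only [← forall_and, HirotaSystem, hirotaForm, mul_neg, neg_mul, neg_sq, ← sub_eq_add_neg]

/-! ### Boundary values of analytic logarithms -/

section BoundaryValues

variable {L δ : ℝ}

/-- The integrals of `f e_{-n}` over the two boundary lines agree by Cauchy's theorem. -/
theorem fcoeff_upper_eq_mode_mul (hL : 0 < L) (hδ : 0 < δ) {f : ℂ → ℂ}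
    (hd : DifferentiableOn ℂ f (openStrip δ)) (hc : ContinuousOn f (closedStrip δ))
    (hp : ∀ z ∈ closedStrip δ, f (z + L) = f z) (n : ℤ) :
    fcoeff L (fun x => f (x + I * (δ / 2))) n
      = mode L n (I * δ) * fcoeff L (fun x => f (x - I * (δ / 2))) n := by
  set g : ℂ → ℂ := fun z => f z * mode L (-n) z with hg
  have hle : -(δ / 2) ≤ δ / 2 := by linarith
  have hcauchy := Complex.integral_boundary_rect_eq_zero_of_continuousOn_of_differentiableOn g
    ⟨-(L / 2), -(δ / 2)⟩ ⟨L / 2, δ / 2⟩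
    ((hc.mul (continuous_mode L (-n)).continuousOn).mono fun z hz => by
      simpa [closedStrip, Set.uIcc_of_le hle] using hz.2)
    ((hd.mul fun z _ =>
        (hasDerivAt_mode L (-n) z).differentiableAt.differentiableWithinAt).mono fun z hz => by
      simpa [openStrip, min_eq_left hle, max_eq_right hle] using hz.2)
  have hside : ∫ y : ℝ in (-(δ / 2))..(δ / 2), g ((L / 2 : ℝ) + y * I)
      = ∫ y : ℝ in (-(δ / 2))..(δ / 2), g ((-(L / 2) : ℝ) + y * I) := by
    refine intervalIntegral.integral_congr fun y hy => ?_
    rw [Set.uIcc_of_le hle] at hy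
    have hshift : ((L / 2 : ℝ) : ℂ) + y * I = (-(L / 2) : ℝ) + y * I + L := by push_cast; ring
    simp only [hg, hshift]
    rw [mode_add_period _ hL.ne', hp _ (by simpa [closedStrip] using hy)]
  have hlower : ∀ x : ℝ, g (x + (-(δ / 2) : ℝ) * I)
      = mode L (-n) (-(I * (δ / 2))) * (f (x - I * (δ / 2)) * mode L (-n) x) := fun x => by
    rw [show (x : ℂ) + (-(δ / 2) : ℝ) * I = x - I * (δ / 2) by push_cast; ring]
    simp only [hg, sub_eq_add_neg, mode_add]
    ring
  have hupper : ∀ x : ℝ, g (x + (δ / 2 : ℝ) * I)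
      = mode L (-n) (I * (δ / 2)) * (f (x + I * (δ / 2)) * mode L (-n) x) := fun x => by
    rw [show (x : ℂ) + (δ / 2 : ℝ) * I = x + I * (δ / 2) by push_cast; ring]
    simp only [hg, mode_add]
    ring
  have hinv : mode L n (I * (δ / 2)) * mode L (-n) (I * (δ / 2)) = 1 := by
    rw [mode_mul_mode, add_neg_cancel, mode_zero_left]
  have hsq : mode L n (I * δ) = mode L n (I * (δ / 2)) * mode L n (I * (δ / 2)) := by
    rw [← mode_add]; congr 1; ring
  simp only [hside, hlower, hupper, intervalIntegral.integral_const_mul, mode_neg_right,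
    neg_neg, add_sub_cancel_right] at hcauchy
  rw [fcoeff, fcoeff, hsq]
  linear_combination -(1 / L * mode L n (I * (δ / 2))) * hcauchy
    - (1 / L * ∫ x in (-(L / 2))..(L / 2), f (x + I * (δ / 2)) * mode L (-n) x) * hinv

theorem exists_log_add_period_eq (hδ : 0 < δ) {F f : ℂ → ℂ}
    (hF : ∀ z ∈ closedStrip δ, F z = exp (f z)) (hd : DifferentiableOn ℂ f (openStrip δ))
    (hc : ContinuousOn f (closedStrip δ)) (hp : ∀ z ∈ closedStrip δ, F (z + L) = F z) :
    ∃ c : ℂ, ∀ z ∈ closedStrip δ, f (z + L) = f z + c := by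
  have hopen : Set.MapsTo (fun z : ℂ => z + L) (openStrip δ) (openStrip δ) := fun z hz => by
    simpa [openStrip] using hz
  have hclosed : Set.MapsTo (fun z : ℂ => z + L) (closedStrip δ) (closedStrip δ) := fun z hz => by
    simpa [closedStrip] using hz
  have hd' : DifferentiableOn ℂ (fun z => f (z + L)) (openStrip δ) := hd.comp (by fun_prop) hopen
  have hderiv : Set.EqOn (deriv f) (deriv fun z => f (z + L)) (openStrip δ) := fun z hz => by
    rw [← logDeriv_eq_deriv_of_eq_exp hF hd hz, ← logDeriv_eq_deriv_of_eq_exp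
      (fun w hw => (hp w hw).symm.trans (hF _ (hclosed hw))) hd' hz]
  refine ⟨f (0 + L) - f 0, fun z hz => ?_⟩
  have hconst := eqOn_add_const_of_deriv_eq hδ hd hd' hc (hc.comp (by fun_prop) hclosed) hderiv hz
  exact hconst.trans (add_comm _ _)

theorem hasDerivAt_of_eq_exp {f F : ℝ → ℂ} (hF : ∀ x, F x = exp (f x)) (hf : Continuous f)
    {x : ℝ} (hd : DifferentiableAt ℝ F x) : HasDerivAt f (logDeriv F x) x := by
  have hquot_self : F x / F x = 1 := div_self (by rw [hF]; exact exp_ne_zero _)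
  have hlog : HasDerivAt (fun y => Complex.log (F y / F x)) (logDeriv F x) x := by
    have := (hd.hasDerivAt.div_const (F x)).clog_real
      (by rw [hquot_self]; exact Complex.one_mem_slitPlane)
    rwa [hquot_self, div_one] at this
  have him : Tendsto (fun y => (f y - f x).im) (𝓝 x) (𝓝 0) := by
    have hcont : Continuous fun y => (f y - f x).im := by fun_prop
    simpa using hcont.tendsto x
  have hlocal : f =ᶠ[𝓝 x] fun y => f x + Complex.log (F y / F x) := by
    filter_upwards [him (Ioo_mem_nhds (neg_lt_zero.mpr Real.pi_pos) Real.pi_pos)] with y hy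
    rw [hF, hF, ← Complex.exp_sub, Complex.log_exp hy.1 hy.2.le]
    ring
  exact (hlog.const_add (f x)).congr_of_eventuallyEq hlocal

theorem fcoeff_logDeriv_of_eq_exp (hL : 0 < L) {P q : ℝ → ℂ} {m b : ℂ} (hP : ContDiff ℝ 1 P)
    (hPq : ∀ x, P x = exp (q x + (m * x + b))) (hq : Continuous q) (hqp : Function.Periodic q L) :
    fcoeff L (logDeriv P) = derivSymbol L * fcoeff L q + fcoeff L fun _ => m := by
  have hq' : ∀ x, HasDerivAt q (logDeriv P x - m) x := fun x => by
    have hlin : HasDerivAt (fun y : ℝ => m * y + b) m x := by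
      simpa using (((hasDerivAt_id (x : ℂ)).const_mul m).add_const b).comp_ofReal
    have hsum := hasDerivAt_of_eq_exp hPq (by fun_prop) (hP.differentiable one_ne_zero x)
    exact (hsum.sub hlin).congr_of_eventuallyEq (.of_forall fun y => by simp)
  have hlogP : Continuous (logDeriv P) :=
    hP.continuous_deriv_one.div hP.continuous fun x => by rw [hPq]; exact exp_ne_zero _
  have hderiv : deriv q = fun x => logDeriv P x - m := funext fun x => (hq' x).deriv
  have hq1 : ContDiff ℝ 1 q := contDiff_one_iff_deriv.mpr
    ⟨fun x => (hq' x).differentiableAt, by rw [hderiv]; fun_prop⟩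
  rw [← fcoeff_deriv hL hqp hq1, hderiv, fcoeff_sub hlogP continuous_const, sub_add_cancel]

/-- Writing `F = exp f`, the function `f - m z` is periodic for a suitable `m`. -/
theorem fcoeff_logDeriv_upper_eq_mode_mul (hL : 0 < L) (hδ : 0 < δ) {F : ℂ → ℂ}
    (hF : HasAnalyticLog δ F) (hp : ∀ z ∈ closedStrip δ, F (z + L) = F z)
    (hup : ContDiff ℝ 1 fun x : ℝ => F (x + I * (δ / 2)))
    (hlow : ContDiff ℝ 1 fun x : ℝ => F (x - I * (δ / 2))) (n : ℤ) :
    fcoeff L (logDeriv fun x : ℝ => F (x + I * (δ / 2))) n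
      = mode L n (I * δ) * fcoeff L (logDeriv fun x : ℝ => F (x - I * (δ / 2))) n := by
  obtain ⟨f, hf, hfd, hfc⟩ := hF
  obtain ⟨c, hperiod⟩ := exists_log_add_period_eq hδ hf hfd hfc hp
  set m : ℂ := c / L
  have hmL : m * L = c := div_mul_cancel₀ _ (by exact_mod_cast hL.ne')
  set g : ℂ → ℂ := fun z => f z - m * z with hg
  have hgd : DifferentiableOn ℂ g (openStrip δ) := hfd.sub (by fun_prop)
  have hgc : ContinuousOn g (closedStrip δ) := hfc.sub (by fun_prop)
  have hgp : ∀ z ∈ closedStrip δ, g (z + L) = g z := fun z hz => by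
    simp only [hg, hperiod z hz, mul_add, hmL]; ring
  have hline : ∀ w : ℂ, (∀ x : ℝ, (x : ℂ) + w ∈ closedStrip δ) →
      ContDiff ℝ 1 (fun x : ℝ => F (x + w)) →
      fcoeff L (logDeriv fun x : ℝ => F (x + w))
        = derivSymbol L * fcoeff L (fun x : ℝ => g (x + w)) + fcoeff L fun _ => m := by
    intro w hw hFw
    refine fcoeff_logDeriv_of_eq_exp hL (b := m * w) hFw (fun x => ?_)
      (hgc.comp_continuous (by fun_prop) hw) fun x => ?_
    · rw [hf _ (hw x)]; congr 1; ring
    · rw [← hgp _ (hw x)]; congr 1; push_cast; ring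
  have hconst : fcoeff L (fun _ => m) n = mode L n (I * δ) * fcoeff L (fun _ => m) n := by
    rw [fcoeff_const hL]
    rcases eq_or_ne n 0 with rfl | hn
    · rw [mode_zero_left, one_mul]
    · rw [if_neg hn, mul_zero]
  have hlower := hline (-(I * (δ / 2))) (sub_mem_closedStrip hδ) hlow
  simp only [← sub_eq_add_neg] at hlower
  rw [hline _ (add_mem_closedStrip hδ) hup, hlower, Pi.add_apply, Pi.mul_apply, Pi.add_apply,
    Pi.mul_apply, fcoeff_upper_eq_mode_mul hL hδ hgd hgc hgp]
  linear_combination hconst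

/-- A pair of functions `f`, `g` on `ℝ` that behaves like the boundary values `x - iδ/2`,
`x + iδ/2` of a periodic function of mean zero that is analytic in the strip. -/
structure IsBoundaryPair (L δ : ℝ) (f g : ℝ → ℂ) : Prop where
  periodic_lower : Function.Periodic f L
  periodic_upper : Function.Periodic g L
  contDiff_lower : ContDiff ℝ 1 f
  contDiff_upper : ContDiff ℝ 1 g
  fcoeff_zero : fcoeff L f 0 = 0
  fcoeff_upper : ∀ n, fcoeff L g n = mode L n (I * δ) * fcoeff L f n

/-- Uses `(coth ± 1) e^{∓s} = csch` at `s = freq L δ n`. -/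
theorem IsBoundaryPair.opT_add_opTt (hL : 0 < L) (hδ : 0 < δ) {f f' g g' : ℝ → ℂ}
    (hf : IsBoundaryPair L δ f f') (hg : IsBoundaryPair L δ g g') (x : ℝ) :
    opT L δ (fun y => I * (f y - g' y)) x + opTt L δ (fun y => I * (g y - f' y)) x
      = -(f x + g' x) := by
  have hcoeff : ∀ {p q : ℝ → ℂ}, ContDiff ℝ 1 p → ContDiff ℝ 1 q →
      fcoeff L (fun y => I * (p y - q y)) = fun n => I * (fcoeff L p n - fcoeff L q n) :=
    fun hp hq => funext fun n => by
      rw [fcoeff_const_mul I, fcoeff_sub hp.continuous hq.continuous, Pi.sub_apply]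
  have hperiodic : ∀ {p q : ℝ → ℂ}, Function.Periodic p L → Function.Periodic q L →
      Function.Periodic (fun y => I * (p y - q y)) L := fun hp hq y => by simp only [hp y, hq y]
  have hsum_periodic : Function.Periodic (fun y => f y + g' y) L :=
    hf.periodic_lower.add hg.periodic_upper
  have hsum_contDiff := hf.contDiff_lower.add hg.contDiff_upper
  rw [opT_add_opTt_eq_trigSeries hL hδ (hperiodic hf.periodic_lower hg.periodic_upper)
      (contDiff_const.mul (hf.contDiff_lower.sub hg.contDiff_upper))
      (hperiodic hg.periodic_lower hf.periodic_upper)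
      (contDiff_const.mul (hg.contDiff_lower.sub hf.contDiff_upper)),
    eq_trigSeries_fcoeff hL hsum_periodic hsum_contDiff.continuous
      (summable_norm_fcoeff hL hsum_periodic hsum_contDiff),
    ← neg_one_mul, ← trigSeries_const_mul, hcoeff hf.contDiff_lower hg.contDiff_upper,
    hcoeff hg.contDiff_lower hf.contDiff_upper,
    fcoeff_add hf.contDiff_lower.continuous hg.contDiff_upper.continuous]
  · congr 1
    ext n
    simp only [Pi.add_apply, Pi.mul_apply, hf.fcoeff_upper, hg.fcoeff_upper]
    rcases eq_or_ne n 0 with rfl | hn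
    · simp [hf.fcoeff_zero, hg.fcoeff_zero]
    · have hinv : exp (freq L δ n) * exp (-freq L δ n) = 1 := by
        rw [← Complex.exp_add, add_neg_cancel, Complex.exp_zero]
      rw [mode_I_mul]
      linear_combination fcoeff L g n * cothSymbol_add_one_mul_exp_neg hL hδ hn
        - exp (-freq L δ n) * fcoeff L f n * cothSymbol_sub_one_mul_exp hL hδ hn
        + (cothSymbol L δ n - 1) * fcoeff L f n * hinv
        + (cothSymbol L δ n * (fcoeff L f n - exp (-freq L δ n) * fcoeff L g n)
          + cschSymbol L δ n * (fcoeff L g n - exp (-freq L δ n) * fcoeff L f n)) * I_sq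
  · simp only [hcoeff hg.contDiff_lower hf.contDiff_upper, hf.fcoeff_upper, hf.fcoeff_zero,
      hg.fcoeff_zero, mul_zero, sub_zero]

end BoundaryValues

section StripFunctions

variable {L δ : ℝ} {F : ℂ → ℝ → ℂ}

theorem bdryPlus_ne_zero (hδ : 0 < δ) (hF : ∀ t, HasAnalyticLog δ fun z => F z t) (x t : ℝ) :
    bdryPlus δ F x t ≠ 0 := by
  obtain ⟨f, hf, -⟩ := hF t
  exact (hf _ (add_mem_closedStrip hδ x)).trans_ne (exp_ne_zero _)

theorem bdryMinus_ne_zero (hδ : 0 < δ) (hF : ∀ t, HasAnalyticLog δ fun z => F z t) (x t : ℝ) :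
    bdryMinus δ F x t ≠ 0 := by
  obtain ⟨f, hf, -⟩ := hF t
  exact (hf _ (sub_mem_closedStrip hδ x)).trans_ne (exp_ne_zero _)

theorem periodic_bdryPlus (hδ : 0 < δ) (hp : StripPeriodic L δ F) (t : ℝ) :
    Function.Periodic (fun x => bdryPlus δ F x t) L := fun x => by
  have hshift : ((x + L : ℝ) : ℂ) + I * (δ / 2) = x + I * (δ / 2) + L := by push_cast; ring
  simp only [bdryPlus, hshift, hp t _ (add_mem_closedStrip hδ x)]

theorem periodic_bdryMinus (hδ : 0 < δ) (hp : StripPeriodic L δ F) (t : ℝ) :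
    Function.Periodic (fun x => bdryMinus δ F x t) L := fun x => by
  have hshift : ((x + L : ℝ) : ℂ) - I * (δ / 2) = x - I * (δ / 2) + L := by push_cast; ring
  simp only [bdryMinus, hshift, hp t _ (sub_mem_closedStrip hδ x)]

theorem isBoundaryPair_dxx_logDx (hL : 0 < L) (hδ : 0 < δ) (hp : StripPeriodic L δ F)
    (hlog : ∀ t, HasAnalyticLog δ fun z => F z t) (hF : BdryContDiff δ 4 F) (t : ℝ) :
    IsBoundaryPair L δ (fun x => dxx (logDx (bdryMinus δ F)) x t)
      (fun x => dxx (logDx (bdryPlus δ F)) x t) := by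
  have hlower : ContDiff ℝ 3 fun x => logDx (bdryMinus δ F) x t :=
    contDiff_slice_x (contDiff_logDx (n := 3) hF.2 (bdryMinus_ne_zero hδ hlog)) t
  have hupper : ContDiff ℝ 3 fun x => logDx (bdryPlus δ F) x t :=
    contDiff_slice_x (contDiff_logDx (n := 3) hF.1 (bdryPlus_ne_zero hδ hlog)) t
  have hlower_periodic := periodic_logDx (periodic_bdryMinus hδ hp t)
  have hupper_periodic := periodic_logDx (periodic_bdryPlus hδ hp t)
  have hdxx : ∀ {p : ℝ → ℂ}, ContDiff ℝ 3 p → Function.Periodic p L →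
      fcoeff L (deriv (deriv p)) = derivSymbol L * (derivSymbol L * fcoeff L p) := fun hp hper => by
    rw [fcoeff_deriv hL (periodic_deriv hper) ((hp.deriv' (n := 2)).of_le (by norm_num)),
      fcoeff_deriv hL hper (hp.of_le (by norm_num))]
  refine ⟨periodic_deriv (periodic_deriv hlower_periodic),
    periodic_deriv (periodic_deriv hupper_periodic),
    (hlower.deriv' (n := 2)).deriv' (n := 1), (hupper.deriv' (n := 2)).deriv' (n := 1),
    fcoeff_deriv_zero hL (periodic_deriv hlower_periodic)
      ((hlower.deriv' (n := 2)).of_le (by norm_num)), fun n => ?_⟩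
  have hfirst : fcoeff L (fun x => logDx (bdryPlus δ F) x t) n
      = mode L n (I * δ) * fcoeff L (fun x => logDx (bdryMinus δ F) x t) n :=
    fcoeff_logDeriv_upper_eq_mode_mul hL hδ (hlog t) (hp t)
      ((contDiff_slice_x hF.1 t).of_le (by norm_num))
      ((contDiff_slice_x hF.2 t).of_le (by norm_num)) n
  change fcoeff L (deriv (deriv _)) n = _ * fcoeff L (deriv (deriv _)) n
  rw [hdxx hupper hupper_periodic, hdxx hlower hlower_periodic]
  simp only [Pi.mul_apply, hfirst]
  ring

theorem dxx_hirotaField {P Q : ℝ → ℝ → ℂ} (hP : ContDiff ℝ 4 fun p : ℝ × ℝ => P p.1 p.2)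
    (hQ : ContDiff ℝ 4 fun p : ℝ × ℝ => Q p.1 p.2) (hP0 : ∀ x t, P x t ≠ 0)
    (hQ0 : ∀ x t, Q x t ≠ 0) (a : ℂ) (x t : ℝ) :
    dxx (hirotaField a P Q) x t = I * (dxx (logDx P) x t - dxx (logDx Q) x t) := by
  have hp : ContDiff ℝ 3 fun x => logDx P x t := contDiff_slice_x (contDiff_logDx (n := 3) hP hP0) t
  have hq : ContDiff ℝ 3 fun x => logDx Q x t := contDiff_slice_x (contDiff_logDx (n := 3) hQ hQ0) t
  have hdx : ∀ {f g : ℝ → ℂ}, ContDiff ℝ 1 f → ContDiff ℝ 1 g →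
      deriv (fun y => I * (f y - g y)) = fun y => I * (deriv f y - deriv g y) := fun hf hg =>
    funext fun y => (((hf.differentiable one_ne_zero y).hasDerivAt.sub
      (hg.differentiable one_ne_zero y).hasDerivAt).const_mul I).deriv
  rw [hirotaField_eq_of_contDiff (hP.of_le (by norm_num)) (hQ.of_le (by norm_num)) hP0 hQ0]
  simp only [dxx, dx, deriv_const_add]
  rw [hdx (hp.of_le (by norm_num)) (hq.of_le (by norm_num)),
    hdx ((hp.deriv' (n := 2)).of_le (by norm_num)) ((hq.deriv' (n := 2)).of_le (by norm_num))]

end StripFunctions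

section BilinearEquivalence

variable {L δ : ℝ} {F G : ℂ → ℝ → ℂ} (hL : 0 < L) (hδ : 0 < δ) (hFp : StripPeriodic L δ F)
  (hGp : StripPeriodic L δ G) (hFl : ∀ t, HasAnalyticLog δ fun z => F z t)
  (hGl : ∀ t, HasAnalyticLog δ fun z => G z t) (hF : BdryContDiff δ 4 F) (hG : BdryContDiff δ 4 G)

include hδ hFl hGl hF hG

theorem dxx_uOfFG (a : ℂ) (t : ℝ) :
    (fun x => dxx (uOfFG δ a F G) x t) = fun x =>
      I * (dxx (logDx (bdryMinus δ F)) x t - dxx (logDx (bdryPlus δ G)) x t) :=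
  funext fun x => dxx_hirotaField hF.2 hG.1 (bdryMinus_ne_zero hδ hFl)
    (bdryPlus_ne_zero hδ hGl) a x t

include hL hFp hGp

theorem tConverges_dxx_uOfFG (a : ℂ) (x t : ℝ) :
    TConverges L δ (fun y => dxx (uOfFG δ a F G) y t) x := by
  have hFpair := isBoundaryPair_dxx_logDx hL hδ hFp hFl hF t
  have hGpair := isBoundaryPair_dxx_logDx hL hδ hGp hGl hG t
  rw [dxx_uOfFG hδ hFl hGl hF hG]
  exact tConverges hL hδ
    ((hFpair.periodic_lower.sub hGpair.periodic_upper).comp (I * ·))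
    (contDiff_const.mul (hFpair.contDiff_lower.sub hGpair.contDiff_upper)) x

theorem opT_dxx_uOfFG_add_opTt_dxx_vOfFG (a b : ℂ) (x t : ℝ) :
    opT L δ (fun y => dxx (uOfFG δ a F G) y t) x + opTt L δ (fun y => dxx (vOfFG δ b F G) y t) x
      = -(dxx (logDx (bdryMinus δ F)) x t + dxx (logDx (bdryPlus δ G)) x t) := by
  change opT L δ _ x + opTt L δ (fun y => dxx (uOfFG δ b G F) y t) x = _
  rw [dxx_uOfFG hδ hFl hGl hF hG, dxx_uOfFG hδ hGl hFl hG hF]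
  exact (isBoundaryPair_dxx_logDx hL hδ hFp hFl hF t).opT_add_opTt hL hδ
    (isBoundaryPair_dxx_logDx hL hδ hGp hGl hG t) x

theorem exists_hirotaSystem_iff_solvesNcILW (ubar vbar : ℂ) :
    (∃ lam1 lam2 : ℝ → ℂ, HirotaSystem δ ubar vbar lam1 lam2 F G) ↔
      SolvesNcILW L δ (uOfFG δ ubar F G) (vOfFG δ vbar F G) := by
  have hFm0 := bdryMinus_ne_zero hδ hFl
  have hFp0 := bdryPlus_ne_zero hδ hFl
  have hGm0 := bdryMinus_ne_zero hδ hGl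
  have hGp0 := bdryPlus_ne_zero hδ hGl
  have hFm3 := hF.2.of_le (m := 3) (by norm_num)
  have hFp3 := hF.1.of_le (m := 3) (by norm_num)
  have hGm3 := hG.2.of_le (m := 3) (by norm_num)
  have hGp3 := hG.1.of_le (m := 3) (by norm_num)
  have hneg : ∀ w : ℝ → ℝ → ℂ, (∀ x t, dt (fun x t => -w x t) x t = -dt w x t) ∧
      ∀ x t, dx (fun x t => -w x t) x t = -dx w x t := fun w =>
    ⟨fun _ _ => deriv.fun_neg, fun _ _ => deriv.fun_neg⟩
  simp only [hirotaSystem_iff, ← exists_and_exists_comm]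
  rw [exists_hirotaForm_eq_zero_iff hFm3 hGp3 hFm0 hGp0,
    exists_hirotaForm_eq_zero_iff hFp3 hGm3 hFp0 hGm0,
    hirotaField_neg_swap hFp3 hGm3 hFp0 hGm0]
  change (∀ x t, dt (uOfFG δ ubar F G) x t + 2 * uOfFG δ ubar F G x t * dx (uOfFG δ ubar F G) x t
    - _ = 0) ∧ (∀ x t, dt (fun x t => -vOfFG δ vbar F G x t) x t + 2 * -vOfFG δ vbar F G x t
      * dx (fun x t => -vOfFG δ vbar F G x t) x t - _ = 0) ↔ _
  simp only [(hneg _).1, (hneg _).2, ← forall_and]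
  refine forall₂_congr fun x t => ?_
  have hT := opT_dxx_uOfFG_add_opTt_dxx_vOfFG hL hδ hFp hGp hFl hGl hF hG ubar vbar x t
  -- `v(F, G) = u(G, F)`
  have hTswap : opT L δ (fun y => dxx (vOfFG δ vbar F G) y t) x
      + opTt L δ (fun y => dxx (uOfFG δ ubar F G) y t) x = _ :=
    opT_dxx_uOfFG_add_opTt_dxx_vOfFG hL hδ hGp hFp hGl hFl hG hF vbar ubar x t
  constructor
  · rintro ⟨hu, hv⟩
    exact ⟨tConverges_dxx_uOfFG hL hδ hFp hGp hFl hGl hF hG ubar x t,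
      tConverges_dxx_uOfFG hL hδ hGp hFp hGl hFl hG hF vbar x t,
      by linear_combination hu + hT, by linear_combination -hv - hTswap⟩
  · rintro ⟨-, -, hu, hv⟩
    exact ⟨by linear_combination hu - hT, by linear_combination -hv - hTswap⟩

end BilinearEquivalence

/-! ### Primitives and boundary values of potentials -/

/-- The `L`-periodic functions of class `C^n` with mean zero. -/
structure IsMeanZeroPeriodic (L : ℝ) (n : ℕ) (h : ℝ → ℂ) : Prop where
  periodic : Function.Periodic h L
  contDiff : ContDiff ℝ n h
  fcoeff_zero : fcoeff L h 0 = 0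

/-- The periodic primitive of mean zero of a periodic function `h` of mean zero. -/
def primitive (L : ℝ) (h : ℝ → ℂ) (x : ℝ) : ℂ := trigSeries L ((derivSymbol L)⁻¹ * fcoeff L h) x

section Primitive

variable {L δ : ℝ} {n : ℕ} {h : ℝ → ℂ}

theorem derivSymbol_ne_zero (hL : L ≠ 0) {m : ℤ} (hm : m ≠ 0) : derivSymbol L m ≠ 0 := by
  simp [derivSymbol, hL, hm, Real.pi_ne_zero]

theorem derivSymbol_mul_inv_mul_cancel (hL : L ≠ 0) {a : ℤ → ℂ} (ha : a 0 = 0) :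
    derivSymbol L * ((derivSymbol L)⁻¹ * a) = a := by
  ext m
  rcases eq_or_ne m 0 with rfl | hm
  · simp [ha]
  · exact mul_inv_cancel_left₀ (derivSymbol_ne_zero hL hm) _

theorem memℓp_inv_derivSymbol (hL : L ≠ 0) : Memℓp (derivSymbol L)⁻¹ ⊤ := by
  have : 0 < |L| := abs_pos.mpr hL
  refine memℓp_infty_iff.mpr ⟨|L| / (2 * π), Set.forall_mem_range.mpr fun m => ?_⟩
  rcases eq_or_ne m 0 with rfl | hm
  · simp only [Pi.inv_apply, derivSymbol, Int.cast_zero, mul_zero, zero_div, inv_zero, norm_zero]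
    positivity
  · have hm1 : 1 ≤ |(m : ℝ)| := by exact_mod_cast Int.one_le_abs hm
    rw [Pi.inv_apply, norm_inv, norm_derivSymbol, ← inv_div (2 * π) |L|]
    gcongr
    exact le_mul_of_one_le_right (by positivity) hm1

namespace IsMeanZeroPeriodic

theorem of_le {m : ℕ} (hh : IsMeanZeroPeriodic L n h) (hmn : m ≤ n) : IsMeanZeroPeriodic L m h :=
  ⟨hh.periodic, hh.contDiff.of_le (by exact_mod_cast hmn), hh.fcoeff_zero⟩

theorem deriv (hL : 0 < L) (hp : Function.Periodic h L) (hh : ContDiff ℝ (n + 1 : ℕ) h) :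
    IsMeanZeroPeriodic L n (deriv h) :=
  ⟨periodic_deriv hp, ContDiff.deriv' (n := n) (by exact_mod_cast hh),
    fcoeff_deriv_zero hL hp (hh.of_le (by exact_mod_cast Nat.le_add_left 1 n))⟩

theorem summableOrder_fcoeff (hL : 0 < L) (hh : IsMeanZeroPeriodic L (n + 1) h) :
    SummableOrder n (fcoeff L h) :=
  NcILW.summableOrder_fcoeff hL hh.periodic hh.contDiff

theorem eq_trigSeries (hL : 0 < L) (hh : IsMeanZeroPeriodic L 1 h) (x : ℝ) :
    h x = trigSeries L (fcoeff L h) x :=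
  eq_trigSeries_fcoeff hL hh.periodic hh.contDiff.continuous
    (hh.summableOrder_fcoeff (n := 0) hL).summable_norm x

theorem summableOrder_primitive (hL : 0 < L) (hh : IsMeanZeroPeriodic L (n + 1) h) :
    SummableOrder (n + 1) ((derivSymbol L)⁻¹ * fcoeff L h) := by
  refine SummableOrder.of_derivSymbol_mul hL.ne' ?_
  rw [derivSymbol_mul_inv_mul_cancel hL.ne' hh.fcoeff_zero]
  exact hh.summableOrder_fcoeff hL

theorem contDiff_primitive (hL : 0 < L) (hh : IsMeanZeroPeriodic L (n + 1) h) :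
    ContDiff ℝ (n + 1 : ℕ) (primitive L h) :=
  contDiff_trigSeries (hh.summableOrder_primitive hL)

theorem hasDerivAt_primitive (hL : 0 < L) (hh : IsMeanZeroPeriodic L 1 h) (x : ℝ) :
    HasDerivAt (primitive L h) (h x) x := by
  refine (hasDerivAt_trigSeries (hh.summableOrder_primitive (n := 0) hL) x).congr_deriv ?_
  rw [derivSymbol_mul_inv_mul_cancel hL.ne' hh.fcoeff_zero, hh.eq_trigSeries hL]

end IsMeanZeroPeriodic

theorem cschSymbol_mul_one_sub_mode (hL : 0 < L) (hδ : 0 < δ) {m : ℤ} (hm : m ≠ 0) :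
    cschSymbol L (δ / 2) m * (1 - mode L m (I * δ)) = 2 * mode L m (I * (δ / 2)) := by
  have hhalf : mode L m (I * (δ / 2)) = exp (-freq L (δ / 2) m) := by
    rw [← mode_I_mul]; push_cast; rfl
  have hdouble : mode L m (I * δ) = mode L m (I * (δ / 2)) * mode L m (I * (δ / 2)) := by
    rw [← mode_add]; congr 1; ring
  have hinv : exp (freq L (δ / 2) m) * exp (-freq L (δ / 2) m) = 1 := by
    rw [← Complex.exp_add, add_neg_cancel, Complex.exp_zero]
  rw [hdouble, hhalf]
  linear_combination -cothSymbol_add_one_mul_exp_neg hL (half_pos hδ) hm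
    + exp (-freq L (δ / 2) m) ^ 2 * cothSymbol_sub_one_mul_exp hL (half_pos hδ) hm
    - (cothSymbol L (δ / 2) m - 1) * exp (-freq L (δ / 2) m) * hinv

namespace IsBoundaryPair

variable {f g : ℝ → ℂ}

theorem fcoeff_sub (hfg : IsBoundaryPair L δ f g) (m : ℤ) :
    fcoeff L (fun x => f x - g x) m = (1 - mode L m (I * δ)) * fcoeff L f m := by
  rw [NcILW.fcoeff_sub hfg.contDiff_lower.continuous hfg.contDiff_upper.continuous, Pi.sub_apply,
    hfg.fcoeff_upper]
  ring

theorem isPotentialSource (hL : 0 < L) (hfg : IsBoundaryPair L δ f g) :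
    IsPotentialSource L fun x => f x - g x where
  continuous := hfg.contDiff_lower.continuous.sub hfg.contDiff_upper.continuous
  fcoeff_zero := by rw [hfg.fcoeff_sub, hfg.fcoeff_zero, mul_zero]
  summable := summable_norm_fcoeff hL (hfg.periodic_lower.sub hfg.periodic_upper)
    (hfg.contDiff_lower.sub hfg.contDiff_upper)

theorem potentialCoeff_eq (hL : 0 < L) (hδ : 0 < δ) (hfg : IsBoundaryPair L δ f g) (m : ℤ) :
    potentialCoeff L δ (fun x => f x - g x) m
      = -I * ((derivSymbol L)⁻¹ * fcoeff L f) m * mode L m (I * (δ / 2)) := by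
  rw [potentialCoeff, hfg.fcoeff_sub, mul_inv, Complex.inv_I, Pi.mul_apply, Pi.inv_apply]
  rcases eq_or_ne m 0 with rfl | hm
  · rw [hfg.fcoeff_zero]; ring
  · linear_combination -I * (derivSymbol L m)⁻¹ * fcoeff L f m / 2
      * cschSymbol_mul_one_sub_mode hL hδ hm

theorem potential_lower (hL : 0 < L) (hδ : 0 < δ) (hfg : IsBoundaryPair L δ f g) (x : ℝ) :
    potential L δ (fun y => f y - g y) (x - I * (δ / 2)) = -I * primitive L f x := by
  rw [potential, primitive, sub_eq_add_neg, trigSeries_add_right, ← trigSeries_const_mul]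
  congr 1
  ext m
  rw [hfg.potentialCoeff_eq hL hδ, mul_assoc, ← mode_add, add_neg_cancel, mode_zero_right, mul_one]

theorem potential_upper (hL : 0 < L) (hδ : 0 < δ) (hfg : IsBoundaryPair L δ f g) (x : ℝ) :
    potential L δ (fun y => f y - g y) (x + I * (δ / 2)) = -I * primitive L g x := by
  rw [potential, primitive, trigSeries_add_right, ← trigSeries_const_mul]
  congr 1
  ext m
  rw [hfg.potentialCoeff_eq hL hδ, mul_assoc, ← mode_add, ← mul_add, add_halves, Pi.mul_apply,
    Pi.mul_apply, hfg.fcoeff_upper]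
  ring

end IsBoundaryPair

end Primitive

/-! ### Exponentials of primitives -/

/-- A family `p · t` of periodic functions of mean zero that may be differentiated in `t` term by
term in its Fourier series, with derivative `p'`. -/
structure IsMeanZeroFlow (L : ℝ) (p p' : ℝ → ℝ → ℂ) : Prop where
  slice : ∀ t, IsMeanZeroPeriodic L 2 fun x => p x t
  slice_deriv : ∀ t, IsMeanZeroPeriodic L 1 fun x => p' x t
  hasSummableDeriv :
    HasSummableDeriv (fun t => fcoeff L fun x => p x t) fun t => fcoeff L fun x => p' x t

/-- `P` is, up to a differentiable function of `t`, the exponential of `-i ∫ p dx`, so that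
`p = i ∂ₓ log P`. -/
def IsPrimitiveExp (L : ℝ) (p P : ℝ → ℝ → ℂ) : Prop :=
  ∃ κ : ℝ → ℂ, (∀ t, κ t ≠ 0) ∧ Differentiable ℝ κ ∧
    ∀ x t, P x t = κ t * exp (-I * primitive L (fun y => p y t) x)

section PrimitiveExp

variable {L δ : ℝ} {p p' q q' P Q : ℝ → ℝ → ℂ}

theorem IsMeanZeroFlow.hasDerivAt_primitive (hL : L ≠ 0) (hp : IsMeanZeroFlow L p p') (x t : ℝ) :
    HasDerivAt (fun s => primitive L (fun y => p y s) x) (primitive L (fun y => p' y t) x) t :=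
  (hp.hasSummableDeriv.bounded_mul (memℓp_inv_derivSymbol hL)).hasDerivAt_trigSeries x t

namespace IsPrimitiveExp

theorem ne_zero (hP : IsPrimitiveExp L p P) (x t : ℝ) : P x t ≠ 0 := by
  obtain ⟨κ, hκ0, -, hPκ⟩ := hP
  rw [hPκ]
  exact mul_ne_zero (hκ0 t) (exp_ne_zero _)

theorem contDiff_slice_x (hL : 0 < L) {n : ℕ} {t : ℝ}
    (hp : IsMeanZeroPeriodic L (n + 1) fun x => p x t) (hP : IsPrimitiveExp L p P) :
    ContDiff ℝ (n + 1 : ℕ) fun x => P x t := by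
  obtain ⟨κ, -, -, hPκ⟩ := hP
  simp only [hPκ]
  exact contDiff_const.mul (contDiff_const.mul (hp.contDiff_primitive hL)).cexp

theorem logDx_eq (hL : 0 < L) {t : ℝ} (hp : IsMeanZeroPeriodic L 1 fun x => p x t)
    (hP : IsPrimitiveExp L p P) (x : ℝ) : logDx P x t = -I * p x t := by
  obtain ⟨κ, hκ0, -, hPκ⟩ := hP
  have hderiv := (((hp.hasDerivAt_primitive hL x).const_mul (-I)).cexp.const_mul (κ t)).deriv
  have : exp (-I * primitive L (fun y => p y t) x) ≠ 0 := exp_ne_zero _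
  have := hκ0 t
  simp only [logDx, logDeriv_apply, hPκ, hderiv]
  field_simp

theorem dx_logDx_eq (hL : 0 < L) {t : ℝ} (hp : IsMeanZeroPeriodic L 1 fun x => p x t)
    (hP : IsPrimitiveExp L p P) (x : ℝ) : dx (logDx P) x t = -I * dx p x t := by
  simp only [dx, hP.logDx_eq hL hp]
  exact deriv_const_mul _ (hp.contDiff.differentiable (by norm_num) x)

theorem hirotaField_eq (hL : 0 < L) {t : ℝ} (hp : IsMeanZeroPeriodic L 1 fun x => p x t)
    (hq : IsMeanZeroPeriodic L 1 fun x => q x t) (hP : IsPrimitiveExp L p P)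
    (hQ : IsPrimitiveExp L q Q) (a : ℂ) (x : ℝ) :
    hirotaField a P Q x t = a + (p x t - q x t) := by
  rw [NcILW.hirotaField_eq ((hP.contDiff_slice_x (n := 0) hL hp).differentiable (by norm_num) x)
    ((hQ.contDiff_slice_x (n := 0) hL hq).differentiable (by norm_num) x) (hP.ne_zero x t)
    (hQ.ne_zero x t),
    hP.logDx_eq hL hp, hQ.logDx_eq hL hq]
  linear_combination (q x t - p x t) * I_sq

theorem differentiable_time (hL : L ≠ 0) (hp : IsMeanZeroFlow L p p') (hP : IsPrimitiveExp L p P)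
    (x : ℝ) : Differentiable ℝ fun t => P x t := by
  obtain ⟨κ, -, hκ, hPκ⟩ := hP
  simp only [hPκ]
  exact hκ.mul fun t => ((hp.hasDerivAt_primitive hL x t).const_mul (-I)).cexp.differentiableAt

theorem hasDerivAt_logDeriv_time (hL : 0 < L) (hp : IsMeanZeroFlow L p p')
    (hP : IsPrimitiveExp L p P) (x t : ℝ) :
    HasDerivAt (fun y => logDeriv (fun s => P y s) t) (-I * p' x t) x := by
  obtain ⟨κ, hκ0, hκ, hPκ⟩ := hP
  have hlog : ∀ y, logDeriv (fun s => P y s) t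
      = logDeriv κ t + -I * primitive L (fun z => p' z t) y := fun y => by
    have hexp := ((hp.hasDerivAt_primitive hL.ne' y t).const_mul (-I)).cexp
    simp only [hPκ]
    rw [logDeriv_mul t (hκ0 t) (exp_ne_zero _) (hκ t) hexp.differentiableAt, logDeriv_apply _ t,
      logDeriv_apply _ t, hexp.deriv, mul_div_cancel_left₀ _ (exp_ne_zero _)]
  simp only [hlog]
  exact (((hp.slice_deriv t).hasDerivAt_primitive hL x).const_mul (-I)).const_add _

theorem hasDerivAt_hirotaDensity (hL : 0 < L) (hp : IsMeanZeroFlow L p p')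
    (hq : IsMeanZeroFlow L q q') (hP : IsPrimitiveExp L p P) (hQ : IsPrimitiveExp L q Q) (a : ℂ)
    (x t : ℝ) :
    HasDerivAt (fun y => hirotaDensity a P Q y t)
      (p' x t - q' x t + 2 * (a + (p x t - q x t)) * (dx p x t - dx q x t)
        + I * (dxx p x t + dxx q x t)) x := by
  have hp1 := fun t => (hp.slice t).of_le one_le_two
  have hq1 := fun t => (hq.slice t).of_le one_le_two
  have hlog : ∀ y, logDeriv (fun s => P y s / Q y s) t
      = logDeriv (fun s => P y s) t - logDeriv (fun s => Q y s) t := fun y =>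
    logDeriv_div t (hP.ne_zero y t) (hQ.ne_zero y t) (hP.differentiable_time hL.ne' hp y t)
      (hQ.differentiable_time hL.ne' hq y t)
  have hslice : ∀ {r r' : ℝ → ℝ → ℂ}, IsMeanZeroFlow L r r' → ∀ y,
      HasDerivAt (fun y => r y t) (dx r y t) y := fun hr y =>
    ((hr.slice t).contDiff.differentiable (by norm_num) y).hasDerivAt
  have hslice_dx : ∀ {r r' : ℝ → ℝ → ℂ}, IsMeanZeroFlow L r r' →
      HasDerivAt (fun y => dx r y t) (dxx r x t) x := fun hr =>
    (((hr.slice t).contDiff.deriv' (n := 1)).differentiable one_ne_zero x).hasDerivAt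
  simp only [hirotaDensity, hlog, hP.hirotaField_eq hL (hp1 t) (hq1 t) hQ,
    hP.dx_logDx_eq hL (hp1 t), hQ.dx_logDx_eq hL (hq1 t)]
  refine (((((hP.hasDerivAt_logDeriv_time hL hp x t).sub
    (hQ.hasDerivAt_logDeriv_time hL hq x t)).const_mul I).add
    ((((hslice hp x).sub (hslice hq x)).const_add a).pow 2)).sub
    (((hslice_dx hp).const_mul (-I)).add ((hslice_dx hq).const_mul (-I)))).congr_deriv ?_
  simp only [Pi.sub_apply]
  push_cast
  linear_combination (q' x t - p' x t) * I_sq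

end IsPrimitiveExp

theorem memℓp_potentialSymbol (hL : 0 < L) (hδ : 0 < δ) :
    Memℓp (fun n => (I * derivSymbol L n)⁻¹ * (cschSymbol L (δ / 2) n / 2)) ⊤ := by
  have heq : (fun n => (I * derivSymbol L n)⁻¹ * (cschSymbol L (δ / 2) n / 2))
      = fun n => -I / 2 * ((derivSymbol L)⁻¹ * cschSymbol L (δ / 2)) n := by
    ext n
    simp only [Pi.mul_apply, Pi.inv_apply, mul_inv, Complex.inv_I]
    ring
  rw [heq]
  exact ((memℓp_inv_derivSymbol hL.ne').infty_mul
    (memℓp_cschSymbol hL (half_pos hδ))).const_mul (-I / 2)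

theorem IsMeanZeroFlow.differentiable_potential (hL : 0 < L) (hδ : 0 < δ)
    (hp : IsMeanZeroFlow L p p') (hq : IsMeanZeroFlow L q q') (x : ℝ) :
    Differentiable ℝ fun t => potential L δ (fun y => p y t - q y t) x := by
  have hneg : Memℓp (-1 : ℤ → ℂ) ⊤ := memℓp_infty_iff.mpr ⟨1, by simp [upperBounds]⟩
  have hcoeff : ∀ t, potentialCoeff L δ (fun y => p y t - q y t)
      = (fun n => (I * derivSymbol L n)⁻¹ * (cschSymbol L (δ / 2) n / 2))
        * ((fcoeff L fun y => p y t) + -1 * fcoeff L fun y => q y t) := fun t => by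
    ext n
    simp only [potentialCoeff, Pi.mul_apply, Pi.add_apply, Pi.neg_apply, Pi.one_apply,
      fcoeff_sub (hp.slice t).contDiff.continuous (hq.slice t).contDiff.continuous, Pi.sub_apply]
    ring
  simp only [potential, hcoeff]
  exact fun t => (((hp.hasSummableDeriv.add (hq.hasSummableDeriv.bounded_mul hneg)).bounded_mul
    (memℓp_potentialSymbol hL hδ)).hasDerivAt_trigSeries x t).differentiableAt

namespace IsHirotaPotential

variable {F : ℂ → ℝ → ℂ} (hL : 0 < L) (hδ : 0 < δ)
  (hpq : ∀ t, IsBoundaryPair L δ (fun x => p x t) fun x => q x t)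
  (hF : IsHirotaPotential L δ (fun x t => p x t - q x t) F)

include hL hδ hpq hF

theorem stripPeriodic : StripPeriodic L δ F := fun t z hz => by
  have heq := (hF.eq_mul_exp_potential hL hδ (fun t => (hpq t).isPotentialSource hL) t).2
  rw [heq z hz, heq (z + L) (by simpa [closedStrip] using hz), periodic_potential hL]

variable (hp : IsMeanZeroFlow L p p') (hq : IsMeanZeroFlow L q q')
  (hF0 : Differentiable ℝ fun t => F 0 t)

include hp hq hF0

theorem isPrimitiveExp_bdryMinus : IsPrimitiveExp L p (bdryMinus δ F) := by
  have heq := hF.eq_mul_exp_potential hL hδ fun t => (hpq t).isPotentialSource hL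
  refine ⟨fun t => F 0 t * exp (-potential L δ (fun y => p y t - q y t) (0 : ℝ)),
    fun t => mul_ne_zero (heq t).1 (exp_ne_zero _),
    hF0.mul (hp.differentiable_potential hL hδ hq 0).neg.cexp, fun x t => ?_⟩
  rw [bdryMinus, (heq t).2 _ (sub_mem_closedStrip hδ x), (hpq t).potential_lower hL hδ, mul_assoc,
    ← Complex.exp_add, ofReal_zero, sub_eq_neg_add]

theorem isPrimitiveExp_bdryPlus : IsPrimitiveExp L q (bdryPlus δ F) := by
  have heq := hF.eq_mul_exp_potential hL hδ fun t => (hpq t).isPotentialSource hL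
  refine ⟨fun t => F 0 t * exp (-potential L δ (fun y => p y t - q y t) (0 : ℝ)),
    fun t => mul_ne_zero (heq t).1 (exp_ne_zero _),
    hF0.mul (hp.differentiable_potential hL hδ hq 0).neg.cexp, fun x t => ?_⟩
  rw [bdryPlus, (heq t).2 _ (add_mem_closedStrip hδ x), (hpq t).potential_upper hL hδ, mul_assoc,
    ← Complex.exp_add, ofReal_zero, sub_eq_neg_add]

theorem bdryRegular : BdryRegular δ F := by
  have hlow := hF.isPrimitiveExp_bdryMinus hL hδ hpq hp hq hF0
  have hup := hF.isPrimitiveExp_bdryPlus hL hδ hpq hp hq hF0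
  exact ⟨fun t => ⟨hup.contDiff_slice_x (n := 1) hL (hq.slice t),
      hlow.contDiff_slice_x (n := 1) hL (hp.slice t)⟩,
    fun x => ⟨hup.differentiable_time hL.ne' hq x, hlow.differentiable_time hL.ne' hp x⟩⟩

end IsHirotaPotential

end PrimitiveExp

/-! ### Boundary parts of a pair of functions -/

/-- For `s = 1` and `s = -1`, the boundary values on `Im z = -δ/2` and on `Im z = δ/2` of the
functions, analytic in the strip, in terms of which `h` and `k` are decomposed: up to sign, the
`u_±` and `v_±` of the paper. -/
def boundaryPart (L δ : ℝ) (s : ℂ) (h k : ℝ → ℂ) (x : ℝ) : ℂ :=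
  s * h x / 2 - I / 2 * (opT L δ h x + opTt L δ k x)

/-- The action of `boundaryPart` on Fourier coefficients. -/
def boundaryCoeff (L δ : ℝ) (s : ℂ) (a b : ℤ → ℂ) : ℤ → ℂ :=
  (fun n => (s + cothSymbol L δ n) / 2) * a + (fun n => cschSymbol L δ n / 2) * b

theorem boundaryPart_sub_boundaryPart_neg (L δ : ℝ) (s : ℂ) (h k : ℝ → ℂ) (x : ℝ) :
    boundaryPart L δ s h k x - boundaryPart L δ (-s) h k x = s * h x := by
  rw [boundaryPart, boundaryPart]; ring

theorem boundaryPart_add_boundaryPart_neg (L δ : ℝ) (s : ℂ) (h k : ℝ → ℂ) (x : ℝ) :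
    boundaryPart L δ s h k x + boundaryPart L δ (-s) h k x
      = -I * (opT L δ h x + opTt L δ k x) := by
  rw [boundaryPart, boundaryPart]; ring

section BoundaryPart

variable {L δ : ℝ}

theorem derivSymbol_mul_boundaryCoeff (s : ℂ) (a b : ℤ → ℂ) :
    derivSymbol L * boundaryCoeff L δ s a b
      = boundaryCoeff L δ s (derivSymbol L * a) (derivSymbol L * b) := by
  rw [boundaryCoeff, boundaryCoeff]; ring

variable (hL : 0 < L) (hδ : 0 < δ)

include hL hδ

theorem memℓp_boundarySymbol (s : ℂ) : Memℓp (fun n => (s + cothSymbol L δ n) / 2) ⊤ := by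
  obtain ⟨B, hB⟩ := memℓp_infty_iff.mp (memℓp_cothSymbol hL hδ)
  refine memℓp_infty_iff.mpr ⟨(‖s‖ + B) / 2, Set.forall_mem_range.mpr fun n => ?_⟩
  rw [norm_div, Complex.norm_two]
  gcongr
  exact (norm_add_le _ _).trans (by gcongr; exact hB (Set.mem_range_self n))

theorem memℓp_half_cschSymbol : Memℓp (fun n => cschSymbol L δ n / 2) ⊤ := by
  simp only [div_eq_inv_mul]
  exact (memℓp_cschSymbol hL hδ).const_mul _

theorem SummableOrder.boundaryCoeff {n : ℕ} {a b : ℤ → ℂ} (s : ℂ) (ha : SummableOrder n a)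
    (hb : SummableOrder n b) : SummableOrder n (boundaryCoeff L δ s a b) :=
  (ha.bounded_mul (memℓp_boundarySymbol hL hδ s)).add (hb.bounded_mul (memℓp_half_cschSymbol hL hδ))

variable {h k : ℝ → ℂ}

theorem boundaryPart_eq_trigSeries (s : ℂ) (hh : IsMeanZeroPeriodic L 1 h)
    (hk : IsMeanZeroPeriodic L 1 k) (x : ℝ) :
    boundaryPart L δ s h k x
      = trigSeries L (boundaryCoeff L δ s (fcoeff L h) (fcoeff L k)) x := by
  have ha := hh.summableOrder_fcoeff (n := 0) hL
  have hb := hk.summableOrder_fcoeff (n := 0) hL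
  set c := (fun n => I * cothSymbol L δ n) * fcoeff L h
    + (fun n => I * cschSymbol L δ n) * fcoeff L k with hc
  have hcs : Summable fun n => ‖c n‖ :=
    ((ha.bounded_mul ((memℓp_cothSymbol hL hδ).const_mul I)).add
      (hb.bounded_mul ((memℓp_cschSymbol hL hδ).const_mul I))).summable_norm
  have hsplit : boundaryCoeff L δ s (fcoeff L h) (fcoeff L k)
      = (fun n => s / 2 * fcoeff L h n) + fun n => -I / 2 * c n := by
    ext n
    simp only [hc, boundaryCoeff, Pi.add_apply, Pi.mul_apply]
    linear_combination
      (cothSymbol L δ n * fcoeff L h n + cschSymbol L δ n * fcoeff L k n) / 2 * I_sq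
  rw [hsplit, trigSeries_add_apply (by simpa only [norm_mul] using ha.summable_norm.mul_left _)
    (by simpa only [norm_mul] using hcs.mul_left _), trigSeries_const_mul, trigSeries_const_mul,
    ← hh.eq_trigSeries hL, ← opT_add_opTt_eq_trigSeries hL hδ hh.periodic hh.contDiff hk.periodic
      hk.contDiff hk.fcoeff_zero, boundaryPart]
  ring

theorem fcoeff_boundaryPart (s : ℂ) (hh : IsMeanZeroPeriodic L 1 h)
    (hk : IsMeanZeroPeriodic L 1 k) :
    fcoeff L (boundaryPart L δ s h k) = boundaryCoeff L δ s (fcoeff L h) (fcoeff L k) := by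
  rw [funext (boundaryPart_eq_trigSeries hL hδ s hh hk)]
  exact fcoeff_trigSeries hL (SummableOrder.boundaryCoeff hL hδ s
    (hh.summableOrder_fcoeff (n := 0) hL) (hk.summableOrder_fcoeff (n := 0) hL)).summable_norm

theorem isMeanZeroPeriodic_boundaryPart {n : ℕ} (s : ℂ) (hh : IsMeanZeroPeriodic L (n + 1) h)
    (hk : IsMeanZeroPeriodic L (n + 1) k) : IsMeanZeroPeriodic L n (boundaryPart L δ s h k) := by
  have hh1 := hh.of_le (Nat.le_add_left 1 n)
  have hk1 := hk.of_le (Nat.le_add_left 1 n)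
  have heq := funext (boundaryPart_eq_trigSeries hL hδ s hh1 hk1)
  refine ⟨heq ▸ periodic_trigSeries hL.ne' _, heq ▸ contDiff_trigSeries
    (SummableOrder.boundaryCoeff hL hδ s (hh.summableOrder_fcoeff hL)
      (hk.summableOrder_fcoeff hL)), ?_⟩
  simp [fcoeff_boundaryPart hL hδ s hh1 hk1, boundaryCoeff, hh.fcoeff_zero, hk.fcoeff_zero]

theorem hasDerivAt_boundaryPart (s : ℂ) (hh : IsMeanZeroPeriodic L 2 h)
    (hk : IsMeanZeroPeriodic L 2 k) (x : ℝ) :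
    HasDerivAt (boundaryPart L δ s h k) (boundaryPart L δ s (deriv h) (deriv k) x) x := by
  have hh1 := hh.of_le one_le_two
  have hk1 := hk.of_le one_le_two
  rw [funext (boundaryPart_eq_trigSeries hL hδ s hh1 hk1), boundaryPart_eq_trigSeries hL hδ s
    (.deriv (n := 1) hL hh.periodic hh.contDiff) (.deriv (n := 1) hL hk.periodic hk.contDiff),
    fcoeff_deriv hL hh.periodic hh1.contDiff, fcoeff_deriv hL hk.periodic hk1.contDiff,
    ← derivSymbol_mul_boundaryCoeff]
  exact hasDerivAt_trigSeries (SummableOrder.boundaryCoeff hL hδ s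
    (hh.summableOrder_fcoeff hL) (hk.summableOrder_fcoeff hL)) x

theorem isBoundaryPair_boundaryPart (hh : IsMeanZeroPeriodic L 2 h)
    (hk : IsMeanZeroPeriodic L 2 k) :
    IsBoundaryPair L δ (boundaryPart L δ 1 h k) (boundaryPart L δ (-1) k h) := by
  have hlow := isMeanZeroPeriodic_boundaryPart (n := 1) hL hδ 1 hh hk
  have hup := isMeanZeroPeriodic_boundaryPart (n := 1) hL hδ (-1) hk hh
  refine ⟨hlow.periodic, hup.periodic, hlow.contDiff, hup.contDiff, hlow.fcoeff_zero, fun n => ?_⟩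
  have hh1 := hh.of_le one_le_two
  have hk1 := hk.of_le one_le_two
  rw [fcoeff_boundaryPart hL hδ _ hh1 hk1, fcoeff_boundaryPart hL hδ _ hk1 hh1, mode_I_mul]
  rcases eq_or_ne n 0 with rfl | hn
  · simp [boundaryCoeff, hh.fcoeff_zero, hk.fcoeff_zero]
  have hinv : exp (freq L δ n) * exp (-freq L δ n) = 1 := by
    rw [← Complex.exp_add, add_neg_cancel, Complex.exp_zero]
  simp only [boundaryCoeff, Pi.add_apply, Pi.mul_apply]
  linear_combination -fcoeff L h n / 2 * cothSymbol_add_one_mul_exp_neg hL hδ hn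
    + fcoeff L k n / 2 * exp (-freq L δ n) * cothSymbol_sub_one_mul_exp hL hδ hn
    - fcoeff L k n / 2 * (cothSymbol L δ n - 1) * hinv

end BoundaryPart

/-! ### Solutions of the ncILW equation -/

/-- `boundaryPart` of the deviations of `u` and `v` from `ubar` and `vbar`, at every time. -/
def boundaryFlow (L δ : ℝ) (s ubar vbar : ℂ) (u v : ℝ → ℝ → ℂ) (x t : ℝ) : ℂ :=
  boundaryPart L δ s (fun y => u y t - ubar) (fun y => v y t - vbar) x

/-- The common form of the two ncILW equations: `s = 1` gives the left-hand side of the first one,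
and `s = -1`, with `u` and `v` interchanged, the negative of that of the second one. -/
def ncILWForm (L δ : ℝ) (s : ℂ) (u v : ℝ → ℝ → ℂ) (x t : ℝ) : ℂ :=
  s * dt u x t + 2 * u x t * dx u x t
    + (opT L δ (fun y => dxx u y t) x + opTt L δ (fun y => dxx v y t) x)

/-- The functions of class `C^3` that are periodic in `x`, with mean `ubar` at every time. -/
structure HasConstantMean (L : ℝ) (u : ℝ → ℝ → ℂ) (ubar : ℂ) : Prop where
  contDiff : ContDiff ℝ 3 fun p : ℝ × ℝ => u p.1 p.2
  periodic : ∀ t, Function.Periodic (fun x => u x t) L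
  mean_eq : ∀ t, mean L (fun x => u x t) = ubar

section Solutions

variable {L δ : ℝ} {s ubar vbar : ℂ} {u v : ℝ → ℝ → ℂ}

theorem SolvesNcILW.ncILWForm_one (h : SolvesNcILW L δ u v) (x t : ℝ) :
    ncILWForm L δ 1 u v x t = 0 := by
  rw [ncILWForm]; linear_combination (h x t).2.2.1

theorem SolvesNcILW.ncILWForm_neg_one (h : SolvesNcILW L δ u v) (x t : ℝ) :
    ncILWForm L δ (-1) v u x t = 0 := by
  rw [ncILWForm]; linear_combination -(h x t).2.2.2

variable (hL : 0 < L)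

include hL

theorem isMeanZeroPeriodic_dxx (hu : ContDiff ℝ 3 fun p : ℝ × ℝ => u p.1 p.2) {t : ℝ}
    (hp : Function.Periodic (fun x => u x t) L) :
    IsMeanZeroPeriodic L 1 fun x => dxx u x t :=
  .deriv (n := 1) hL (periodic_deriv hp)
    ((contDiff_slice_x hu t).deriv' (n := 2))

theorem fcoeff_dt_zero_of_ncILWForm_eq_zero (hδ : 0 < δ) (hs : s ≠ 0)
    (hu : ContDiff ℝ 3 fun p : ℝ × ℝ => u p.1 p.2) (hv : ContDiff ℝ 3 fun p : ℝ × ℝ => v p.1 p.2)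
    {t : ℝ} (hup : Function.Periodic (fun x => u x t) L)
    (hvp : Function.Periodic (fun x => v x t) L) (h : ∀ x, ncILWForm L δ s u v x t = 0) :
    fcoeff L (fun x => dt u x t) 0 = 0 := by
  have hslice := contDiff_slice_x hu t
  have hsq : ContDiff ℝ 1 fun x => u x t ^ 2 := (hslice.pow 2).of_le (by norm_num)
  have hTT := isMeanZeroPeriodic_boundaryPart (n := 0) hL hδ 0 (isMeanZeroPeriodic_dxx hL hu hup)
    (isMeanZeroPeriodic_dxx hL hv hvp)
  have hTT_cont : Continuous fun x =>
      2 * I * boundaryPart L δ 0 (fun y => dxx u y t) (fun y => dxx v y t) x :=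
    continuous_const.mul hTT.contDiff.continuous
  have hdt : (fun x => dt u x t) = fun x => -s⁻¹ * (deriv (fun y => u y t ^ 2) x + 2 * I *
      boundaryPart L δ 0 (fun y => dxx u y t) (fun y => dxx v y t) x) := by
    ext x
    have hdsq : deriv (fun y => u y t ^ 2) x = 2 * u x t * dx u x t := by
      simpa only [dx, Nat.cast_ofNat, pow_one, Nat.add_one_sub_one] using
        ((hslice.differentiable (by norm_num) x).hasDerivAt.fun_pow 2).deriv
    have hform := h x
    rw [ncILWForm] at hform
    rw [hdsq, boundaryPart]
    linear_combination s⁻¹ * hform - dt u x t * inv_mul_cancel₀ hs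
      - s⁻¹ * (opT L δ (fun y => dxx u y t) x + opTt L δ (fun y => dxx v y t) x) * I_sq
  rw [hdt, fcoeff_const_mul, fcoeff_add hsq.continuous_deriv_one hTT_cont, Pi.add_apply,
    fcoeff_const_mul, hTT.fcoeff_zero, fcoeff_deriv_zero hL (fun x => congrArg (· ^ 2) (hup x)) hsq]
  ring

theorem hasConstantMean_of_ncILWForm_eq_zero (hδ : 0 < δ) (hs : s ≠ 0)
    (hu : ContDiff ℝ 3 fun p : ℝ × ℝ => u p.1 p.2) (hv : ContDiff ℝ 3 fun p : ℝ × ℝ => v p.1 p.2)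
    (hup : ∀ t, Function.Periodic (fun x => u x t) L)
    (hvp : ∀ t, Function.Periodic (fun x => v x t) L) (h : ∀ x t, ncILWForm L δ s u v x t = 0) :
    HasConstantMean L u (mean L fun x => u x 0) := by
  have hderiv : ∀ t, HasDerivAt (fun s => fcoeff L (fun x => u x s) 0) 0 t := fun t =>
    (hasDerivAt_fcoeff_time (hu.of_le (by norm_num)) 0 t).congr_deriv
      (fcoeff_dt_zero_of_ncILWForm_eq_zero hL hδ hs hu hv (hup t) (hvp t) fun x => h x t)
  refine ⟨hu, hup, fun t => ?_⟩
  rw [← fcoeff_zero_eq_mean, ← fcoeff_zero_eq_mean]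
  exact is_const_of_deriv_eq_zero (fun t => (hderiv t).differentiableAt)
    (fun t => (hderiv t).deriv) t 0

namespace HasConstantMean

theorem isMeanZeroPeriodic_sub (hu : HasConstantMean L u ubar) (t : ℝ) :
    IsMeanZeroPeriodic L 3 fun x => u x t - ubar where
  periodic := (hu.periodic t).sub fun _ => rfl
  contDiff := (contDiff_slice_x hu.contDiff t).sub contDiff_const
  fcoeff_zero := by
    rw [fcoeff_sub (contDiff_slice_x hu.contDiff t).continuous continuous_const, Pi.sub_apply,
      fcoeff_const hL, if_pos rfl, fcoeff_zero_eq_mean, hu.mean_eq, sub_self]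

omit hL in
theorem isMeanZeroPeriodic_dt (hu : HasConstantMean L u ubar) (t : ℝ) :
    IsMeanZeroPeriodic L 2 fun x => dt u x t where
  periodic := periodic_dt hu.periodic t
  contDiff := contDiff_slice_x (contDiff_dt (n := 2) hu.contDiff) t
  fcoeff_zero := by
    have hderiv := hasDerivAt_fcoeff_time (L := L) (hu.contDiff.of_le (by norm_num)) 0 t
    simp only [fcoeff_zero_eq_mean L (fun x => u x _), hu.mean_eq] at hderiv
    exact hderiv.unique (hasDerivAt_const t ubar)

theorem hasSummableDeriv_sub (hu : HasConstantMean L u ubar) :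
    HasSummableDeriv (fun t => fcoeff L fun x => u x t - ubar)
      fun t => fcoeff L fun x => dt u x t := by
  have hdt : ∀ x t, dt (fun y s => u y s - ubar) x t = dt u x t := fun x t =>
    deriv_sub_const ubar
  simpa only [hdt] using hasSummableDeriv_fcoeff (u := fun x t => u x t - ubar) hL
    (hu.contDiff.sub contDiff_const) fun t => (hu.isMeanZeroPeriodic_sub hL t).periodic

variable (hδ : 0 < δ) (hu : HasConstantMean L u ubar) (hv : HasConstantMean L v vbar)

include hδ hu hv

theorem isBoundaryPair_boundaryFlow (t : ℝ) :
    IsBoundaryPair L δ (fun x => boundaryFlow L δ 1 ubar vbar u v x t)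
      fun x => boundaryFlow L δ (-1) vbar ubar v u x t :=
  isBoundaryPair_boundaryPart hL hδ ((hu.isMeanZeroPeriodic_sub hL t).of_le (by norm_num))
    ((hv.isMeanZeroPeriodic_sub hL t).of_le (by norm_num))

theorem isMeanZeroFlow_boundaryFlow (s : ℂ) :
    IsMeanZeroFlow L (boundaryFlow L δ s ubar vbar u v) fun x t =>
      boundaryPart L δ s (fun y => dt u y t) (fun y => dt v y t) x where
  slice t := isMeanZeroPeriodic_boundaryPart hL hδ s (hu.isMeanZeroPeriodic_sub hL t)
    (hv.isMeanZeroPeriodic_sub hL t)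
  slice_deriv t := isMeanZeroPeriodic_boundaryPart hL hδ s (hu.isMeanZeroPeriodic_dt t)
    (hv.isMeanZeroPeriodic_dt t)
  hasSummableDeriv := by
    have hflow : (fun t => fcoeff L fun x => boundaryFlow L δ s ubar vbar u v x t) = fun t =>
        boundaryCoeff L δ s (fcoeff L fun x => u x t - ubar) (fcoeff L fun x => v x t - vbar) :=
      funext fun t => fcoeff_boundaryPart hL hδ s
        ((hu.isMeanZeroPeriodic_sub hL t).of_le (by norm_num))
        ((hv.isMeanZeroPeriodic_sub hL t).of_le (by norm_num))
    have hflow_dt : (fun t => fcoeff L (boundaryPart L δ s (fun y => dt u y t) fun y => dt v y t))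
        = fun t => boundaryCoeff L δ s (fcoeff L fun x => dt u x t) (fcoeff L fun x => dt v x t) :=
      funext fun t => fcoeff_boundaryPart hL hδ s
        ((hu.isMeanZeroPeriodic_dt t).of_le one_le_two)
        ((hv.isMeanZeroPeriodic_dt t).of_le one_le_two)
    rw [hflow, hflow_dt]
    exact ((hu.hasSummableDeriv_sub hL).bounded_mul (memℓp_boundarySymbol hL hδ s)).add
      ((hv.hasSummableDeriv_sub hL).bounded_mul (memℓp_half_cschSymbol hL hδ))

theorem dx_boundaryFlow (s : ℂ) (x t : ℝ) :
    dx (boundaryFlow L δ s ubar vbar u v) x t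
      = boundaryPart L δ s (fun y => dx u y t) (fun y => dx v y t) x := by
  have hsub : ∀ (w : ℝ → ℝ → ℂ) (wbar : ℂ), deriv (fun y => w y t - wbar) = fun y => dx w y t :=
    fun w wbar => funext fun y => deriv_sub_const wbar
  have h := hasDerivAt_boundaryPart hL hδ s ((hu.isMeanZeroPeriodic_sub hL t).of_le (by norm_num))
    ((hv.isMeanZeroPeriodic_sub hL t).of_le (by norm_num)) x
  rw [hsub, hsub] at h
  exact h.deriv

theorem dxx_boundaryFlow (s : ℂ) (x t : ℝ) :
    dxx (boundaryFlow L δ s ubar vbar u v) x t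
      = boundaryPart L δ s (fun y => dxx u y t) (fun y => dxx v y t) x := by
  have hdx : ∀ {w : ℝ → ℝ → ℂ} {wbar : ℂ}, HasConstantMean L w wbar →
      IsMeanZeroPeriodic L 2 fun y => dx w y t := fun hw =>
    .deriv (n := 2) hL (hw.periodic t) (contDiff_slice_x hw.contDiff t)
  simp only [dxx, hu.dx_boundaryFlow hL hδ hv]
  exact (hasDerivAt_boundaryPart hL hδ s (hdx hu) (hdx hv) x).deriv

theorem hasDerivAt_hirotaDensity (hs : s ^ 2 = 1) {P Q : ℝ → ℝ → ℂ}
    (hP : IsPrimitiveExp L (boundaryFlow L δ s ubar vbar u v) P)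
    (hQ : IsPrimitiveExp L (boundaryFlow L δ (-s) ubar vbar u v) Q) (x t : ℝ) :
    HasDerivAt (fun y => hirotaDensity (s * ubar) P Q y t) (ncILWForm L δ s u v x t) x := by
  refine (hP.hasDerivAt_hirotaDensity hL (hu.isMeanZeroFlow_boundaryFlow hL hδ hv s)
    (hu.isMeanZeroFlow_boundaryFlow hL hδ hv (-s)) hQ (s * ubar) x t).congr_deriv ?_
  rw [hu.dx_boundaryFlow hL hδ hv, hu.dx_boundaryFlow hL hδ hv, hu.dxx_boundaryFlow hL hδ hv,
    hu.dxx_boundaryFlow hL hδ hv, boundaryFlow, boundaryFlow, boundaryPart_sub_boundaryPart_neg,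
    boundaryPart_sub_boundaryPart_neg, boundaryPart_sub_boundaryPart_neg,
    boundaryPart_add_boundaryPart_neg, ncILWForm]
  linear_combination 2 * u x t * dx u x t * hs
    - (opT L δ (fun y => dxx u y t) x + opTt L δ (fun y => dxx v y t) x) * I_sq

end HasConstantMean

end Solutions

section BoundaryFlow

variable (L δ : ℝ) (ubar vbar : ℂ) (u v : ℝ → ℝ → ℂ) (x t : ℝ)

theorem uPlus_eq_boundaryFlow :
    uPlus L δ ubar vbar u v x t = boundaryFlow L δ 1 ubar vbar u v x t := by
  rw [uPlus, TTt, boundaryFlow, boundaryPart, one_mul]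

theorem uMinus_eq_neg_boundaryFlow :
    uMinus L δ ubar vbar u v x t = -boundaryFlow L δ (-1) ubar vbar u v x t := by
  rw [uMinus, TTt, boundaryFlow, boundaryPart]
  ring

theorem uPlus_add_vPlus : uPlus L δ ubar vbar u v x t + vPlus L δ ubar vbar u v x t
    = boundaryFlow L δ 1 ubar vbar u v x t - boundaryFlow L δ (-1) vbar ubar v u x t := by
  rw [uPlus_eq_boundaryFlow, sub_eq_add_neg, ← uMinus_eq_neg_boundaryFlow]
  rfl

theorem uMinus_add_vMinus : uMinus L δ ubar vbar u v x t + vMinus L δ ubar vbar u v x t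
    = boundaryFlow L δ 1 vbar ubar v u x t - boundaryFlow L δ (-1) ubar vbar u v x t := by
  rw [← uPlus_add_vPlus, add_comm]
  rfl

theorem uPlus_sub_uMinus : uPlus L δ ubar vbar u v x t - uMinus L δ ubar vbar u v x t
    = boundaryFlow L δ 1 ubar vbar u v x t + boundaryFlow L δ (-1) ubar vbar u v x t := by
  rw [uPlus_eq_boundaryFlow, uMinus_eq_neg_boundaryFlow, sub_neg_eq_add]

theorem vPlus_sub_vMinus : vPlus L δ ubar vbar u v x t - vMinus L δ ubar vbar u v x t
    = -(boundaryFlow L δ (-1) vbar ubar v u x t + boundaryFlow L δ 1 vbar ubar v u x t) := by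
  rw [add_comm, ← uPlus_sub_uMinus, neg_sub]
  rfl

end BoundaryFlow

namespace HasConstantMean

variable {L δ : ℝ} {s ubar vbar : ℂ} {u v : ℝ → ℝ → ℂ} (hL : 0 < L) (hδ : 0 < δ)
  (hu : HasConstantMean L u ubar) (hv : HasConstantMean L v vbar)

include hL hδ hu hv

theorem differentiable_boundaryFlow (s : ℂ) (t : ℝ) :
    Differentiable ℝ fun x => boundaryFlow L δ s ubar vbar u v x t :=
  ((hu.isMeanZeroFlow_boundaryFlow hL hδ hv s).slice t).contDiff.differentiable (by norm_num)

section Flow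

variable {P Q : ℝ → ℝ → ℂ} (hP : IsPrimitiveExp L (boundaryFlow L δ s ubar vbar u v) P)
  (hQ : IsPrimitiveExp L (boundaryFlow L δ (-s) ubar vbar u v) Q)

include hP hQ

theorem hirotaField_eq (x t : ℝ) : hirotaField (s * ubar) P Q x t = s * u x t := by
  have hslice := fun s =>
    ((hu.isMeanZeroFlow_boundaryFlow hL hδ hv s).slice t).of_le one_le_two
  rw [hP.hirotaField_eq hL (hslice s) (hslice (-s)) hQ, boundaryFlow, boundaryFlow,
    boundaryPart_sub_boundaryPart_neg]
  ring

theorem hirotaDensity_eq (hs : s ^ 2 = 1) (x t : ℝ) :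
    hirotaDensity (s * ubar) P Q x t = I * logDeriv (fun r => P x r / Q x r) t + u x t ^ 2
      + I * dx (fun y r => boundaryFlow L δ s ubar vbar u v y r
        + boundaryFlow L δ (-s) ubar vbar u v y r) x t := by
  have hslice := fun s =>
    ((hu.isMeanZeroFlow_boundaryFlow hL hδ hv s).slice t).of_le one_le_two
  have hdx : dx (fun y r => boundaryFlow L δ s ubar vbar u v y r
      + boundaryFlow L δ (-s) ubar vbar u v y r) x t = _ :=
    deriv_fun_add (hu.differentiable_boundaryFlow hL hδ hv s t x)
      (hu.differentiable_boundaryFlow hL hδ hv (-s) t x)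
  rw [hirotaDensity, hu.hirotaField_eq hL hδ hv hP hQ, hP.dx_logDx_eq hL (hslice s),
    hQ.dx_logDx_eq hL (hslice (-s)), hdx, dx, dx]
  linear_combination u x t ^ 2 * hs

theorem exists_hirotaForm_eq_zero (hs : s ^ 2 = 1) (h : ∀ x t, ncILWForm L δ s u v x t = 0) :
    ∃ l : ℝ → ℂ, (∀ x t, l t = I * logDeriv (fun r => P x r / Q x r) t + u x t ^ 2
      + I * dx (fun y r => boundaryFlow L δ s ubar vbar u v y r
        + boundaryFlow L δ (-s) ubar vbar u v y r) x t) ∧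
      ∀ x t, hirotaForm (s * ubar) (l t) P Q x t = 0 := by
  have hflow := hu.isMeanZeroFlow_boundaryFlow hL hδ hv
  have hconst : ∀ x t,
      hirotaDensity (s * ubar) P Q x t = hirotaDensity (s * ubar) P Q 0 t := fun x t => by
    have hderiv := fun y =>
      (hu.hasDerivAt_hirotaDensity hL hδ hv hs hP hQ y t).congr_deriv (h y t)
    exact is_const_of_deriv_eq_zero (fun y => (hderiv y).differentiableAt)
      (fun y => (hderiv y).deriv) x 0
  exact ⟨fun t => hirotaDensity (s * ubar) P Q 0 t,
    fun x t => (hconst x t).symm.trans (hu.hirotaDensity_eq hL hδ hv hP hQ hs x t),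
    fun x t => (hirotaForm_eq_zero_iff (hP.contDiff_slice_x (n := 1) hL ((hflow s).slice t))
      (hQ.contDiff_slice_x (n := 1) hL ((hflow (-s)).slice t))
      (hP.differentiable_time hL.ne' (hflow s) x t)
      (hQ.differentiable_time hL.ne' (hflow (-s)) x t) (hP.ne_zero x t) (hQ.ne_zero x t) _).2
      (hconst x t)⟩

end Flow

section Potential

theorem exists_isHirotaPotential {c : ℝ → ℂ} (hc : ∀ t, c t ≠ 0) :
    ∃ F : ℂ → ℝ → ℂ, IsHirotaPotential L δ (fun x t =>
      boundaryFlow L δ 1 ubar vbar u v x t - boundaryFlow L δ (-1) vbar ubar v u x t) F ∧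
      ∀ t, F 0 t = c t :=
  NcILW.exists_isHirotaPotential hL hδ
    (fun t => (hu.isBoundaryPair_boundaryFlow hL hδ hv t).isPotentialSource hL) hc

variable {F G : ℂ → ℝ → ℂ}
  (hF : IsHirotaPotential L δ (fun x t =>
    boundaryFlow L δ 1 ubar vbar u v x t - boundaryFlow L δ (-1) vbar ubar v u x t) F)

include hF

theorem stripPeriodic : StripPeriodic L δ F :=
  hF.stripPeriodic hL hδ (hu.isBoundaryPair_boundaryFlow hL hδ hv)

variable (hF0 : Differentiable ℝ fun t => F 0 t)

include hF0

theorem bdryRegular : BdryRegular δ F :=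
  hF.bdryRegular hL hδ (hu.isBoundaryPair_boundaryFlow hL hδ hv)
    (hu.isMeanZeroFlow_boundaryFlow hL hδ hv 1) (hv.isMeanZeroFlow_boundaryFlow hL hδ hu (-1)) hF0

theorem isPrimitiveExp_bdryMinus :
    IsPrimitiveExp L (boundaryFlow L δ 1 ubar vbar u v) (bdryMinus δ F) :=
  hF.isPrimitiveExp_bdryMinus hL hδ (hu.isBoundaryPair_boundaryFlow hL hδ hv)
    (hu.isMeanZeroFlow_boundaryFlow hL hδ hv 1) (hv.isMeanZeroFlow_boundaryFlow hL hδ hu (-1)) hF0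

theorem isPrimitiveExp_bdryPlus :
    IsPrimitiveExp L (boundaryFlow L δ (-1) vbar ubar v u) (bdryPlus δ F) :=
  hF.isPrimitiveExp_bdryPlus hL hδ (hu.isBoundaryPair_boundaryFlow hL hδ hv)
    (hu.isMeanZeroFlow_boundaryFlow hL hδ hv 1) (hv.isMeanZeroFlow_boundaryFlow hL hδ hu (-1)) hF0

variable
  (hG : IsHirotaPotential L δ (fun x t =>
    boundaryFlow L δ 1 vbar ubar v u x t - boundaryFlow L δ (-1) ubar vbar u v x t) G)
  (hG0 : Differentiable ℝ fun t => G 0 t)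

include hG hG0

theorem eq_uOfFG (x t : ℝ) : u x t = uOfFG δ ubar F G x t := by
  have h := hu.hirotaField_eq hL hδ hv (hu.isPrimitiveExp_bdryMinus hL hδ hv hF hF0)
    (hv.isPrimitiveExp_bdryPlus hL hδ hu hG hG0) x t
  rw [one_mul, one_mul] at h
  exact h.symm

theorem exists_hirotaSystem (h : SolvesNcILW L δ u v) :
    ∃ lam1 lam2 : ℝ → ℂ,
      (∀ x t, lam1 t = I * logDeriv (fun s => bdryMinus δ F x s / bdryPlus δ G x s) t + u x t ^ 2
        + I * dx (fun y s =>
          boundaryFlow L δ 1 ubar vbar u v y s + boundaryFlow L δ (-1) ubar vbar u v y s) x t) ∧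
      (∀ x t, lam2 t = I * logDeriv (fun s => bdryPlus δ F x s / bdryMinus δ G x s) t + v x t ^ 2
        + I * dx (fun y s =>
          boundaryFlow L δ (-1) vbar ubar v u y s + boundaryFlow L δ 1 vbar ubar v u y s) x t) ∧
      HirotaSystem δ ubar vbar lam1 lam2 F G := by
  have hGminus : IsPrimitiveExp L (boundaryFlow L δ (-(-1)) vbar ubar v u) (bdryMinus δ G) := by
    rw [neg_neg]
    exact hv.isPrimitiveExp_bdryMinus hL hδ hu hG hG0
  obtain ⟨lam1, hlam1, hform1⟩ := hu.exists_hirotaForm_eq_zero hL hδ hv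
    (hu.isPrimitiveExp_bdryMinus hL hδ hv hF hF0) (hv.isPrimitiveExp_bdryPlus hL hδ hu hG hG0)
    (one_pow 2) h.ncILWForm_one
  obtain ⟨lam2, hlam2, hform2⟩ := hv.exists_hirotaForm_eq_zero hL hδ hu
    (hu.isPrimitiveExp_bdryPlus hL hδ hv hF hF0) hGminus neg_one_sq h.ncILWForm_neg_one
  rw [one_mul] at hform1
  rw [neg_one_mul] at hform2
  rw [neg_neg] at hlam2
  exact ⟨lam1, lam2, hlam1, hlam2, hirotaSystem_iff.2 ⟨hform1, hform2⟩⟩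

end Potential

end HasConstantMean

end

end NcILW

theorem mainTheorem2 (L δ : ℝ) (hL : 0 < L) (hδ : 0 < δ) :
    -- (A)
    (∀ F G : ℂ → ℝ → ℂ,
      NcILW.StripPeriodic L δ F → NcILW.StripPeriodic L δ G →
      (∀ t, NcILW.HasAnalyticLog δ (fun z => F z t)) →
      (∀ t, NcILW.HasAnalyticLog δ (fun z => G z t)) →
      NcILW.BdryContDiff δ 4 F → NcILW.BdryContDiff δ 4 G →
      ∀ ubar vbar : ℂ,
        (∃ lam1 lam2 : ℝ → ℂ, NcILW.HirotaSystem δ ubar vbar lam1 lam2 F G) ↔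
          NcILW.SolvesNcILW L δ (NcILW.uOfFG δ ubar F G) (NcILW.vOfFG δ vbar F G)) ∧
    -- (B)
    (∀ u v : ℝ → ℝ → ℂ,
      ContDiff ℝ 3 (fun p : ℝ × ℝ => u p.1 p.2) → ContDiff ℝ 3 (fun p : ℝ × ℝ => v p.1 p.2) →
      (∀ t, Function.Periodic (fun x => u x t) L) → (∀ t, Function.Periodic (fun x => v x t) L) →
      NcILW.SolvesNcILW L δ u v →
      ∀ ubar vbar : ℂ,
        NcILW.mean L (fun x => u x 0) = ubar → NcILW.mean L (fun x => v x 0) = vbar →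
        -- the means are constant in time
        (∀ t, NcILW.mean L (fun x => u x t) = ubar ∧ NcILW.mean L (fun x => v x t) = vbar) ∧
        -- existence of `F` and `G`, with arbitrary normalizations at `z = 0`
        (∀ c d : ℝ → ℂ, (∀ t, c t ≠ 0) → (∀ t, d t ≠ 0) →
          ∃ F G : ℂ → ℝ → ℂ,
            NcILW.IsHirotaPotential L δ (fun y s =>
              NcILW.uPlus L δ ubar vbar u v y s + NcILW.vPlus L δ ubar vbar u v y s) F ∧
            NcILW.IsHirotaPotential L δ (fun y s =>
              NcILW.uMinus L δ ubar vbar u v y s + NcILW.vMinus L δ ubar vbar u v y s) G ∧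
            (∀ t, F 0 t = c t) ∧ (∀ t, G 0 t = d t)) ∧
        -- uniqueness of `F` and of `G` up to a factor that depends on `t` only
        (∀ F₁ F₂ : ℂ → ℝ → ℂ,
          NcILW.IsHirotaPotential L δ (fun y s =>
            NcILW.uPlus L δ ubar vbar u v y s + NcILW.vPlus L δ ubar vbar u v y s) F₁ →
          NcILW.IsHirotaPotential L δ (fun y s =>
            NcILW.uPlus L δ ubar vbar u v y s + NcILW.vPlus L δ ubar vbar u v y s) F₂ →
          ∃ c : ℝ → ℂ, ∀ t, c t ≠ 0 ∧ ∀ z ∈ NcILW.closedStrip δ, F₂ z t = c t * F₁ z t) ∧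
        (∀ G₁ G₂ : ℂ → ℝ → ℂ,
          NcILW.IsHirotaPotential L δ (fun y s =>
            NcILW.uMinus L δ ubar vbar u v y s + NcILW.vMinus L δ ubar vbar u v y s) G₁ →
          NcILW.IsHirotaPotential L δ (fun y s =>
            NcILW.uMinus L δ ubar vbar u v y s + NcILW.vMinus L δ ubar vbar u v y s) G₂ →
          ∃ d : ℝ → ℂ, ∀ t, d t ≠ 0 ∧ ∀ z ∈ NcILW.closedStrip δ, G₂ z t = d t * G₁ z t) ∧
        -- every such pair, with normalizations differentiable in `t`, solves the bilinear system
        (∀ F G : ℂ → ℝ → ℂ,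
          NcILW.IsHirotaPotential L δ (fun y s =>
            NcILW.uPlus L δ ubar vbar u v y s + NcILW.vPlus L δ ubar vbar u v y s) F →
          NcILW.IsHirotaPotential L δ (fun y s =>
            NcILW.uMinus L δ ubar vbar u v y s + NcILW.vMinus L δ ubar vbar u v y s) G →
          Differentiable ℝ (fun t => F 0 t) → Differentiable ℝ (fun t => G 0 t) →
          NcILW.StripPeriodic L δ F ∧ NcILW.StripPeriodic L δ G ∧
          NcILW.BdryRegular δ F ∧ NcILW.BdryRegular δ G ∧
          (∀ x t, u x t = NcILW.uOfFG δ ubar F G x t ∧ v x t = NcILW.vOfFG δ vbar F G x t) ∧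
          (∀ t, Differentiable ℝ (fun x =>
              NcILW.uPlus L δ ubar vbar u v x t - NcILW.uMinus L δ ubar vbar u v x t) ∧
            Differentiable ℝ (fun x =>
              NcILW.vPlus L δ ubar vbar u v x t - NcILW.vMinus L δ ubar vbar u v x t)) ∧
          ∃ lam1 lam2 : ℝ → ℂ,
            (∀ x t, lam1 t =
              Complex.I * logDeriv (fun s : ℝ =>
                NcILW.bdryMinus δ F x s / NcILW.bdryPlus δ G x s) t + u x t ^ 2 +
              Complex.I * NcILW.dx (fun y s =>
                NcILW.uPlus L δ ubar vbar u v y s - NcILW.uMinus L δ ubar vbar u v y s) x t) ∧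
            (∀ x t, lam2 t =
              Complex.I * logDeriv (fun s : ℝ =>
                NcILW.bdryPlus δ F x s / NcILW.bdryMinus δ G x s) t + v x t ^ 2 -
              Complex.I * NcILW.dx (fun y s =>
                NcILW.vPlus L δ ubar vbar u v y s - NcILW.vMinus L δ ubar vbar u v y s) x t) ∧
            NcILW.HirotaSystem δ ubar vbar lam1 lam2 F G)) := by
  refine ⟨fun F G hFp hGp hFl hGl hF hG ubar vbar =>
    NcILW.exists_hirotaSystem_iff_solvesNcILW hL hδ hFp hGp hFl hGl hF hG ubar vbar, ?_⟩
  rintro u v hu hv hup hvp hsol _ _ rfl rfl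
  have hmu := NcILW.hasConstantMean_of_ncILWForm_eq_zero hL hδ one_ne_zero hu hv hup hvp
    hsol.ncILWForm_one
  have hmv := NcILW.hasConstantMean_of_ncILWForm_eq_zero hL hδ (neg_ne_zero.2 one_ne_zero) hv hu
    hvp hup hsol.ncILWForm_neg_one
  simp only [NcILW.uPlus_add_vPlus, NcILW.uMinus_add_vMinus, NcILW.uPlus_sub_uMinus,
    NcILW.vPlus_sub_vMinus]
  refine ⟨fun t => ⟨hmu.mean_eq t, hmv.mean_eq t⟩, fun c d hc hd => ?_,
    fun _ _ => NcILW.IsHirotaPotential.exists_eq_const_mul hδ,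
    fun _ _ => NcILW.IsHirotaPotential.exists_eq_const_mul hδ, fun F G hF hG hF0 hG0 => ?_⟩
  · obtain ⟨F, hF, hFc⟩ := hmu.exists_isHirotaPotential hL hδ hmv hc
    obtain ⟨G, hG, hGd⟩ := hmv.exists_isHirotaPotential hL hδ hmu hd
    exact ⟨F, G, hF, hG, hFc, hGd⟩
  · obtain ⟨lam1, lam2, hlam1, hlam2, hH⟩ :=
      hmu.exists_hirotaSystem hL hδ hmv hF hF0 hG hG0 hsol
    exact ⟨hmu.stripPeriodic hL hδ hmv hF, hmv.stripPeriodic hL hδ hmu hG,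
      hmu.bdryRegular hL hδ hmv hF hF0, hmv.bdryRegular hL hδ hmu hG hG0,
      fun x t => ⟨hmu.eq_uOfFG hL hδ hmv hF hF0 hG hG0 x t,
        hmv.eq_uOfFG hL hδ hmu hG hG0 hF hF0 x t⟩,
      fun t => ⟨(hmu.differentiable_boundaryFlow hL hδ hmv 1 t).add
          (hmu.differentiable_boundaryFlow hL hδ hmv (-1) t),
        ((hmv.differentiable_boundaryFlow hL hδ hmu (-1) t).add
          (hmv.differentiable_boundaryFlow hL hδ hmu 1 t)).neg⟩,
      lam1, lam2, hlam1,
      fun x t => by simp only [hlam2 x t, NcILW.dx, deriv.fun_neg, mul_neg, sub_neg_eq_add], hH⟩
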